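/- **Setting.** For bounded real sequences $a=(a_n)_{n\in\mathbb Z}$, $b=(b_n)_{n\in\mathbb Z}$ with $\inf_n a_n>0$, let $J$ be the Jacobi operator $(J\phi)_n=a_{n-1}\phi_{n-1}+b_n\phi_n+a_n\phi_{n+1}$ on $\ell^2(\mathbb Z)$. Write $J\in\mathcal J(R)$ if $1/R\le a_n\le R$ and $|b_n|\le R$ for all $n$; $J$ is $q$-periodic if $a_{n+q}=a_n$ and $b_{n+q}=b_n$ for all $n$. Let $A=i[J,X]$, where $(X\phi)_n=n\phi_n$; it extends to the bounded operator $(A\phi)_n=ia_n\phi_{n+1}-ia_{n-1}\phi_{n-1}$. Let $J$ be $q$-periodic. The Floquet transform $\mathcal F_q:\ell^2(\mathbb Z)\to L^2([0,1);\mathbb C^q)$ is $(\mathcal F_q\phi)_k(\theta)=\sum_{p\in\mathbb Z}\phi_{k+pq}e^{-2\pi ip\theta}$, $0\le k\le q-1$. Let $J(\theta)$ be the Hermitian $q\times q$ matrix, with rows and columns numbered $0,\dots,q-1$, that is tridiagonal with diagonal $b_0,\dots,b_{q-1}$ and off-diagonal entries $a_0,\dots,a_{q-2}$, with $a_{q-1}e^{-2\pi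 i\theta}$ added to the entry $(0,q-1)$ and $a_{q-1}e^{2\pi i\theta}$ added to the entry $(q-1,0)$. Let $A(\theta)$ be the $q\times q$ matrix with entries $ia_j$ at $(j,j+1)$ and $-ia_j$ at $(j+1,j)$ for $0\le j\le q-2$, with $-ia_{q-1}e^{-2\pi i\theta}$ added to the entry $(0,q-1)$ and $ia_{q-1}e^{2\pi i\theta}$ added to the entry $(q-1,0)$, and all other entries zero. Let $\lambda_{q,0}(\theta)\le\dots\le\lambda_{q,q-1}(\theta)$ be the eigenvalues of $J(\theta)$, $P_k(\theta)$ the orthogonal projection onto $\ker(J(\theta)-\lambda_{q,k}(\theta))$, and for $\theta\notin\{0,\tfrac12\}$ $$Q_q(\theta)=\frac{q}{2\pi}\sum_{k=0}^{q-1}\frac{d\lambda_{q,k}}{d\theta}(\theta)\,P_k(\theta).$$ Let $Q_q$ denote the bounded operator on $\ell^2(\mathbb Z)$ with $(\mathcal F_qQ_q\phi)(\theta)=Q_q(\theta)(\mathcal F_q\phi)(\theta)$ for a.e. $\theta$ and all $\phi$. For a bounded operator $T$ on $\ell^2(\mathbb Z)$ let $\|T\|_{1\to2}$ be its norm as an operator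 from $\ell^1(\mathbb Z)$ to $\ell^2(\mathbb Z)$, and let $\|\cdot\|_{HS}$ be the Hilbert–Schmidt norm of matrices. **Theorem 4.1.** For every $R>0$ there is a constant $c_1=c_1(R)>0$ such that $$\Big|\frac{d\lambda_{q,j}}{d\theta}(\theta)\Big|\ge e^{-c_1q}\,|\sin 2\pi\theta|$$ for all $q\ge1$, all $q$-periodic $J\in\mathcal J(R)$, all $0\le j\le q-1$ and all $\theta\in\mathbb R\setminus\tfrac12\mathbb Z$, and such that the following holds. Let $\eta>7c_1$, let $J\in\mathcal J(R)$, let $(q_n)_{n\ge0}$ be positive integers with $q_n\mid q_{n+1}$ and $q_n\ne q_{n+1}$, and let $J_{q_n}$ be $q_n$-periodic Jacobi operators with $J_{q_n}\in\mathcal J(R)$ for all large $n$ and $$\lim_{n\to\infty}q_{n+1}^3e^{\eta q_n}\|J-J_{q_n}\|=0 .$$ Put $\gamma_n=e^{-\eta q_{n-1}}/q_n^3$, and let $A_{q_n}$, $A_{q_n}(\theta)$, $Q_{q_n}(\theta)$, $Q_{q_n}$ be the objects above for $J_{q_n}$. Then for all sufficiently large $n$ the operator $Q_{q_n}$ exists,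 and for every real $t\ne0$ $$\Big\|Q_{q_n}-\frac1t\int_0^te^{isJ_{q_n}}A_{q_n}e^{-isJ_{q_n}}\,ds\Big\|_{1\to2}^2\le I_n(t):=\int_0^1\Big\|Q_{q_n}(\theta)-\frac1t\int_0^te^{isJ_{q_n}(\theta)}A_{q_n}(\theta)e^{-isJ_{q_n}(\theta)}\,ds\Big\|_{HS}^2\,d\theta ,$$ where the integrand of $I_n(t)$ is integrable, and $$I_n(t)\le\frac{4R^2q_n^2}{t^2\varepsilon^2}+64R^2e^{c_1q_n/2}\sqrt\varepsilon\quad\text{for every }\varepsilon>0,$$ $$I_n(t)\le\frac{4R^2q_n^2}{t^2\varepsilon^2}+16R^2q_ne^{c_1q_{n-1}/2}\sqrt\varepsilon\quad\text{for every }\varepsilon>\gamma_n .$$ -/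

import Mathlib

open MeasureTheory Filter

noncomputable section

/-! ### The sequence spaces and weighted shifts -/

/-- The Hilbert space `ℓ²(ℤ)` of complex sequences. -/
abbrev Ell2 : Type := lp (fun _ : ℤ => ℂ) 2

/-- The Banach space `ℓ¹(ℤ)` of complex sequences. -/
abbrev Ell1 : Type := lp (fun _ : ℤ => ℂ) 1

theorem summable_sq_ell2 (φ : Ell2) : Summable fun n => ‖φ n‖ ^ 2 := by
  have h := (lp.memℓp φ).summable (by norm_num)
  simpa using h

theorem norm_sq_ell2 (φ : Ell2) : ‖φ‖ ^ 2 = ∑' n, ‖φ n‖ ^ 2 := by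
  have h := lp.norm_rpow_eq_tsum (p := 2) (by norm_num) φ
  simpa using h

theorem weighted_sq_le {c : ℤ → ℂ} {C : ℝ} (hC : ∀ n, ‖c n‖ ≤ C) (z : ℂ) (n : ℤ) :
    ‖c n * z‖ ^ 2 ≤ C ^ 2 * ‖z‖ ^ 2 := by
  rw [norm_mul, mul_pow]
  have := hC n
  gcongr

theorem memlp_weighted (c : ℤ → ℂ) (hc : ∃ C, ∀ n, ‖c n‖ ≤ C) (σ : ℤ → ℤ)
    (hσ : Function.Injective σ) (φ : Ell2) : Memℓp (fun n => c n * φ (σ n)) 2 := by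
  obtain ⟨C, hC⟩ := hc
  have hs : Summable fun n => C ^ 2 * ‖φ (σ n)‖ ^ 2 :=
    ((summable_sq_ell2 φ).comp_injective hσ).mul_left _
  apply memℓp_gen
  have := Summable.of_nonneg_of_le (fun n => by positivity)
    (fun n => weighted_sq_le hC (φ (σ n)) n) hs
  simpa using this

/-- The bounded operator `(T φ)_n = c_n φ_{σ(n)}` on `ℓ²(ℤ)`, for a bounded sequence `c` and an
injective re-indexing `σ`. -/
def weightedPullback (c : ℤ → ℂ) (hc : ∃ C, ∀ n, ‖c n‖ ≤ C) (σ : ℤ → ℤ)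
    (hσ : Function.Injective σ) : Ell2 →L[ℂ] Ell2 :=
  LinearMap.mkContinuous
    { toFun := fun φ => ⟨fun n => c n * φ (σ n), memlp_weighted c hc σ hσ φ⟩
      map_add' := fun φ ψ => by
        ext n
        exact mul_add (c n) (φ (σ n)) (ψ (σ n))
      map_smul' := fun z φ => by
        ext n
        simp [mul_left_comm] }
    (Classical.choose hc) (fun φ => by
      have hC := Classical.choose_spec hc
      set C := Classical.choose hc
      have hC0 : 0 ≤ C := (norm_nonneg _).trans (hC 0)
      refine lp.norm_le_of_tsum_le (p := 2) (by norm_num) (by positivity) ?_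
      have hs : Summable fun n => C ^ 2 * ‖φ (σ n)‖ ^ 2 :=
        ((summable_sq_ell2 φ).comp_injective hσ).mul_left _
      have h1 : Summable fun n => ‖c n * φ (σ n)‖ ^ 2 :=
        Summable.of_nonneg_of_le (fun n => by positivity)
          (fun n => weighted_sq_le hC (φ (σ n)) n) hs
      have h2 : ∑' n, ‖c n * φ (σ n)‖ ^ 2 ≤ (C * ‖φ‖) ^ 2 := by
        calc ∑' n, ‖c n * φ (σ n)‖ ^ 2 ≤ ∑' n, C ^ 2 * ‖φ (σ n)‖ ^ 2 :=
              h1.tsum_le_tsum (fun n => weighted_sq_le hC (φ (σ n)) n) hs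
          _ = C ^ 2 * ∑' n, ‖φ (σ n)‖ ^ 2 := tsum_mul_left
          _ ≤ C ^ 2 * ∑' n, ‖φ n‖ ^ 2 := by
              exact mul_le_mul_of_nonneg_left
                (Summable.tsum_le_tsum_of_inj σ hσ (fun n _ => by positivity) (fun n => le_rfl)
                  ((summable_sq_ell2 φ).comp_injective hσ) (summable_sq_ell2 φ)) (by positivity)
          _ = (C * ‖φ‖) ^ 2 := by rw [mul_pow, norm_sq_ell2]
      simpa using h2)

theorem weightedPullback_apply (c : ℤ → ℂ) (hc : ∃ C, ∀ n, ‖c n‖ ≤ C) (σ : ℤ → ℤ)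
    (hσ : Function.Injective σ) (φ : Ell2) (n : ℤ) :
    weightedPullback c hc σ hσ φ n = c n * φ (σ n) := rfl

/-- The inclusion `ℓ¹(ℤ) → ℓ²(ℤ)`. -/
def ell1ToEll2 : Ell1 →L[ℂ] Ell2 :=
  LinearMap.mkContinuous
    { toFun := fun φ => ⟨fun n => φ n, (lp.memℓp φ).of_exponent_ge (by norm_num)⟩
      map_add' := fun φ ψ => rfl
      map_smul' := fun z φ => rfl }
    1 (fun φ => by
      have hs : Summable fun n => ‖φ n‖ := by
        have h := (lp.memℓp φ).summable (by norm_num)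
        simpa using h
      have hn : ‖φ‖ = ∑' n, ‖φ n‖ := by
        have h := lp.norm_rpow_eq_tsum (p := 1) (by norm_num) φ
        simpa using h
      refine lp.norm_le_of_forall_sum_le (p := 2) (by norm_num) (by positivity) ?_
      intro s
      have h1 : ∑ n ∈ s, ‖φ n‖ ^ 2 ≤ (∑ n ∈ s, ‖φ n‖) ^ 2 :=
        Finset.sum_sq_le_sq_sum_of_nonneg (fun n _ => norm_nonneg _)
      have h2 : ∑ n ∈ s, ‖φ n‖ ≤ ‖φ‖ := hn ▸ hs.sum_le_tsum s (fun n _ => norm_nonneg _)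
      have h3 : (∑ n ∈ s, ‖φ n‖) ^ 2 ≤ ‖φ‖ ^ 2 := by
        have : 0 ≤ ∑ n ∈ s, ‖φ n‖ := Finset.sum_nonneg fun n _ => norm_nonneg _
        gcongr
      simp only [ENNReal.toReal_ofNat, Real.rpow_ofNat, one_mul]
      exact h1.trans h3)

theorem ell1ToEll2_apply (φ : Ell1) (n : ℤ) : ell1ToEll2 φ n = φ n := rfl

/-- The norm of a bounded operator on `ℓ²(ℤ)`, regarded as an operator `ℓ¹(ℤ) → ℓ²(ℤ)`. -/
def normOneTwo (T : Ell2 →L[ℂ] Ell2) : ℝ := ‖T ∘L ell1ToEll2‖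

/-! ### Jacobi matrices -/

/-- The coefficients of a (two-sided) Jacobi matrix: bounded real sequences with `inf a > 0`. -/
structure JacobiMatrix where
  a : ℤ → ℝ
  b : ℤ → ℝ
  a_bounded : ∃ C, ∀ n, |a n| ≤ C
  b_bounded : ∃ C, ∀ n, |b n| ≤ C
  a_inf_pos : ∃ δ, 0 < δ ∧ ∀ n, δ ≤ a n

namespace JacobiMatrix

theorem bdd_a (J : JacobiMatrix) (z : ℂ) (d : ℤ) : ∃ C, ∀ n, ‖z * (J.a (n + d) : ℂ)‖ ≤ C := by
  obtain ⟨C, hC⟩ := J.a_bounded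
  refine ⟨‖z‖ * C, fun n => ?_⟩
  rw [norm_mul, Complex.norm_real, Real.norm_eq_abs]
  have := hC (n + d)
  gcongr

theorem bdd_b (J : JacobiMatrix) : ∃ C, ∀ n, ‖(J.b n : ℂ)‖ ≤ C := by
  obtain ⟨C, hC⟩ := J.b_bounded
  exact ⟨C, fun n => by simpa using hC n⟩

/-- The Jacobi operator `(J φ)_n = a_{n-1} φ_{n-1} + b_n φ_n + a_n φ_{n+1}` on `ℓ²(ℤ)`;
see `op_apply`. -/
def op (J : JacobiMatrix) : Ell2 →L[ℂ] Ell2 :=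
  weightedPullback (fun n => 1 * (J.a (n + -1) : ℂ)) (J.bdd_a 1 (-1)) (fun n => n + -1)
      (add_left_injective _)
    + weightedPullback (fun n => (J.b n : ℂ)) J.bdd_b id Function.injective_id
    + weightedPullback (fun n => 1 * (J.a (n + 0) : ℂ)) (J.bdd_a 1 0) (fun n => n + 1)
      (add_left_injective _)

theorem op_apply (J : JacobiMatrix) (φ : Ell2) (n : ℤ) :
    J.op φ n = J.a (n - 1) * φ (n - 1) + J.b n * φ n + J.a n * φ (n + 1) := by
  simp [op, weightedPullback_apply, sub_eq_add_neg]

/-- The momentum operator: the bounded extension to `ℓ²(ℤ)` of the commutator `A = i[J, X]`, where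
`(X φ)_n = n φ_n`; see `momentum_eq_commutator`. -/
def momentum (J : JacobiMatrix) : Ell2 →L[ℂ] Ell2 :=
  weightedPullback (fun n => Complex.I * (J.a (n + 0) : ℂ)) (J.bdd_a _ 0) (fun n => n + 1)
      (add_left_injective _)
    + weightedPullback (fun n => -Complex.I * (J.a (n + -1) : ℂ)) (J.bdd_a _ (-1))
      (fun n => n + -1) (add_left_injective _)

theorem momentum_apply (J : JacobiMatrix) (φ : Ell2) (n : ℤ) :
    J.momentum φ n
      = Complex.I * J.a n * φ (n + 1) - Complex.I * J.a (n - 1) * φ (n - 1) := by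
  simp [momentum, weightedPullback_apply, sub_eq_add_neg]

/-- If `φ` lies in the domain of `X` and `ψ = X φ`, then `A φ = i (J X φ - X J φ)`. -/
theorem momentum_eq_commutator (J : JacobiMatrix) (φ ψ : Ell2) (h : ∀ n, ψ n = (n : ℂ) * φ n)
    (n : ℤ) : J.momentum φ n = Complex.I * (J.op ψ n - (n : ℂ) * J.op φ n) := by
  rw [momentum_apply, op_apply, op_apply, h, h, h]
  push_cast
  ring

/-- `J ∈ 𝒥(R)`. -/
def IsRBounded (J : JacobiMatrix) (R : ℝ) : Prop :=
  ∀ n, 1 / R ≤ J.a n ∧ J.a n ≤ R ∧ |J.b n| ≤ R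

/-- `q`-periodicity of the coefficients. -/
def IsPeriodic (J : JacobiMatrix) (q : ℕ) : Prop :=
  ∀ n, J.a (n + q) = J.a n ∧ J.b (n + q) = J.b n

/-! ### Floquet matrices, their eigenvalues and spectral projections -/

/-- The `q × q` Floquet matrix `J(θ)` of a `q`-periodic Jacobi matrix (rows and columns are
numbered from `0`): the tridiagonal matrix with the entries of `J`, plus the two corner terms
`a_{q-1} e^{∓2πiθ}`. -/
def floquet (J : JacobiMatrix) (q : ℕ) (θ : ℝ) : Matrix (Fin q) (Fin q) ℂ :=
  Matrix.of fun j k =>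
    (if j = k then (J.b j : ℂ) else 0)
      + (if (j : ℕ) + 1 = k then (J.a j : ℂ) else 0)
      + (if (k : ℕ) + 1 = j then (J.a k : ℂ) else 0)
      + (if (j : ℕ) = 0 ∧ (k : ℕ) + 1 = q then
          (J.a k : ℂ) * Complex.exp (-(2 * Real.pi * θ * Complex.I)) else 0)
      + (if (k : ℕ) = 0 ∧ (j : ℕ) + 1 = q then
          (J.a j : ℂ) * Complex.exp (2 * Real.pi * θ * Complex.I) else 0)

/-- The `q × q` fibre `A(θ)` of the momentum operator of a `q`-periodic Jacobi matrix. -/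
def floquetMomentum (J : JacobiMatrix) (q : ℕ) (θ : ℝ) : Matrix (Fin q) (Fin q) ℂ :=
  Matrix.of fun j k =>
    (if (j : ℕ) + 1 = k then Complex.I * (J.a j : ℂ) else 0)
      + (if (k : ℕ) + 1 = j then -Complex.I * (J.a k : ℂ) else 0)
      + (if (j : ℕ) = 0 ∧ (k : ℕ) + 1 = q then
          -Complex.I * (J.a k : ℂ) * Complex.exp (-(2 * Real.pi * θ * Complex.I)) else 0)
      + (if (k : ℕ) = 0 ∧ (j : ℕ) + 1 = q then
          Complex.I * (J.a j : ℂ) * Complex.exp (2 * Real.pi * θ * Complex.I) else 0)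

theorem floquet_isHermitian (J : JacobiMatrix) (q : ℕ) (θ : ℝ) :
    (J.floquet q θ).IsHermitian := by
  ext j k
  have e1 : (starRingEnd ℂ) (Complex.exp (-(2 * Real.pi * θ * Complex.I)))
      = Complex.exp (2 * Real.pi * θ * Complex.I) := by
    rw [← Complex.exp_conj]; simp [Complex.conj_ofNat]
  have e2 : (starRingEnd ℂ) (Complex.exp (2 * Real.pi * θ * Complex.I))
      = Complex.exp (-(2 * Real.pi * θ * Complex.I)) := by
    rw [← Complex.exp_conj]; simp [Complex.conj_ofNat]
  simp only [floquet, Matrix.conjTranspose_apply, Matrix.of_apply, star_add, RCLike.star_def,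
    apply_ite (starRingEnd ℂ), map_mul, Complex.conj_ofReal, map_zero, e1, e2]
  by_cases h : j = k
  · subst h
    simp only [if_true]
    ring
  · rw [if_neg h, if_neg (Ne.symm h)]
    ring

/-- The eigenvalues `λ_0(θ) ≤ λ_1(θ) ≤ ⋯ ≤ λ_{q-1}(θ)` of `J(θ)`, with multiplicity. -/
def eigenvalue (J : JacobiMatrix) (q : ℕ) (k : Fin q) (θ : ℝ) : ℝ :=
  (J.floquet_isHermitian q θ).eigenvalues₀ (Fin.cast (Fintype.card_fin q).symm k.rev)

/-- The matrix of the orthogonal projection `P_k(θ)` onto `ker (J(θ) - λ_k(θ))`. -/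
def eigenprojection (J : JacobiMatrix) (q : ℕ) (k : Fin q) (θ : ℝ) :
    Matrix (Fin q) (Fin q) ℂ :=
  Matrix.toEuclideanLin.symm
    ((Module.End.eigenspace (Matrix.toEuclideanLin (J.floquet q θ))
      (J.eigenvalue q k θ : ℂ)).starProjection : EuclideanSpace ℂ (Fin q) →ₗ[ℂ] _)

/-- The fibre `Q(θ) = q ∑_k λ̇_k(θ) P_k(θ)`, where the dot is the derivative with respect to the
Floquet phase `2πθ`, so that `λ̇_k = (2π)⁻¹ dλ_k/dθ`. -/
def velocityFiber (J : JacobiMatrix) (q : ℕ) (θ : ℝ) : Matrix (Fin q) (Fin q) ℂ :=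
  (q : ℂ) • ∑ k : Fin q,
    ((deriv (J.eigenvalue q k) θ / (2 * Real.pi) : ℝ) : ℂ) • J.eigenprojection q k θ

/-! ### Time averages -/

/-- `t⁻¹ ∫₀ᵗ e^{isJ} A e^{-isJ} ds` on `ℓ²(ℤ)` (a Bochner integral in the operator norm). -/
def timeAverage (J : JacobiMatrix) (t : ℝ) : Ell2 →L[ℂ] Ell2 :=
  (t : ℂ)⁻¹ • ∫ s in (0 : ℝ)..t,
    NormedSpace.exp ((Complex.I * s) • J.op) * J.momentum *
      NormedSpace.exp ((-(Complex.I * s)) • J.op)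

/-- `t⁻¹ ∫₀ᵗ e^{isJ(θ)} A(θ) e^{-isJ(θ)} ds` (entrywise integral of a matrix). -/
def timeAverageFiber (J : JacobiMatrix) (q : ℕ) (t θ : ℝ) : Matrix (Fin q) (Fin q) ℂ :=
  (t : ℂ)⁻¹ • Matrix.of fun j k => ∫ s in (0 : ℝ)..t,
    (NormedSpace.exp ((Complex.I * s) • J.floquet q θ) * J.floquetMomentum q θ *
      NormedSpace.exp ((-(Complex.I * s)) • J.floquet q θ)) j k

end JacobiMatrix

/-- The square of the Hilbert–Schmidt norm of a matrix. -/
def hsNormSq {q : ℕ} (M : Matrix (Fin q) (Fin q) ℂ) : ℝ := ∑ j, ∑ k, ‖M j k‖ ^ 2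

/-! ### The Floquet transform -/

theorem slice_injective (q : ℕ) [NeZero q] (k : Fin q) :
    Function.Injective fun n : ℤ => (k : ℤ) - n * q := by
  intro m n h
  have hq : (q : ℤ) ≠ 0 := by exact_mod_cast NeZero.ne q
  have h' : m * (q : ℤ) = n * q := by simpa using h
  exact mul_right_cancel₀ hq h'

/-- The `q`-periodic Floquet transform of `φ ∈ ℓ²(ℤ)`: its component `k` is the function
`∑_p φ_{k+pq} e^{-2πipθ}` in `L²(ℝ/ℤ)`, that is, the function whose `n`-th Fourier coefficient is
`φ_{k-nq}`. -/
def floquetTransform (q : ℕ) [NeZero q] (φ : Ell2) (k : Fin q) :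
    Lp ℂ 2 (AddCircle.haarAddCircle (T := (1 : ℝ))) :=
  (fourierBasis (T := (1 : ℝ))).repr.symm
    (weightedPullback (fun _ => 1) ⟨1, by simp⟩ (fun n => (k : ℤ) - n * q)
      (slice_injective q k) φ)

/-- `F_q T F_q⁻¹ = ∫^⊕ M(θ) dθ`: in Floquet space the operator `T` acts as multiplication by the
matrix-valued function `M`. -/
def HasFloquetFibers (q : ℕ) [NeZero q] (T : Ell2 →L[ℂ] Ell2)
    (M : ℝ → Matrix (Fin q) (Fin q) ℂ) : Prop :=
  ∀ φ : Ell2, ∀ᵐ θ : ℝ ∂(volume.restrict (Set.Ico (0 : ℝ) 1)), ∀ j : Fin q,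
    floquetTransform q (T φ) j (θ : AddCircle (1 : ℝ))
      = ∑ k : Fin q, M θ j k * floquetTransform q φ k (θ : AddCircle (1 : ℝ))

/-! ### The exponential class and the constant `c₁` -/

/-- `J` belongs to the exponential class `EC(η)`, as witnessed by the periods `q_n` and the
periodic Jacobi matrices `J_{q_n}`. -/
structure IsExpApprox (η : ℝ) (J : JacobiMatrix) (q : ℕ → ℕ+) (Jq : ℕ → JacobiMatrix) : Prop where
  dvd : ∀ n, (q n : ℕ) ∣ (q (n + 1) : ℕ)
  ne : ∀ n, q n ≠ q (n + 1)
  periodic : ∀ n, (Jq n).IsPeriodic (q n)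
  tendsto : Tendsto
    (fun n => ((q (n + 1) : ℕ) : ℝ) ^ 3 * Real.exp (η * (q n : ℕ)) * ‖J.op - (Jq n).op‖)
    atTop (nhds 0)

/-- `c₁` is an admissible constant in the lower bound for the slopes of the eigenvalues,
`|dλ_j/dθ| ≥ e^{-c₁ q} |sin 2πθ|`, for all periods `q` and all `q`-periodic `J ∈ 𝒥(R)`. -/
def IsSlopeConstant (R c₁ : ℝ) : Prop :=
  ∀ (q : ℕ+) (J : JacobiMatrix), J.IsRBounded R → J.IsPeriodic q → ∀ (j : Fin q) (θ : ℝ),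
    Real.exp (-c₁ * (q : ℕ)) * |Real.sin (2 * Real.pi * θ)| ≤ |deriv (J.eigenvalue q j) θ|

/-- `γ_n = e^{-η q_{n-1}} / q_n³` (only used for large `n`). -/
def gammaRate (η : ℝ) (q : ℕ → ℕ+) (n : ℕ) : ℝ :=
  Real.exp (-η * (q (n - 1) : ℕ)) / ((q n : ℕ) : ℝ) ^ 3

end

/-! ### Ordered eigenbases: min-max, Weyl's inequality and approximate eigenvectors. -/

noncomputable section

open scoped InnerProductSpace

namespace SpectralBasis

variable {E : Type*} [NormedAddCommGroup E] [InnerProductSpace ℂ E] {q : ℕ}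

/-! For sin 2πθ ≠ 0 all eigenvalues of `J(θ)` are simple. In an eigenbasis the matrix of `Q(θ)`
minus the time average has zero diagonal, because `A(θ)` is a commutator with `J(θ)` plus `(q/2π)
dJ/dθ`, so Hellmann–Feynman identifies the diagonal of `A(θ)` with the velocities. Off the diagonal
an entry of `A(θ)` is multiplied by the average of `e^{is(λ_j-λ_k)}`, which is at most 1 and at most
`2/(|t||λ_j-λ_k|)`. Pairs with gap above `ε` give the term in `1/(t²ε²)`. The work lies in the
resonant pairs, those with gap at most `ε`.

Gaps and slopes come from the discriminant `D`, a polynomial with `D(λ_k(θ)) = 2 cos 2πθ`.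
Differentiating this relation and bounding `D'` by `B_q = (14R²)^q` gives the slope bound
(`sin_le_discBound_mul_deriv`). Two eigenvalues at the same `θ` enclose a critical point, where `|D|
≥ 2`, so their gap is at least `|sin 2πθ|/B_q` (`sin_le_eigenvalue_gap`). Hence resonances need
`|sin 2πθ| ≤ B_q ε`, and integrating the weight `|sin 2πθ|^{-3/4}` gives the first estimate.

The second estimate replaces `B_q` by `B_{q'}` for the preceding period `q'`, where `q = q'm`.
Eigenvectors of the `q'`-periodic `J'` at `θ` are Bloch waves with phases `(θ+l)/m`. Momentum
connects only equal phases, and eigenvalues of equal phase have gap at least `|sin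
2π(θ+l)/m|/B_{q'}` (`lifted_momentum_gap`). Arbitrary pairs are only polynomially closer in `m`
(`lifted_gap`). The perturbation lemma `norm_component_apply_eigenvector_le` carries this over to
`J`; summing over the phases is a Riemann sum for the same integrable weight.

On ℓ²(ℤ), the fibres `Q(θ)` are almost everywhere limits of continuous time-averaged fibres and
differ boundedly from one of them, so they define a bounded operator. The Floquet transform of a
delta sequence is a unimodular multiple of a coordinate vector, which is why the Hilbert–Schmidt
integral dominates the ℓ¹ → ℓ² norm. -/

theorem inner_apply (T : E →L[ℂ] E) (v : OrthonormalBasis (Fin q) ℂ E) (l : Fin q → ℝ)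
    (h : ∀ i, T (v i) = (l i : ℂ) • v i) (i : Fin q) (x : E) :
    ⟪v i, T x⟫_ℂ = l i * ⟪v i, x⟫_ℂ := by
  conv_lhs => rw [← v.sum_repr' x]
  simp only [map_sum, map_smul, h, inner_sum, inner_smul_right]
  rw [Finset.sum_eq_single i]
  · simp [mul_comm]
  · intro j _ hj
    simp [Ne.symm hj]
  · simp

theorem inner_self_apply (T : E →L[ℂ] E) (v : OrthonormalBasis (Fin q) ℂ E) (l : Fin q → ℝ)
    (h : ∀ i, T (v i) = (l i : ℂ) • v i) (x : E) :
    (⟪x, T x⟫_ℂ).re = ∑ i, l i * ‖⟪v i, x⟫_ℂ‖ ^ 2 := by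
  rw [← v.sum_inner_mul_inner x (T x), Complex.re_sum]
  refine Finset.sum_congr rfl fun i _ => ?_
  rw [inner_apply T v l h, ← inner_conj_symm x (v i), mul_left_comm, Complex.re_ofReal_mul,
    mul_comm ((starRingEnd ℂ) _), Complex.mul_conj, Complex.normSq_eq_norm_sq, Complex.ofReal_re]

theorem norm_sq_apply_sub (T : E →L[ℂ] E) (v : OrthonormalBasis (Fin q) ℂ E) (l : Fin q → ℝ)
    (h : ∀ i, T (v i) = (l i : ℂ) • v i) (μ : ℝ) (x : E) :
    ‖T x - (μ : ℂ) • x‖ ^ 2 = ∑ i, (l i - μ) ^ 2 * ‖⟪v i, x⟫_ℂ‖ ^ 2 := by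
  rw [← v.sum_sq_norm_inner_right (T x - (μ : ℂ) • x)]
  refine Finset.sum_congr rfl fun i _ => ?_
  rw [inner_sub_right, inner_smul_right, inner_apply T v l h, ← sub_mul, norm_mul, mul_pow,
    ← Complex.ofReal_sub, Complex.norm_real, Real.norm_eq_abs, sq_abs]

/-- There is one linear condition for each index other than `k`, hence `q - 1` conditions in
dimension `q`. The solution is a min-max test vector: it lies in the upper part of one basis and in
the lower part of the other. -/
theorem exists_common_vector (v w : OrthonormalBasis (Fin q) ℂ E) (k : Fin q) :
    ∃ x : E, x ≠ 0 ∧ (∀ i < k, ⟪v i, x⟫_ℂ = 0) ∧ ∀ i > k, ⟪w i, x⟫_ℂ = 0 := by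
  classical
  have : FiniteDimensional ℂ E := v.toBasis.finiteDimensional_of_finite
  let L : E →ₗ[ℂ] ({i : Fin q // i ≠ k} → ℂ) :=
    LinearMap.pi fun i => if (i : Fin q) < k then (innerₛₗ ℂ (v i)) else (innerₛₗ ℂ (w i))
  have hfin : Module.finrank ℂ ({i : Fin q // i ≠ k} → ℂ) < Module.finrank ℂ E := by
    rw [Module.finrank_eq_card_basis v.toBasis, Module.finrank_fintype_fun_eq_card]
    exact Fintype.card_subtype_lt (x := k) (by simp)
  obtain ⟨x, hx, hx0⟩ := (Submodule.ne_bot_iff _).1 (LinearMap.ker_ne_bot_of_finrank_lt (f := L) hfin)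
  refine ⟨x, hx0, fun i hi => ?_, fun i hi => ?_⟩
  · have := congrFun (LinearMap.mem_ker.1 hx) ⟨i, hi.ne⟩
    simpa [L, hi] using this
  · have := congrFun (LinearMap.mem_ker.1 hx) ⟨i, hi.ne'⟩
    simpa [L, not_lt.2 hi.le] using this

/-- On the common test vector the quadratic form of `T` is at least `l k` and that of `S` at most `m
k`, while the forms differ by at most `C`. -/
theorem eigenvalue_le_add (T S : E →L[ℂ] E) (v w : OrthonormalBasis (Fin q) ℂ E)
    (l m : Fin q → ℝ) (hT : ∀ i, T (v i) = (l i : ℂ) • v i)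
    (hS : ∀ i, S (w i) = (m i : ℂ) • w i) (hl : Monotone l) (hm : Monotone m) {C : ℝ}
    (hC : ∀ x, ‖T x - S x‖ ≤ C * ‖x‖) (k : Fin q) : l k ≤ m k + C := by
  obtain ⟨x, hx0, hv, hw⟩ := exists_common_vector v w k
  have h1 : l k * ‖x‖ ^ 2 ≤ (⟪x, T x⟫_ℂ).re := by
    rw [inner_self_apply T v l hT, ← v.sum_sq_norm_inner_right x, Finset.mul_sum]
    refine Finset.sum_le_sum fun i _ => ?_
    rcases lt_or_ge i k with hi | hi
    · simp [hv i hi]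
    · exact mul_le_mul_of_nonneg_right (hl hi) (by positivity)
  have h2 : (⟪x, S x⟫_ℂ).re ≤ m k * ‖x‖ ^ 2 := by
    rw [inner_self_apply S w m hS, ← w.sum_sq_norm_inner_right x, Finset.mul_sum]
    refine Finset.sum_le_sum fun i _ => ?_
    rcases lt_or_ge k i with hi | hi
    · simp [hw i hi]
    · exact mul_le_mul_of_nonneg_right (hm hi) (by positivity)
  have h3 : (⟪x, T x⟫_ℂ).re - (⟪x, S x⟫_ℂ).re ≤ C * ‖x‖ ^ 2 := by
    rw [← Complex.sub_re, ← inner_sub_right]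
    calc (⟪x, T x - S x⟫_ℂ).re ≤ ‖⟪x, T x - S x⟫_ℂ‖ := Complex.re_le_norm _
      _ ≤ ‖x‖ * ‖T x - S x‖ := norm_inner_le_norm _ _
      _ ≤ ‖x‖ * (C * ‖x‖) := by gcongr; exact hC x
      _ = C * ‖x‖ ^ 2 := by ring
  have hpos : 0 < ‖x‖ ^ 2 := by positivity
  have : l k * ‖x‖ ^ 2 ≤ (m k + C) * ‖x‖ ^ 2 := by linarith
  exact le_of_mul_le_mul_right this hpos

/-- Weyl's inequality for ordered eigenvalues. -/
theorem abs_eigenvalue_sub_le (T S : E →L[ℂ] E) (v w : OrthonormalBasis (Fin q) ℂ E)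
    (l m : Fin q → ℝ) (hT : ∀ i, T (v i) = (l i : ℂ) • v i)
    (hS : ∀ i, S (w i) = (m i : ℂ) • w i) (hl : Monotone l) (hm : Monotone m) {C : ℝ}
    (hC : ∀ x, ‖T x - S x‖ ≤ C * ‖x‖) (k : Fin q) : |l k - m k| ≤ C := by
  have h1 := eigenvalue_le_add T S v w l m hT hS hl hm hC k
  have h2 := eigenvalue_le_add S T w v m l hS hT hm hl
    (fun x => by rw [norm_sub_rev]; exact hC x) k
  rw [abs_le]
  constructor <;> linarith

theorem norm_sq_sub_component (v : OrthonormalBasis (Fin q) ℂ E) (k : Fin q) (x : E) :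
    ‖x - ⟪v k, x⟫_ℂ • v k‖ ^ 2 = ∑ i ∈ Finset.univ.erase k, ‖⟪v i, x⟫_ℂ‖ ^ 2 := by
  rw [← v.sum_sq_norm_inner_right, ← Finset.add_sum_erase _ _ (Finset.mem_univ k)]
  have h0 : ‖⟪v k, x - ⟪v k, x⟫_ℂ • v k⟫_ℂ‖ ^ 2 = 0 := by
    simp
  rw [h0, zero_add]
  refine Finset.sum_congr rfl fun i hi => ?_
  have hik : i ≠ k := (Finset.mem_erase.1 hi).1
  simp [inner_sub_right, inner_smul_right, hik]

/-- An approximate eigenvector at `μ` is nearly parallel to `v k` when every other eigenvalue stays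
`g` away from `μ`: coordinatewise, `T - μ` multiplies the remaining components by at least `g`. -/
theorem gap_mul_norm_sub_component_le (T : E →L[ℂ] E) (v : OrthonormalBasis (Fin q) ℂ E)
    (l : Fin q → ℝ) (h : ∀ i, T (v i) = (l i : ℂ) • v i) (μ g : ℝ) (hg : 0 ≤ g) (k : Fin q)
    (hk : ∀ i, i ≠ k → g ≤ |l i - μ|) (x : E) :
    g * ‖x - ⟪v k, x⟫_ℂ • v k‖ ≤ ‖T x - (μ : ℂ) • x‖ := by
  refine le_of_sq_le_sq ?_ (norm_nonneg _)
  rw [mul_pow, norm_sq_sub_component, norm_sq_apply_sub T v l h, Finset.mul_sum,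
    ← Finset.add_sum_erase _ _ (Finset.mem_univ k)]
  refine le_add_of_nonneg_of_le (by positivity) (Finset.sum_le_sum fun i hi => ?_)
  have := hk i (Finset.mem_erase.1 hi).1
  have h2 : g ^ 2 ≤ (l i - μ) ^ 2 := by rw [← sq_abs (l i - μ)]; gcongr
  gcongr

end SpectralBasis
end

/-! ### Perturbation of eigenvalues and of matrix elements between eigenvectors. -/

noncomputable section

open scoped InnerProductSpace

namespace SpectralBasis

variable {E : Type*} [NormedAddCommGroup E] [InnerProductSpace ℂ E] {q : ℕ}

/-- The Hellmann–Feynman formula for a simple eigenvalue of a differentiable family. -/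
theorem hasDerivAt_eigenvalue (T : ℝ → E →L[ℂ] E) (D : E →L[ℂ] E)
    (v : ℝ → OrthonormalBasis (Fin q) ℂ E) (l : ℝ → Fin q → ℝ)
    (hT : ∀ θ i, T θ (v θ i) = (l θ i : ℂ) • v θ i) (hl : ∀ θ, Monotone (l θ)) (θ₀ : ℝ)
    (hD : HasDerivAt T D θ₀) (k : Fin q) (hk : ∀ i, i ≠ k → l θ₀ i ≠ l θ₀ k) :
    HasDerivAt (fun θ => l θ k) (⟪v θ₀ k, D (v θ₀ k)⟫_ℂ).re θ₀ := by
  -- The gap is taken as `2 * g` so that a gap `g` survives when Weyl's inequality moves `l θ k` by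
  -- at most `g`. Without other indices any positive value does.
  obtain ⟨g, hg, hgap⟩ : ∃ g > 0, ∀ i, i ≠ k → 2 * g ≤ |l θ₀ i - l θ₀ k| := by
    rcases (Finset.univ.erase k).eq_empty_or_nonempty with h | h
    · refine ⟨1, one_pos, fun i hi => ?_⟩
      have : i ∈ Finset.univ.erase k := by simp [hi]
      simp [h] at this
    · obtain ⟨i₀, hi₀, hmin⟩ := (Finset.univ.erase k).exists_min_image
        (fun i => |l θ₀ i - l θ₀ k|) h
      have hpos : 0 < |l θ₀ i₀ - l θ₀ k| :=
        abs_pos.2 (sub_ne_zero.2 (hk i₀ (Finset.mem_erase.1 hi₀).1))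
      refine ⟨|l θ₀ i₀ - l θ₀ k| / 2, by positivity, fun i hi => ?_⟩
      have := hmin i (by simp [hi])
      linarith
  set u := v θ₀ k with hu
  have hu1 : ‖u‖ = 1 := (v θ₀).orthonormal.1 k
  have hweyl : ∀ θ i, |l θ i - l θ₀ i| ≤ ‖T θ - T θ₀‖ := fun θ i =>
    abs_eigenvalue_sub_le (T θ) (T θ₀) (v θ) (v θ₀) (l θ) (l θ₀) (hT θ) (hT θ₀) (hl θ) (hl θ₀)
      (fun x => (T θ - T θ₀).le_opNorm x) i
  have hcont : Tendsto (fun θ => ‖T θ - T θ₀‖) (nhds θ₀) (nhds 0) := by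
    have := (hD.continuousAt.sub (continuousAt_const (y := T θ₀))).norm
    simpa [ContinuousAt] using this
  have hsmall : ∀ᶠ θ in nhds θ₀, ‖T θ - T θ₀‖ ≤ g ∧ ‖T θ - T θ₀‖ ≤ g / 2 := by
    have h1 := hcont.eventually (ge_mem_nhds hg)
    have h2 := hcont.eventually (ge_mem_nhds (half_pos hg))
    exact h1.and h2
  rw [hasDerivAt_iff_isLittleO]
  have hD' := hasDerivAt_iff_isLittleO.1 hD
  -- This majorant is twice the right side of `hbound`; the factor 2 pays for dividing by the
  -- overlap `c`, whose modulus is at least 1/2.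
  have ho : (fun θ => 2 * (|θ - θ₀| * (‖D‖ * (‖T θ - T θ₀‖ / g))
      + ‖T θ - T θ₀ - (θ - θ₀) • D‖)) =o[nhds θ₀] fun θ => θ - θ₀ := by
    refine Asymptotics.IsLittleO.const_mul_left (Asymptotics.IsLittleO.add ?_ hD'.norm_left) 2
    have h1 : (fun θ => ‖D‖ * (‖T θ - T θ₀‖ / g)) =o[nhds θ₀] fun _ => (1 : ℝ) := by
      rw [Asymptotics.isLittleO_one_iff]
      simpa using (hcont.div_const g).const_mul ‖D‖
    have h2 := (Asymptotics.isBigO_refl (fun θ : ℝ => |θ - θ₀|) (nhds θ₀)).mul_isLittleO h1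
    simpa using h2
  refine Asymptotics.IsBigO.trans_isLittleO (Asymptotics.IsBigO.of_bound 1 ?_) ho
  filter_upwards [hsmall] with θ ⟨hs1, hs2⟩
  rw [one_mul]
  refine le_trans ?_ (le_abs_self _)
  set u' := v θ k
  have hu'1 : ‖u'‖ = 1 := (v θ).orthonormal.1 k
  set c := ⟪u, u'⟫_ℂ
  set w := u' - c • u with hw
  set τ := ‖T θ - T θ₀‖
  have hwb : ‖w‖ ≤ τ / g := by
    rw [le_div_iff₀ hg, mul_comm]
    refine (gap_mul_norm_sub_component_le (T θ₀) (v θ₀) (l θ₀) (hT θ₀) (l θ k) g hg.le k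
      (fun i hi => ?_) u').trans ?_
    · have h1 := hgap i hi
      have h2 := hweyl θ k
      have h3 := abs_sub_abs_le_abs_sub (l θ₀ i - l θ₀ k) (l θ k - l θ₀ k)
      have h4 : l θ₀ i - l θ₀ k - (l θ k - l θ₀ k) = l θ₀ i - l θ k := by ring
      rw [h4] at h3
      linarith
    · rw [← hT θ k, norm_sub_rev]
      have := (T θ - T θ₀).le_opNorm u'
      rwa [hu'1, mul_one] at this
  have hc : 1 / 2 ≤ ‖c‖ := by
    have h1 : ‖u'‖ ≤ ‖c • u‖ + ‖w‖ := by
      have := norm_add_le (c • u) w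
      rwa [hw, add_sub_cancel] at this
    rw [norm_smul, hu1, hu'1, mul_one] at h1
    have h2 : τ / g ≤ 1 / 2 := by
      rw [div_le_iff₀ hg]; linarith
    linarith
  set d := ⟪u, D u⟫_ℂ
  set r := T θ - T θ₀ - (θ - θ₀) • D with hr
  have hTr : ∀ x, T θ x - T θ₀ x = ((θ - θ₀ : ℝ) : ℂ) • D x + r x := by
    intro x
    rw [hr, _root_.sub_apply, _root_.smul_apply, Complex.coe_smul,
      _root_.sub_apply, add_sub_cancel]
  -- Pairing `(T θ - T θ₀) u'` with `u` gives the eigenvalue difference exactly. The eigenvectors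
  -- are chosen independently at each `θ`, so no derivative of them is taken; only the smallness of
  -- `w` enters.
  have key : c * ((l θ k - l θ₀ k : ℝ) - ((θ - θ₀ : ℝ) : ℂ) * d)
      = ((θ - θ₀ : ℝ) : ℂ) * ⟪u, D w⟫_ℂ + ⟪u, r u'⟫_ℂ := by
    have h1 : ⟪u, T θ u' - T θ₀ u'⟫_ℂ = ((l θ k - l θ₀ k : ℝ) : ℂ) * c := by
      rw [inner_sub_right, hT θ k, inner_smul_right, inner_apply (T θ₀) (v θ₀) (l θ₀) (hT θ₀)]
      push_cast
      ring
    have h2 : D u' = c • D u + D w := by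
      rw [← map_smul, ← map_add, hw, add_sub_cancel]
    rw [hTr, inner_add_right, inner_smul_right, h2, inner_add_right, inner_smul_right] at h1
    linear_combination -h1
  have hbound : ‖c‖ * ‖((l θ k - l θ₀ k : ℝ) : ℂ) - ((θ - θ₀ : ℝ) : ℂ) * d‖
      ≤ |θ - θ₀| * (‖D‖ * (τ / g)) + ‖r‖ := by
    rw [← norm_mul, key]
    refine (norm_add_le _ _).trans (add_le_add ?_ ?_)
    · rw [norm_mul, Complex.norm_real, Real.norm_eq_abs]
      gcongr
      calc ‖⟪u, D w⟫_ℂ‖ ≤ ‖u‖ * ‖D w‖ := norm_inner_le_norm _ _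
        _ ≤ 1 * (‖D‖ * ‖w‖) := by rw [hu1]; gcongr; exact D.le_opNorm w
        _ ≤ ‖D‖ * (τ / g) := by rw [one_mul]; gcongr
    · calc ‖⟪u, r u'⟫_ℂ‖ ≤ ‖u‖ * ‖r u'‖ := norm_inner_le_norm _ _
        _ ≤ 1 * (‖r‖ * ‖u'‖) := by rw [hu1]; gcongr; exact r.le_opNorm u'
        _ = ‖r‖ := by rw [hu'1]; ring
  have hre : ‖l θ k - l θ₀ k - (θ - θ₀) • d.re‖
      ≤ ‖((l θ k - l θ₀ k : ℝ) : ℂ) - ((θ - θ₀ : ℝ) : ℂ) * d‖ := by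
    have := Complex.abs_re_le_norm (((l θ k - l θ₀ k : ℝ) : ℂ) - ((θ - θ₀ : ℝ) : ℂ) * d)
    rwa [Complex.sub_re, Complex.re_ofReal_mul, Complex.ofReal_re] at this
  have hn := norm_nonneg (((l θ k - l θ₀ k : ℝ) : ℂ) - ((θ - θ₀ : ℝ) : ℂ) * d)
  nlinarith

/-- The component of `f` in the span of the basis vectors indexed by `s`. -/
def component (v : OrthonormalBasis (Fin q) ℂ E) (s : Finset (Fin q)) : E →ₗ[ℂ] E :=
  ∑ k ∈ s, (innerₛₗ ℂ (v k)).smulRight (v k)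

theorem component_apply (v : OrthonormalBasis (Fin q) ℂ E) (s : Finset (Fin q)) (x : E) :
    component v s x = ∑ k ∈ s, ⟪v k, x⟫_ℂ • v k := by
  simp [component]

theorem inner_component (v : OrthonormalBasis (Fin q) ℂ E) (s : Finset (Fin q)) (x : E)
    (i : Fin q) : ⟪v i, component v s x⟫_ℂ = if i ∈ s then ⟪v i, x⟫_ℂ else 0 := by
  simp [component_apply, OrthonormalBasis.inner_eq_ite]

theorem norm_sq_component (v : OrthonormalBasis (Fin q) ℂ E) (s : Finset (Fin q)) (x : E) :
    ‖component v s x‖ ^ 2 = ∑ k ∈ s, ‖⟪v k, x⟫_ℂ‖ ^ 2 := by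
  rw [← v.sum_sq_norm_inner_right]
  simp only [inner_component]
  rw [← Finset.sum_filter_add_sum_filter_not Finset.univ (· ∈ s)]
  rw [Finset.sum_congr rfl (g := fun k => ‖⟪v k, x⟫_ℂ‖ ^ 2) (by simp +contextual)]
  rw [Finset.sum_eq_zero (s := Finset.univ.filter (· ∉ s)) (by simp +contextual)]
  simp

theorem norm_component_le (v : OrthonormalBasis (Fin q) ℂ E) (s : Finset (Fin q)) (x : E) :
    ‖component v s x‖ ≤ ‖x‖ := by
  refine le_of_sq_le_sq ?_ (norm_nonneg _)
  rw [norm_sq_component, ← v.sum_sq_norm_inner_right x]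
  exact Finset.sum_le_univ_sum_of_nonneg fun _ => by positivity

/-- `T - μ` is diagonal in this basis, so it commutes with the projection and has norm at most `ε`
on its range. -/
theorem norm_component_apply_sub_le (T : E →L[ℂ] E) (v : OrthonormalBasis (Fin q) ℂ E)
    (l : Fin q → ℝ) (h : ∀ i, T (v i) = (l i : ℂ) • v i) (s : Finset (Fin q)) (μ ε : ℝ)
    (hε : 0 ≤ ε) (hs : ∀ k ∈ s, |l k - μ| ≤ ε) (x : E) :
    ‖component v s (T x - (μ : ℂ) • x)‖ ≤ ε * ‖x‖ := by
  have h1 : ‖component v s (T x - (μ : ℂ) • x)‖ ≤ ε * ‖component v s x‖ := by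
    refine le_of_sq_le_sq ?_ (by positivity)
    rw [mul_pow, norm_sq_component, norm_sq_component, Finset.mul_sum]
    refine Finset.sum_le_sum fun k hk => ?_
    rw [inner_sub_right, inner_smul_right, inner_apply T v l h, ← sub_mul, norm_mul, mul_pow,
      ← Complex.ofReal_sub, Complex.norm_real, Real.norm_eq_abs]
    have := hs k hk
    gcongr
  exact h1.trans (by gcongr; exact norm_component_le v s x)

/-- If two self-adjoint operators `T`, `T'` are close, and `A'` only connects the eigenvector
`v'_j` of `T'` to eigenvectors with distant eigenvalues, then an operator `A` close to `A'` hardly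
connects `v_j` to eigenvectors of `T` with eigenvalues close to that of `v_j`. -/
theorem norm_component_apply_eigenvector_le (T T' A A' : E →L[ℂ] E)
    (v v' : OrthonormalBasis (Fin q) ℂ E) (l l' : Fin q → ℝ)
    (hT : ∀ i, T (v i) = (l i : ℂ) • v i) (hT' : ∀ i, T' (v' i) = (l' i : ℂ) • v' i)
    {δ ε κ g M : ℝ} (hδ : 0 ≤ δ) (hδε : δ ≤ ε) (hκ : 0 < κ) (hg : 0 < g) (hM : 0 ≤ M)
    (hTT' : ∀ x, ‖T x - T' x‖ ≤ δ * ‖x‖) (hAA' : ∀ x, ‖A x - A' x‖ ≤ δ * ‖x‖)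
    (hA' : ∀ x, ‖A' x‖ ≤ M * ‖x‖) (j : Fin q) (hll' : |l j - l' j| ≤ δ)
    (hgap : ∀ a, a ≠ j → κ ≤ |l' a - l' j|)
    (hfib : ∀ a, a ≠ j → ⟪v' a, A' (v' j)⟫_ℂ ≠ 0 → g ≤ |l' a - l' j|)
    (s : Finset (Fin q)) (hs : ∀ k ∈ s, k ≠ j ∧ |l k - l j| ≤ ε) :
    ‖component v s (A (v j))‖ ≤ δ + 2 * M * min 1 (2 * δ / κ) + M * min 1 (4 * ε / g) := by
  have hε : 0 ≤ ε := hδ.trans hδε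
  have hvj : ‖v j‖ = 1 := v.orthonormal.1 j
  have hv'j : ‖v' j‖ = 1 := v'.orthonormal.1 j
  -- Decomposition behind the bound: `v j = c v' j + w` and `A' (v' j) = e v' j + f`. The errors `A
  -- - A'`, `A' w` and the `v' j` part are small because `v j` is close to `v' j`; the remaining
  -- part `f` has only eigenvalues of `T'` far from `l' j`.
  set c := ⟪v' j, v j⟫_ℂ with hc
  set w := v j - c • v' j with hw
  have hc1 : ‖c‖ ≤ 1 := by
    have := norm_inner_le_norm (𝕜 := ℂ) (v' j) (v j)
    rwa [hvj, hv'j, mul_one] at this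
  have hw2 : ‖w‖ ^ 2 = 1 - ‖c‖ ^ 2 := by
    have h1 := norm_sq_sub_component v' j (v j)
    have h2 := v'.sum_sq_norm_inner_right (v j)
    rw [← Finset.add_sum_erase _ _ (Finset.mem_univ j), hvj] at h2
    rw [hw, hc, h1]
    linarith
  have hw1 : ‖w‖ ≤ 1 := by
    have := norm_nonneg w
    nlinarith [norm_nonneg c]
  have hwb : ‖w‖ ≤ min 1 (2 * δ / κ) := by
    refine le_min hw1 ?_
    rcases le_total κ (2 * δ) with h | h
    · exact hw1.trans ((one_le_div hκ).2 h)
    · have h1 := gap_mul_norm_sub_component_le T' v' l' hT' (l j) (κ / 2) (by positivity) j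
        (fun i hi => by
          have h2 := hgap i hi
          have h3 := abs_sub_abs_le_abs_sub (l' i - l' j) (l j - l' j)
          rw [show l' i - l' j - (l j - l' j) = l' i - l j by ring] at h3
          linarith) (v j)
      rw [← hT, norm_sub_rev (T' (v j))] at h1
      have h2 := hTT' (v j)
      rw [hvj, mul_one] at h2
      rw [le_div_iff₀ hκ]
      linarith
  -- Since `j ∉ s`, the projection of the unit vector `v' j` misses its overlap with `v j`, which
  -- leaves at most `1 - ‖c‖ ^ 2 = ‖w‖ ^ 2`.
  have hPv' : ‖component v s (v' j)‖ ≤ ‖w‖ := by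
    refine le_of_sq_le_sq ?_ (norm_nonneg _)
    rw [norm_sq_component, hw2]
    have h2 := v.sum_sq_norm_inner_right (v' j)
    rw [← Finset.add_sum_erase _ _ (Finset.mem_univ j), hv'j] at h2
    have h3 : ∑ k ∈ s, ‖⟪v k, v' j⟫_ℂ‖ ^ 2 ≤ ∑ k ∈ Finset.univ.erase j, ‖⟪v k, v' j⟫_ℂ‖ ^ 2 :=
      Finset.sum_le_sum_of_subset_of_nonneg
        (fun k hk => by simpa using (hs k hk).1) (fun _ _ _ => by positivity)
    rw [hc, norm_inner_symm]
    linarith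
  set e := ⟪v' j, A' (v' j)⟫_ℂ with he
  set f := A' (v' j) - e • v' j with hf
  have hA'v' : ‖A' (v' j)‖ ≤ M := by simpa [hv'j] using hA' (v' j)
  have he1 : ‖e‖ ≤ M := by
    have := norm_inner_le_norm (𝕜 := ℂ) (v' j) (A' (v' j))
    rw [hv'j, one_mul] at this
    exact this.trans hA'v'
  have hfM : ‖f‖ ≤ M := by
    refine le_of_sq_le_sq ?_ hM
    rw [hf, he, norm_sq_sub_component]
    have h2 := v'.sum_sq_norm_inner_right (A' (v' j))
    rw [← Finset.add_sum_erase _ _ (Finset.mem_univ j)] at h2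
    have : ‖A' (v' j)‖ ^ 2 ≤ M ^ 2 := by gcongr
    nlinarith [sq_nonneg ‖⟪v' j, A' (v' j)⟫_ℂ‖]
  have hfb : ‖component v s f‖ ≤ M * min 1 (4 * ε / g) := by
    rw [mul_min_of_nonneg _ _ hM, mul_one]
    have hfM' := (norm_component_le v s f).trans hfM
    refine le_min hfM' ?_
    -- If `g ≤ 2δ ≤ 2ε`, the quotient `4ε/g` exceeds 1 and the trivial bound suffices.
    rcases le_or_gt g (2 * δ) with h | h
    · refine hfM'.trans (le_mul_of_one_le_right hM ((one_le_div hg).2 ?_))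
      linarith
    · have hfinner : ∀ a, ⟪v' a, f⟫_ℂ = if a = j then 0 else ⟪v' a, A' (v' j)⟫_ℂ := by
        intro a
        by_cases haj : a = j
        · subst haj
          simp [hf, he]
        · simp [hf, haj]
      have hgap' : ∀ a, ⟪v' a, f⟫_ℂ ≠ 0 → g / 2 ≤ |l' a - l j| := by
        intro a ha
        rw [hfinner] at ha
        have haj : a ≠ j := fun h => ha (if_pos h)
        rw [if_neg haj] at ha
        have h2 := hfib a haj ha
        have h3 := abs_sub_abs_le_abs_sub (l' a - l' j) (l j - l' j)
        rw [show l' a - l' j - (l j - l' j) = l' a - l j by ring] at h3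
        linarith
      -- Solve `(T' - l j) x = f`; the inverse is bounded by `2/g` on the eigenvectors occurring in
      -- `f`. Then `f = (T - l j) x - (T - T') x`, whose projection to resonant eigenvectors is at
      -- most `(ε + δ) ‖x‖`.
      set x := ∑ a, (⟪v' a, f⟫_ℂ / ((l' a - l j : ℝ) : ℂ)) • v' a with hx
      have hxinner : ∀ a, ⟪v' a, x⟫_ℂ = ⟪v' a, f⟫_ℂ / ((l' a - l j : ℝ) : ℂ) := by
        intro a
        simp [hx, OrthonormalBasis.inner_eq_ite]
      have hTx : T' x - (l j : ℂ) • x = f := by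
        refine v'.toBasis.ext_elem fun a => ?_
        simp only [OrthonormalBasis.coe_toBasis_repr_apply, OrthonormalBasis.repr_apply_apply]
        rw [inner_sub_right, inner_smul_right, inner_apply T' v' l' hT', hxinner, ← sub_mul,
          ← Complex.ofReal_sub]
        by_cases ha : ⟪v' a, f⟫_ℂ = 0
        · simp [ha]
        · have h1 := hgap' a ha
          have h2 : ((l' a - l j : ℝ) : ℂ) ≠ 0 := by
            intro h0
            rw [Complex.ofReal_eq_zero] at h0
            rw [h0, abs_zero] at h1
            linarith
          rw [mul_div_cancel₀ _ h2]
      have hxb : ‖x‖ ≤ 2 * M / g := by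
        rw [le_div_iff₀ hg]
        have h1 : ‖x‖ * (g / 2) ≤ ‖f‖ := by
          refine le_of_sq_le_sq ?_ (norm_nonneg _)
          rw [mul_pow, ← v'.sum_sq_norm_inner_right x, ← v'.sum_sq_norm_inner_right f,
            Finset.sum_mul]
          refine Finset.sum_le_sum fun a _ => ?_
          rw [hxinner]
          by_cases ha : ⟪v' a, f⟫_ℂ = 0
          · simp [ha]
          · have h1 := hgap' a ha
            have h2 : 0 < |l' a - l j| := lt_of_lt_of_le (by positivity) h1
            rw [norm_div, Complex.norm_real, Real.norm_eq_abs, ← mul_pow]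
            have h3 : ‖⟪v' a, f⟫_ℂ‖ / |l' a - l j| * (g / 2) ≤ ‖⟪v' a, f⟫_ℂ‖ := by
              rw [div_mul_eq_mul_div, div_le_iff₀ h2]
              gcongr
            gcongr
        linarith
      have hfx : f = (T x - (l j : ℂ) • x) - (T x - T' x) := by rw [← hTx]; abel
      have h5 : ‖component v s f‖ ≤ ε * ‖x‖ + δ * ‖x‖ := by
        rw [hfx, map_sub]
        refine (norm_sub_le _ _).trans (add_le_add ?_ ?_)
        · exact norm_component_apply_sub_le T v l hT s (l j) ε hε (fun k hk => (hs k hk).2) x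
        · exact (norm_component_le v s _).trans (hTT' x)
      calc ‖component v s f‖ ≤ ε * ‖x‖ + ε * ‖x‖ := by
            refine h5.trans ?_
            gcongr
        _ = 2 * ε * ‖x‖ := by ring
        _ ≤ 2 * ε * (2 * M / g) := by gcongr
        _ = M * (4 * ε / g) := by ring
  have hdec : A (v j) = (A (v j) - A' (v j)) + A' w + c • (e • v' j) + c • f := by
    have h1 : A' (v j) = A' w + c • A' (v' j) := by
      rw [← map_smul, ← map_add, hw, sub_add_cancel]
    rw [hf, smul_sub, h1]
    abel
  have e1 : ‖component v s (A (v j) - A' (v j))‖ ≤ δ := by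
    refine (norm_component_le v s _).trans ?_
    simpa [hvj] using hAA' (v j)
  have e2 : ‖component v s (A' w)‖ ≤ M * min 1 (2 * δ / κ) :=
    (norm_component_le v s _).trans ((hA' w).trans (by gcongr))
  have e3 : ‖component v s (c • (e • v' j))‖ ≤ M * min 1 (2 * δ / κ) := by
    rw [map_smul, map_smul, norm_smul, norm_smul]
    calc ‖c‖ * (‖e‖ * ‖component v s (v' j)‖) ≤ 1 * (M * min 1 (2 * δ / κ)) := by
          gcongr
          exact hPv'.trans hwb
      _ = _ := one_mul _
  have e4 : ‖component v s (c • f)‖ ≤ M * min 1 (4 * ε / g) := by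
    rw [map_smul, norm_smul]
    calc ‖c‖ * ‖component v s f‖ ≤ 1 * (M * min 1 (4 * ε / g)) := by gcongr
      _ = _ := one_mul _
  rw [hdec, map_add, map_add, map_add]
  refine (norm_add_le _ _).trans ?_
  have t1 := norm_add_le (component v s (A (v j) - A' (v j)) + component v s (A' w))
    (component v s (c • (e • v' j)))
  have t2 := norm_add_le (component v s (A (v j) - A' (v j))) (component v s (A' w))
  linarith

end SpectralBasis
end

noncomputable section

open Matrix

/-! ### Quasi-periodic sequences -/

/-- The extension `u_{j + pq} = z^p u_j` of a vector `u` to a quasi-periodic sequence. -/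
def quasiExt (q : ℕ) [NeZero q] (z : ℂ) (u : Fin q → ℂ) (n : ℤ) : ℂ :=
  z ^ (n / (q : ℤ)) * u (Fin.ofNat q (n % (q : ℤ)).toNat)

theorem quasiExt_add_period (q : ℕ) [NeZero q] {z : ℂ} (hz : z ≠ 0) (u : Fin q → ℂ) (n : ℤ) :
    quasiExt q z u (n + q) = z * quasiExt q z u n := by
  have hq : (q : ℤ) ≠ 0 := by exact_mod_cast NeZero.ne q
  rw [quasiExt, quasiExt, Int.add_emod_right, Int.add_ediv_of_dvd_right (dvd_refl _),
    Int.ediv_self hq, zpow_add₀ hz, zpow_one]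
  ring

theorem quasiExt_coe (q : ℕ) [NeZero q] (z : ℂ) (u : Fin q → ℂ) (j : Fin q) :
    quasiExt q z u (j : ℕ) = u j := by
  have h1 : ((j : ℕ) : ℤ) / (q : ℤ) = 0 := by
    exact_mod_cast Nat.div_eq_of_lt j.2
  have h2 : (((j : ℕ) : ℤ) % (q : ℤ)).toNat = j := by
    rw [← Int.natCast_mod, Int.toNat_natCast, Nat.mod_eq_of_lt j.2]
  rw [quasiExt, h1, h2, zpow_zero, one_mul]
  congr 1
  ext
  simp

theorem quasi_add_mul {z : ℂ} (hz : z ≠ 0) (q : ℕ) (w : ℤ → ℂ)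
    (hw : ∀ n, w (n + q) = z * w n) (n k : ℤ) : w (n + k * q) = z ^ k * w n := by
  induction k using Int.induction_on with
  | zero => simp
  | succ i ih =>
    rw [add_mul, one_mul, ← add_assoc, hw, ih, zpow_add₀ hz, zpow_one]
    ring
  | pred i ih =>
    have h := hw (n + (-(i : ℤ) - 1) * q)
    rw [show n + (-(i : ℤ) - 1) * q + q = n + -(i : ℤ) * q by ring, ih] at h
    rw [zpow_sub_one₀ hz, mul_assoc, mul_comm z⁻¹, ← mul_assoc, h]
    field_simp

/-- Reduces identities between quasi-periodic sequences to a comparison on one period. -/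
theorem eq_quasiExt (q : ℕ) [NeZero q] {z : ℂ} (hz : z ≠ 0) (u : Fin q → ℂ) (w : ℤ → ℂ)
    (hw : ∀ n, w (n + q) = z * w n) (hwu : ∀ j : Fin q, w (j : ℕ) = u j) :
    w = quasiExt q z u := by
  have hq : (q : ℤ) ≠ 0 := by exact_mod_cast NeZero.ne q
  funext n
  have h1 := quasi_add_mul hz q w hw (n % q) (n / q)
  have h0 : 0 ≤ n % (q : ℤ) := Int.emod_nonneg n hq
  have hlt : (n % (q : ℤ)).toNat < q := by
    have := Int.emod_lt_of_pos n (show (0 : ℤ) < q by have := NeZero.pos q; exact_mod_cast this)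
    omega
  rw [mul_comm (n / (q : ℤ)), Int.emod_add_mul_ediv] at h1
  rw [h1, quasiExt, ← hwu]
  congr 2
  simp only [Fin.val_ofNat, Nat.mod_eq_of_lt hlt]
  exact (Int.toNat_of_nonneg h0).symm

theorem sum_fin_add_one_of_periodic {M : Type*} [AddCommGroup M] (q : ℕ) (F : ℤ → M)
    (hF : ∀ n, F (n + q) = F n) (d : ℤ) :
    ∑ j : Fin q, F ((j : ℕ) + d + 1) = ∑ j : Fin q, F ((j : ℕ) + d) := by
  rw [Fin.sum_univ_eq_sum_range (fun j => F ((j : ℤ) + d + 1)),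
    Fin.sum_univ_eq_sum_range (fun j => F ((j : ℤ) + d))]
  have h1 := Finset.sum_range_succ (fun j : ℕ => F ((j : ℤ) + d)) q
  have h2 := Finset.sum_range_succ' (fun j : ℕ => F ((j : ℤ) + d)) q
  have h3 : F ((q : ℤ) + d) = F (((0 : ℕ) : ℤ) + d) := by
    rw [add_comm, hF]; simp
  rw [h3] at h1
  have h4 : ∑ k ∈ Finset.range q, F (((k + 1 : ℕ) : ℤ) + d)
      = ∑ k ∈ Finset.range q, F ((k : ℤ) + d + 1) := by
    refine Finset.sum_congr rfl fun k _ => ?_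
    congr 1
    push_cast
    ring
  rw [h1, h4] at h2
  exact (add_right_cancel h2).symm

theorem sum_fin_add_of_periodic {M : Type*} [AddCommGroup M] (q : ℕ) (F : ℤ → M)
    (hF : ∀ n, F (n + q) = F n) (d : ℤ) :
    ∑ j : Fin q, F ((j : ℕ) + d) = ∑ j : Fin q, F (j : ℕ) := by
  induction d using Int.induction_on with
  | zero => simp
  | succ i ih => rw [← ih, ← sum_fin_add_one_of_periodic q F hF i]; simp [add_assoc]
  | pred i ih => rw [← ih, ← sum_fin_add_one_of_periodic q F hF (-(i : ℤ) - 1)]; simp [add_assoc]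

/-! ### Periodic band matrices -/

/-- A tridiagonal `q × q` matrix with two corner terms twisted by `z`. -/
def bandMatrix (q : ℕ) (α β : ℂ) (a b : ℤ → ℝ) (z : ℂ) : Matrix (Fin q) (Fin q) ℂ :=
  Matrix.of fun j k =>
    (if j = k then (b j : ℂ) else 0)
      + (if (j : ℕ) + 1 = k then α * a j else 0)
      + (if (k : ℕ) + 1 = j then β * a k else 0)
      + (if (j : ℕ) = 0 ∧ (k : ℕ) + 1 = q then β * a k * z⁻¹ else 0)
      + (if (k : ℕ) = 0 ∧ (j : ℕ) + 1 = q then α * a j * z else 0)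

/-- The corner entries are the hoppings that leave the block `0, …, q-1`; the factors `z` and `z⁻¹`
bring them back by quasi-periodicity. The matrix thus becomes a three-term operator on sequences
over ℤ, with no boundary left, also for `q = 1, 2` where entries overlap. -/
theorem bandMatrix_mulVec (q : ℕ) [NeZero q] (α β : ℂ) (a b : ℤ → ℝ)
    (ha : ∀ n, a (n + q) = a n) {z : ℂ} (hz : z ≠ 0) (u : Fin q → ℂ) (j : Fin q) :
    (bandMatrix q α β a b z *ᵥ u) j
      = α * a (j : ℕ) * quasiExt q z u ((j : ℕ) + 1) + b (j : ℕ) * quasiExt q z u (j : ℕ)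
        + β * a ((j : ℕ) - 1) * quasiExt q z u ((j : ℕ) - 1) := by
  have hqpos : 0 < q := NeZero.pos q
  simp only [bandMatrix, Matrix.mulVec, dotProduct, Matrix.of_apply, add_mul,
    Finset.sum_add_distrib, ite_mul, zero_mul]
  have s1 : ∑ k : Fin q, (if j = k then (b (j : ℕ) : ℂ) * u k else 0)
      = b (j : ℕ) * quasiExt q z u (j : ℕ) := by
    rw [quasiExt_coe]; simp
  -- Only one of the two sums contributes: the superdiagonal when `j + 1 < q`, the corner when `j +
  -- 1 = q`. The sum `s3` treats `j - 1` in the same way.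
  have s2 : ∑ k : Fin q, (if (j : ℕ) + 1 = k then α * a (j : ℕ) * u k else 0)
      + ∑ k : Fin q, (if (k : ℕ) = 0 ∧ (j : ℕ) + 1 = q then α * a (j : ℕ) * z * u k else 0)
      = α * a (j : ℕ) * quasiExt q z u ((j : ℕ) + 1) := by
    rcases Nat.lt_or_ge ((j : ℕ) + 1) q with h | h
    · rw [Finset.sum_eq_single ⟨(j : ℕ) + 1, h⟩, Finset.sum_eq_zero]
      · have := quasiExt_coe q z u ⟨(j : ℕ) + 1, h⟩
        push_cast at this
        simp [this]
      · intro k _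
        rw [if_neg]; omega
      · intro k _ hk
        rw [if_neg]
        intro h'
        exact hk (Fin.ext h'.symm)
      · simp
    · have hj : (j : ℕ) + 1 = q := by have := j.2; omega
      rw [Finset.sum_eq_zero, Finset.sum_eq_single ⟨0, hqpos⟩]
      · have h0 := quasiExt_coe q z u ⟨0, hqpos⟩
        have h1 := quasiExt_add_period q hz u 0
        rw [show ((j : ℕ) : ℤ) + 1 = 0 + (q : ℤ) by omega, h1]
        simp only [Nat.cast_zero] at h0
        rw [h0]
        simp [hj]
        ring
      · intro k _ hk
        rw [if_neg]
        rintro ⟨h', -⟩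
        exact hk (Fin.ext h')
      · simp
      · intro k _
        rw [if_neg]
        have := k.2
        omega
  have s3 : ∑ k : Fin q, (if (k : ℕ) + 1 = j then β * a (k : ℕ) * u k else 0)
      + ∑ k : Fin q, (if (j : ℕ) = 0 ∧ (k : ℕ) + 1 = q then β * a (k : ℕ) * z⁻¹ * u k else 0)
      = β * a ((j : ℕ) - 1) * quasiExt q z u ((j : ℕ) - 1) := by
    rcases Nat.eq_zero_or_pos (j : ℕ) with h | h
    · rw [Finset.sum_eq_zero, Finset.sum_eq_single ⟨q - 1, by omega⟩]
      · have h0 := quasiExt_coe q z u ⟨q - 1, by omega⟩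
        have h1 := quasiExt_add_period q hz u (-1)
        have h2 := ha (-1)
        have h3 : (-1 : ℤ) + q = ((q - 1 : ℕ) : ℤ) := by omega
        rw [h3] at h1 h2
        rw [h0] at h1
        simp only [h, Nat.cast_zero, zero_sub]
        rw [← h2, h1]
        have h5 : q - 1 + 1 = q := by omega
        simp only [h5, and_self, if_true]
        field_simp
        ring
      · intro k _ hk
        rw [if_neg]
        rintro ⟨-, h'⟩
        refine hk (Fin.ext ?_)
        simp
        omega
      · simp
      · intro k _
        rw [if_neg]; omega
    · have hlt := j.2
      rw [Finset.sum_eq_single ⟨(j : ℕ) - 1, by omega⟩, Finset.sum_eq_zero]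
      · have := quasiExt_coe q z u ⟨(j : ℕ) - 1, by omega⟩
        have h3 : ((j : ℕ) : ℤ) - 1 = (((j : ℕ) - 1 : ℕ) : ℤ) := by omega
        have h4 : (j : ℕ) - 1 + 1 = j := by omega
        rw [h3, this]
        simp [h4]
      · intro k _
        rw [if_neg]; omega
      · intro k _ hk
        rw [if_neg]
        intro h'
        refine hk (Fin.ext ?_)
        simp
        omega
      · simp
  rw [← s1, ← s2, ← s3]
  ring

/-- The image is a sum of three weighted shifts of the extended sequence. For unimodular `z` its
modulus is `q`-periodic, so a shift does not change the norm over one period. -/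
theorem norm_bandMatrix_mulVec_le (q : ℕ) [NeZero q] {α β : ℂ} (hα : ‖α‖ ≤ 1) (hβ : ‖β‖ ≤ 1)
    (a b : ℤ → ℝ) (ha : ∀ n, a (n + q) = a n) {z : ℂ} (hz : ‖z‖ = 1) {C₁ C₂ : ℝ}
    (h₁ : ∀ n, |a n| ≤ C₁) (h₂ : ∀ n, |b n| ≤ C₂) (x : EuclideanSpace ℂ (Fin q)) :
    ‖toEuclideanCLM (𝕜 := ℂ) (bandMatrix q α β a b z) x‖ ≤ (2 * C₁ + C₂) * ‖x‖ := by
  have hz0 : z ≠ 0 := by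
    intro h
    simp [h] at hz
  have hC₁ : 0 ≤ C₁ := (abs_nonneg _).trans (h₁ 0)
  have hC₂ : 0 ≤ C₂ := (abs_nonneg _).trans (h₂ 0)
  set w := quasiExt q z x.ofLp with hw
  have hterm : ∀ (c : ℤ → ℂ) (C : ℝ) (d : ℤ), 0 ≤ C → (∀ n, ‖c n‖ ≤ C) →
      ‖(WithLp.toLp 2 fun j : Fin q => c (j : ℕ) * w ((j : ℕ) + d) :
        EuclideanSpace ℂ (Fin q))‖ ≤ C * ‖x‖ := by
    intro c C d hC hc
    refine le_of_sq_le_sq ?_ (by positivity)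
    rw [mul_pow, EuclideanSpace.norm_sq_eq, EuclideanSpace.norm_sq_eq]
    have hper : ∀ n, ‖w (n + q)‖ ^ 2 = ‖w n‖ ^ 2 := by
      intro n
      rw [hw, quasiExt_add_period q hz0, norm_mul, hz, one_mul]
    have hsum := sum_fin_add_of_periodic q (fun n => ‖w n‖ ^ 2) hper d
    have hx : ∑ j : Fin q, ‖w (j : ℕ)‖ ^ 2 = ∑ j : Fin q, ‖x j‖ ^ 2 :=
      Finset.sum_congr rfl fun j _ => by rw [hw, quasiExt_coe]
    rw [← hx, ← hsum, Finset.mul_sum]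
    refine Finset.sum_le_sum fun j _ => ?_
    simp only
    rw [norm_mul, mul_pow]
    have := hc (j : ℕ)
    gcongr
  have hdec : toEuclideanCLM (𝕜 := ℂ) (bandMatrix q α β a b z) x
      = WithLp.toLp 2 (fun j : Fin q => (fun n => α * a n) (j : ℕ) * w ((j : ℕ) + 1))
        + WithLp.toLp 2 (fun j : Fin q => (fun n => (b n : ℂ)) (j : ℕ) * w ((j : ℕ) + 0))
        + WithLp.toLp 2 (fun j : Fin q => (fun n => β * a (n - 1)) (j : ℕ) * w ((j : ℕ) + -1)) := by
    ext j
    have := bandMatrix_mulVec q α β a b ha hz0 x.ofLp j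
    simp only [ofLp_toEuclideanCLM, this, PiLp.add_apply, add_zero]
    rfl
  rw [hdec]
  have t1 := hterm (fun n => α * a n) C₁ 1 hC₁ (fun n => by
    rw [norm_mul, Complex.norm_real, Real.norm_eq_abs]
    calc ‖α‖ * |a n| ≤ 1 * C₁ := by gcongr; exact h₁ n
      _ = C₁ := one_mul _)
  have t2 := hterm (fun n => (b n : ℂ)) C₂ 0 hC₂ (fun n => by simpa using h₂ n)
  have t3 := hterm (fun n => β * a (n - 1)) C₁ (-1) hC₁ (fun n => by
    rw [norm_mul, Complex.norm_real, Real.norm_eq_abs]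
    calc ‖β‖ * |a (n - 1)| ≤ 1 * C₁ := by gcongr; exact h₁ _
      _ = C₁ := one_mul _)
  refine (norm_add₃_le).trans ?_
  linarith

end

/-! ### Floquet multipliers and the action of the fibres on quasi-periodic sequences. -/

noncomputable section

open Matrix Polynomial

/-- The Floquet multiplier `e^{2πiθ}`. -/
def multiplier (θ : ℝ) : ℂ := Complex.exp (2 * Real.pi * θ * Complex.I)

theorem norm_multiplier (θ : ℝ) : ‖multiplier θ‖ = 1 := by
  have := Complex.norm_exp_ofReal_mul_I (2 * Real.pi * θ)
  rw [multiplier]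
  push_cast at this
  exact this

theorem multiplier_ne_zero (θ : ℝ) : multiplier θ ≠ 0 := Complex.exp_ne_zero _

theorem multiplier_add_inv (θ : ℝ) :
    multiplier θ + (multiplier θ)⁻¹ = ((2 * Real.cos (2 * Real.pi * θ) : ℝ) : ℂ) := by
  rw [multiplier, ← Complex.exp_neg, Complex.ofReal_mul, Complex.ofReal_cos, Complex.cos]
  push_cast
  rw [← neg_mul]
  ring

theorem sin_eq_zero_of_multiplier_sq {θ : ℝ} (h : multiplier θ ^ 2 = 1) :
    Real.sin (2 * Real.pi * θ) = 0 := by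
  have h1 : (multiplier θ) = Real.cos (2 * Real.pi * θ) + Real.sin (2 * Real.pi * θ) * Complex.I := by
    rw [multiplier, Complex.exp_mul_I]; push_cast; rfl
  have hc := Real.sin_sq_add_cos_sq (2 * Real.pi * θ)
  generalize Real.cos (2 * Real.pi * θ) = c at *
  generalize Real.sin (2 * Real.pi * θ) = s at *
  rw [h1] at h
  have hre := congrArg Complex.re h
  simp [pow_two] at hre
  nlinarith

namespace JacobiMatrix

theorem floquet_eq_bandMatrix (J : JacobiMatrix) (q : ℕ) (θ : ℝ) :
    J.floquet q θ = bandMatrix q 1 1 J.a J.b (multiplier θ) := by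
  ext j k
  simp [floquet, bandMatrix, multiplier, Complex.exp_neg]

theorem floquetMomentum_eq_bandMatrix (J : JacobiMatrix) (q : ℕ) (θ : ℝ) :
    J.floquetMomentum q θ
      = bandMatrix q Complex.I (-Complex.I) J.a (fun _ => 0) (multiplier θ) := by
  ext j k
  simp [floquetMomentum, bandMatrix, multiplier, Complex.exp_neg]

theorem one_le_of_isRBounded {J : JacobiMatrix} {R : ℝ} (hR : 0 < R) (h : J.IsRBounded R) :
    1 ≤ R := by
  have h1 := (h 0).1.trans (h 0).2.1
  rw [div_le_iff₀ hR] at h1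
  nlinarith

theorem IsRBounded.a_pos {J : JacobiMatrix} {R : ℝ} (hR : 0 < R) (h : J.IsRBounded R) (n : ℤ) :
    0 < J.a n := lt_of_lt_of_le (by positivity) (h n).1

theorem IsRBounded.abs_a_le {J : JacobiMatrix} {R : ℝ} (hR : 0 < R) (h : J.IsRBounded R) (n : ℤ) :
    |J.a n| ≤ R := by
  rw [abs_of_pos (h.a_pos hR n)]
  exact (h n).2.1

theorem a_pos (J : JacobiMatrix) (n : ℤ) : 0 < J.a n := by
  obtain ⟨δ, hδ, h⟩ := J.a_inf_pos
  exact hδ.trans_le (h n)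

/-- The action of the Jacobi matrix on an arbitrary sequence. -/
def seqOp (J : JacobiMatrix) (w : ℤ → ℂ) (n : ℤ) : ℂ :=
  J.a n * w (n + 1) + J.b n * w n + J.a (n - 1) * w (n - 1)

/-- The action of the momentum operator on an arbitrary sequence. -/
def seqMomentum (J : JacobiMatrix) (w : ℤ → ℂ) (n : ℤ) : ℂ :=
  Complex.I * J.a n * w (n + 1) - Complex.I * J.a (n - 1) * w (n - 1)

theorem seqOp_quasi {J : JacobiMatrix} {q : ℕ} (hJ : J.IsPeriodic q) {z : ℂ} {w : ℤ → ℂ}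
    (hw : ∀ n, w (n + q) = z * w n) (n : ℤ) : J.seqOp w (n + q) = z * J.seqOp w n := by
  have h1 := hw (n + 1)
  have h2 := hw (n - 1)
  have h3 := (hJ (n - 1)).1
  rw [show n + 1 + (q : ℤ) = n + q + 1 by ring] at h1
  rw [show n - 1 + (q : ℤ) = n + q - 1 by ring] at h2 h3
  rw [seqOp, seqOp, (hJ n).1, (hJ n).2, h1, h2, h3, hw]
  ring

theorem seqMomentum_quasi {J : JacobiMatrix} {q : ℕ} (hJ : J.IsPeriodic q) {z : ℂ} {w : ℤ → ℂ}
    (hw : ∀ n, w (n + q) = z * w n) (n : ℤ) :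
    J.seqMomentum w (n + q) = z * J.seqMomentum w n := by
  have h1 := hw (n + 1)
  have h2 := hw (n - 1)
  have h3 := (hJ (n - 1)).1
  rw [show n + 1 + (q : ℤ) = n + q + 1 by ring] at h1
  rw [show n - 1 + (q : ℤ) = n + q - 1 by ring] at h2 h3
  rw [seqMomentum, seqMomentum, (hJ n).1, h1, h2, h3]
  ring

theorem floquet_mulVec (J : JacobiMatrix) {q : ℕ} [NeZero q] (hJ : J.IsPeriodic q) (θ : ℝ)
    (u : Fin q → ℂ) (j : Fin q) :
    (J.floquet q θ *ᵥ u) j = J.seqOp (quasiExt q (multiplier θ) u) (j : ℕ) := by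
  rw [floquet_eq_bandMatrix, bandMatrix_mulVec q 1 1 J.a J.b (fun n => (hJ n).1)
    (multiplier_ne_zero θ), seqOp]
  ring

theorem floquetMomentum_mulVec (J : JacobiMatrix) {q : ℕ} [NeZero q] (hJ : J.IsPeriodic q) (θ : ℝ)
    (u : Fin q → ℂ) (j : Fin q) :
    (J.floquetMomentum q θ *ᵥ u) j = J.seqMomentum (quasiExt q (multiplier θ) u) (j : ℕ) := by
  rw [floquetMomentum_eq_bandMatrix, bandMatrix_mulVec q _ _ J.a _ (fun n => (hJ n).1)
    (multiplier_ne_zero θ), seqMomentum]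
  push_cast
  ring

theorem quasiExt_floquet_mulVec (J : JacobiMatrix) {q : ℕ} [NeZero q] (hJ : J.IsPeriodic q)
    (θ : ℝ) (u : Fin q → ℂ) :
    quasiExt q (multiplier θ) (J.floquet q θ *ᵥ u) = J.seqOp (quasiExt q (multiplier θ) u) :=
  (eq_quasiExt q (multiplier_ne_zero θ) _ _
    (seqOp_quasi hJ (quasiExt_add_period q (multiplier_ne_zero θ) u))
    (fun j => (floquet_mulVec J hJ θ u j).symm)).symm

/-! ### Transfer matrices and the discriminant -/

/-- The one-step transfer matrix, acting on `(w_n, a_{n-1} w_{n-1})`. -/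
def stepPoly (J : JacobiMatrix) (n : ℕ) : Matrix (Fin 2) (Fin 2) ℝ[X] :=
  !![C (1 / J.a n) * (X - C (J.b n)), -C (1 / J.a n); C (J.a n), 0]

/-- The transfer matrix over `n` steps. -/
def transferPoly (J : JacobiMatrix) : ℕ → Matrix (Fin 2) (Fin 2) ℝ[X]
  | 0 => 1
  | n + 1 => J.stepPoly n * transferPoly J n

/-- The discriminant: the trace of the transfer matrix over `q` steps. -/
def disc (J : JacobiMatrix) (q : ℕ) : ℝ[X] := (J.transferPoly q).trace

/-- Storing `a_{n-1} w_{n-1}` instead of `w_{n-1}` makes every single step unimodular, whatever the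
coefficients. -/
theorem det_transferPoly (J : JacobiMatrix) (n : ℕ) : (J.transferPoly n).det = 1 := by
  induction n with
  | zero => simp [transferPoly]
  | succ n ih =>
    have h := (J.a_pos n).ne'
    rw [transferPoly, Matrix.det_mul, ih, mul_one, stepPoly, Matrix.det_fin_two_of]
    rw [mul_zero, zero_sub, neg_mul, neg_neg, ← C_mul, one_div_mul_cancel h, C_1]

/-- The one-step transfer matrix at energy `E`. -/
def step (J : JacobiMatrix) (n : ℕ) (E : ℂ) : Matrix (Fin 2) (Fin 2) ℂ :=
  (aeval (R := ℝ) E).mapMatrix (J.stepPoly n)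

/-- The transfer matrix at energy `E`. -/
def transfer (J : JacobiMatrix) (n : ℕ) (E : ℂ) : Matrix (Fin 2) (Fin 2) ℂ :=
  (aeval (R := ℝ) E).mapMatrix (J.transferPoly n)

theorem step_eq (J : JacobiMatrix) (n : ℕ) (E : ℂ) :
    J.step n E = !![(E - J.b n) / J.a n, -1 / J.a n; (J.a n : ℂ), 0] := by
  ext i j
  fin_cases i <;> fin_cases j <;> simp [step, stepPoly, div_eq_inv_mul]

theorem transfer_succ (J : JacobiMatrix) (n : ℕ) (E : ℂ) :
    J.transfer (n + 1) E = J.step n E * J.transfer n E := by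
  rw [transfer, transferPoly, map_mul]; rfl

theorem transfer_zero (J : JacobiMatrix) (E : ℂ) : J.transfer 0 E = 1 := by
  rw [transfer, transferPoly, map_one]

theorem det_transfer (J : JacobiMatrix) (n : ℕ) (E : ℂ) : (J.transfer n E).det = 1 := by
  rw [transfer, ← AlgHom.map_det, det_transferPoly, map_one]

theorem trace_transfer (J : JacobiMatrix) (q : ℕ) (E : ℂ) :
    (J.transfer q E).trace = aeval E (J.disc q) := by
  simp [transfer, disc, Matrix.trace, Matrix.diag]

/-- The data `(w_n, a_{n-1} w_{n-1})` of a solution at site `n`. -/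
def state (J : JacobiMatrix) (w : ℤ → ℂ) (n : ℤ) : Fin 2 → ℂ := ![w n, J.a (n - 1) * w (n - 1)]

theorem step_mulVec (J : JacobiMatrix) (n : ℕ) (E : ℂ) (w₀ w₁ : ℂ) :
    J.step n E *ᵥ ![w₀, w₁] = ![((E - J.b n) * w₀ - w₁) / J.a n, J.a n * w₀] := by
  rw [step_eq]
  ext i
  fin_cases i
  · simp [Matrix.mulVec, dotProduct, Fin.sum_univ_two]
    ring
  · simp [Matrix.mulVec, dotProduct, Fin.sum_univ_two]

theorem transfer_mulVec_state (J : JacobiMatrix) (E : ℂ) (w : ℤ → ℂ)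
    (hw : ∀ n, J.seqOp w n = E * w n) (n : ℕ) :
    J.transfer n E *ᵥ J.state w 0 = J.state w n := by
  induction n with
  | zero => simp [transfer_zero]
  | succ n ih =>
    rw [transfer_succ, ← Matrix.mulVec_mulVec, ih, state, step_mulVec, state]
    have h := hw n
    have ha : (J.a n : ℂ) ≠ 0 := by exact_mod_cast (J.a_pos n).ne'
    rw [seqOp] at h
    push_cast
    rw [add_sub_cancel_right]
    congr 1
    rw [div_eq_iff ha]
    linear_combination -h

theorem state_quasi {J : JacobiMatrix} {q : ℕ} (hJ : J.IsPeriodic q) {z : ℂ} {w : ℤ → ℂ}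
    (hw : ∀ n, w (n + q) = z * w n) (n : ℤ) : J.state w (n + q) = z • J.state w n := by
  have h2 := hw (n - 1)
  have h3 := (hJ (n - 1)).1
  rw [show n - 1 + (q : ℤ) = n + q - 1 by ring] at h2 h3
  rw [state, state, hw, h2, h3]
  ext i
  fin_cases i
  · simp
  · simp
    ring

theorem eq_zero_of_state_eq_zero (J : JacobiMatrix) (E : ℂ) (w : ℤ → ℂ)
    (hw : ∀ n, J.seqOp w n = E * w n) (h0 : J.state w 0 = 0) (n : ℕ) : w n = 0 := by
  have := transfer_mulVec_state J E w hw n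
  rw [h0, Matrix.mulVec_zero] at this
  have h := congrFun this 0
  simpa [state] using h.symm

theorem seqOp_of_mulVec_eq {J : JacobiMatrix} {q : ℕ} [NeZero q] (hJ : J.IsPeriodic q) {θ : ℝ}
    {u : Fin q → ℂ} {E : ℂ} (h : J.floquet q θ *ᵥ u = E • u) (n : ℤ) :
    J.seqOp (quasiExt q (multiplier θ) u) n = E * quasiExt q (multiplier θ) u n := by
  rw [← quasiExt_floquet_mulVec J hJ, h, quasiExt, quasiExt, Pi.smul_apply, smul_eq_mul]
  ring

/-- The Floquet initial data of an eigenvector. -/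
def initialState (J : JacobiMatrix) (q : ℕ) [NeZero q] (θ : ℝ) (u : Fin q → ℂ) : Fin 2 → ℂ :=
  J.state (quasiExt q (multiplier θ) u) 0

theorem transfer_mulVec_initialState {J : JacobiMatrix} {q : ℕ} [NeZero q] (hJ : J.IsPeriodic q)
    {θ : ℝ} {u : Fin q → ℂ} {E : ℂ} (h : J.floquet q θ *ᵥ u = E • u) :
    J.transfer q E *ᵥ J.initialState q θ u = multiplier θ • J.initialState q θ u := by
  rw [initialState, transfer_mulVec_state J E _ (seqOp_of_mulVec_eq hJ h)]
  have := state_quasi hJ (quasiExt_add_period q (multiplier_ne_zero θ) u) 0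
  rwa [zero_add] at this

theorem eq_zero_of_initialState_eq_zero {J : JacobiMatrix} {q : ℕ} [NeZero q]
    (hJ : J.IsPeriodic q) {θ : ℝ} {u : Fin q → ℂ} {E : ℂ} (h : J.floquet q θ *ᵥ u = E • u)
    (h0 : J.initialState q θ u = 0) : u = 0 := by
  ext j
  have := eq_zero_of_state_eq_zero J E _ (seqOp_of_mulVec_eq hJ h) h0 j
  rwa [quasiExt_coe] at this

/-- Run the recursion from `x` over one period and extend quasi-periodically. Since `x` is an
eigenvector of the transfer matrix for the multiplier, both components of the state match at the
seam, which is the eigenvalue equation in the boundary rows. -/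
theorem exists_eigenvector_of_transfer {J : JacobiMatrix} {q : ℕ} [NeZero q]
    (hJ : J.IsPeriodic q) {θ : ℝ} {E : ℂ} {x : Fin 2 → ℂ} (hx : x ≠ 0)
    (h : J.transfer q E *ᵥ x = multiplier θ • x) :
    ∃ u : Fin q → ℂ, u ≠ 0 ∧ J.floquet q θ *ᵥ u = E • u := by
  have hq : 0 < q := NeZero.pos q
  have hz := multiplier_ne_zero θ
  set y : ℕ → Fin 2 → ℂ := fun n => J.transfer n E *ᵥ x with hy
  have hy0 : y 0 = x := by simp only [hy, transfer_zero, Matrix.one_mulVec]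
  have hys : ∀ n, y (n + 1) = ![((E - J.b n) * y n 0 - y n 1) / J.a n, J.a n * y n 0] := by
    intro n
    have : y n = ![y n 0, y n 1] := by
      ext i
      fin_cases i <;> rfl
    rw [← step_mulVec, ← this]
    simp only [hy]
    rw [transfer_succ, Matrix.mulVec_mulVec]
  set u : Fin q → ℂ := fun j => y j 0 with hu
  set w := quasiExt q (multiplier θ) u with hw
  have hwq : ∀ n, w (n + q) = multiplier θ * w n := quasiExt_add_period q hz u
  have hwn : ∀ n : ℕ, n ≤ q → w n = y n 0 := by
    intro n hn
    rcases hn.lt_or_eq with h1 | h1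
    · exact quasiExt_coe q _ u ⟨n, h1⟩
    · have h2 := hwq 0
      have h3 : w 0 = y 0 0 := quasiExt_coe q _ u ⟨0, hq⟩
      rw [zero_add, h3, hy0] at h2
      rw [h1, h2]
      simp only [hy]
      rw [h]
      rfl
  have hw1 : ∀ n : ℕ, n ≤ q → J.a ((n : ℤ) - 1) * w ((n : ℤ) - 1) = y n 1 := by
    intro n hn
    rcases n with _ | n
    · have h2 := hwq (-1)
      have h3 := (hJ (-1)).1
      rw [show (-1 : ℤ) + q = ((q - 1 : ℕ) : ℤ) by omega] at h2 h3
      have h4 := hys (q - 1)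
      rw [Nat.sub_add_cancel hq] at h4
      have h5 : y q 1 = multiplier θ * x 1 := by
        simp only [hy]
        rw [h]
        rfl
      rw [h4, h3, ← hwn (q - 1) (by omega), h2] at h5
      simp only [Matrix.cons_val_one, Matrix.cons_val_fin_one] at h5
      have h6 : multiplier θ * (J.a (-1) * w (-1)) = multiplier θ * x 1 := by
        linear_combination h5
      rw [hy0]
      simpa using mul_left_cancel₀ hz h6
    · rw [hys, ← hwn n (by omega)]
      simp
  refine ⟨u, ?_, ?_⟩
  · intro hu0
    have h0 : w = 0 := by
      rw [hw, hu0]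
      funext n
      simp [quasiExt]
    refine hx ?_
    rw [← hy0]
    ext i
    fin_cases i
    · have := hwn 0 hq.le
      rw [h0] at this
      simpa using this.symm
    · have := hw1 0 hq.le
      rw [h0] at this
      simpa using this.symm
  · ext j
    have hj := j.2
    have ha : (J.a (j : ℕ) : ℂ) ≠ 0 := by exact_mod_cast (J.a_pos (j : ℕ)).ne'
    rw [floquet_mulVec J hJ, seqOp, hw1 j hj.le, ← hw]
    have h1 := hwn (j + 1) hj
    push_cast at h1
    rw [h1, hwn j hj.le, hys]
    simp only [Matrix.cons_val_zero, Pi.smul_apply, smul_eq_mul, hu]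
    field_simp
    ring

/-- With determinant one the characteristic equation is `z² - z tr T + 1 = 0`; divide it by `z`. -/
theorem exists_mulVec_eq_smul_iff {T : Matrix (Fin 2) (Fin 2) ℂ} (hT : T.det = 1) {z : ℂ}
    (hz : z ≠ 0) : (∃ x, x ≠ 0 ∧ T *ᵥ x = z • x) ↔ T.trace = z + z⁻¹ := by
  have h1 : (∃ x, x ≠ 0 ∧ T *ᵥ x = z • x) ↔ ∃ x, x ≠ 0 ∧ (T - z • (1 : Matrix _ _ ℂ)) *ᵥ x = 0 := by
    simp only [Matrix.sub_mulVec, Matrix.smul_mulVec, Matrix.one_mulVec, sub_eq_zero]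
  rw [h1, Matrix.exists_mulVec_eq_zero_iff]
  rw [Matrix.det_fin_two] at hT ⊢
  rw [Matrix.trace_fin_two]
  simp only [Matrix.sub_apply, Matrix.smul_apply, Matrix.one_apply_eq, smul_eq_mul, mul_one,
    Matrix.one_apply_ne (show (0 : Fin 2) ≠ 1 by decide),
    Matrix.one_apply_ne (show (1 : Fin 2) ≠ 0 by decide), mul_zero, sub_zero]
  constructor
  · intro h
    field_simp
    linear_combination hT - h
  · intro h
    field_simp at h
    linear_combination hT - h

/-- A real number is an eigenvalue of `J(θ)` if and only if the discriminant takes the value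
`2 cos 2πθ` there. -/
theorem exists_eigenvector_iff {J : JacobiMatrix} {q : ℕ} [NeZero q] (hJ : J.IsPeriodic q)
    (θ E : ℝ) : (∃ u : Fin q → ℂ, u ≠ 0 ∧ J.floquet q θ *ᵥ u = (E : ℂ) • u)
      ↔ (J.disc q).eval E = 2 * Real.cos (2 * Real.pi * θ) := by
  have h1 : (∃ u : Fin q → ℂ, u ≠ 0 ∧ J.floquet q θ *ᵥ u = (E : ℂ) • u)
      ↔ ∃ x, x ≠ 0 ∧ J.transfer q E *ᵥ x = multiplier θ • x := by
    constructor
    · rintro ⟨u, hu, h⟩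
      exact ⟨_, fun h0 => hu (eq_zero_of_initialState_eq_zero hJ h h0),
        transfer_mulVec_initialState hJ h⟩
    · rintro ⟨x, hx, h⟩
      exact exists_eigenvector_of_transfer hJ hx h
  rw [h1, exists_mulVec_eq_smul_iff (det_transfer J q E) (multiplier_ne_zero θ), trace_transfer,
    multiplier_add_inv]
  have h2 : aeval (E : ℂ) (J.disc q) = (((J.disc q).eval E : ℝ) : ℂ) := by
    have := aeval_algebraMap_apply ℂ E (J.disc q)
    simpa using this
  rw [h2]
  exact_mod_cast Iff.rfl

end JacobiMatrix
end

noncomputable section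

open Matrix Polynomial
open scoped InnerProductSpace

namespace JacobiMatrix

/-! ### Ordered eigenbases of the Floquet matrices -/

/-- The Floquet matrix as an operator. -/
def floquetCLM (J : JacobiMatrix) (q : ℕ) (θ : ℝ) :
    EuclideanSpace ℂ (Fin q) →L[ℂ] EuclideanSpace ℂ (Fin q) :=
  toEuclideanCLM (𝕜 := ℂ) (J.floquet q θ)

/-- The momentum fibre as an operator. -/
def momentumCLM (J : JacobiMatrix) (q : ℕ) (θ : ℝ) :
    EuclideanSpace ℂ (Fin q) →L[ℂ] EuclideanSpace ℂ (Fin q) :=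
  toEuclideanCLM (𝕜 := ℂ) (J.floquetMomentum q θ)

/-- An orthonormal basis of eigenvectors of `J(θ)`, ordered by the eigenvalues. -/
def eigenbasis (J : JacobiMatrix) (q : ℕ) (θ : ℝ) :
    OrthonormalBasis (Fin q) ℂ (EuclideanSpace ℂ (Fin q)) :=
  (J.floquet_isHermitian q θ).eigenvectorBasis.reindex
    -- `eigenvalues₀` is decreasing, so the index is reversed to obtain increasing order.
    ((Fin.revPerm.trans (finCongr (Fintype.card_fin q).symm)).trans
      (Fintype.equivOfCardEq (Fintype.card_fin _))).symm

theorem mulVec_eigenbasis (J : JacobiMatrix) (q : ℕ) (θ : ℝ) (k : Fin q) :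
    J.floquet q θ *ᵥ (J.eigenbasis q θ k).ofLp
      = (J.eigenvalue q k θ : ℂ) • (J.eigenbasis q θ k).ofLp := by
  have h := (J.floquet_isHermitian q θ).mulVec_eigenvectorBasis
    (Fintype.equivOfCardEq (Fintype.card_fin _) (Fin.cast (Fintype.card_fin q).symm k.rev))
  rw [Matrix.IsHermitian.eigenvalues, Equiv.symm_apply_apply] at h
  rw [eigenbasis, OrthonormalBasis.reindex_apply]
  exact h

theorem floquetCLM_eigenbasis (J : JacobiMatrix) (q : ℕ) (θ : ℝ) (k : Fin q) :
    J.floquetCLM q θ (J.eigenbasis q θ k)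
      = (J.eigenvalue q k θ : ℂ) • J.eigenbasis q θ k := by
  apply WithLp.ofLp_injective
  rw [floquetCLM, ofLp_toEuclideanCLM, mulVec_eigenbasis]
  rfl

theorem eigenvalue_mono (J : JacobiMatrix) (q : ℕ) (θ : ℝ) :
    Monotone fun k : Fin q => J.eigenvalue q k θ := by
  intro j k hjk
  refine (J.floquet_isHermitian q θ).eigenvalues₀_antitone ?_
  exact Fin.rev_le_rev.2 hjk

theorem exists_eigenvalue_eq (J : JacobiMatrix) (q : ℕ) (θ E : ℝ) {u : Fin q → ℂ} (hu : u ≠ 0)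
    (h : J.floquet q θ *ᵥ u = (E : ℂ) • u) : ∃ k, J.eigenvalue q k θ = E := by
  by_contra! hne
  refine hu ?_
  have h0 : (WithLp.toLp 2 u : EuclideanSpace ℂ (Fin q)) = 0 := by
    refine (J.eigenbasis q θ).toBasis.ext_elem fun k => ?_
    simp only [OrthonormalBasis.coe_toBasis_repr_apply, OrthonormalBasis.repr_apply_apply,
      inner_zero_right]
    have h1 := SpectralBasis.inner_apply (J.floquetCLM q θ) (J.eigenbasis q θ)
      (fun k => J.eigenvalue q k θ) (J.floquetCLM_eigenbasis q θ) k (WithLp.toLp 2 u)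
    rw [floquetCLM, toEuclideanCLM_toLp, h, WithLp.toLp_smul, inner_smul_right] at h1
    have h2 : ((J.eigenvalue q k θ - E : ℝ) : ℂ) ≠ 0 := by
      exact_mod_cast sub_ne_zero.2 (hne k)
    refine (mul_eq_zero.1 (?_ : ((J.eigenvalue q k θ - E : ℝ) : ℂ) * _ = 0)).resolve_left h2
    push_cast
    linear_combination -h1
  simpa using congrArg WithLp.ofLp h0

theorem eigenbasis_ofLp_ne_zero (J : JacobiMatrix) (q : ℕ) (θ : ℝ) (k : Fin q) :
    (J.eigenbasis q θ k).ofLp ≠ 0 := by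
  intro h
  have h1 := (J.eigenbasis q θ).orthonormal.ne_zero k
  exact h1 (WithLp.ofLp_injective 2 h)

theorem disc_eval_eigenvalue {J : JacobiMatrix} {q : ℕ} [NeZero q] (hJ : J.IsPeriodic q)
    (θ : ℝ) (k : Fin q) :
    (J.disc q).eval (J.eigenvalue q k θ) = 2 * Real.cos (2 * Real.pi * θ) :=
  (exists_eigenvector_iff hJ θ _).1
    ⟨_, J.eigenbasis_ofLp_ne_zero q θ k, J.mulVec_eigenbasis q θ k⟩

theorem exists_eigenvalue_of_disc_eval {J : JacobiMatrix} {q : ℕ} [NeZero q]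
    (hJ : J.IsPeriodic q) {θ E : ℝ} (h : (J.disc q).eval E = 2 * Real.cos (2 * Real.pi * θ)) :
    ∃ k, J.eigenvalue q k θ = E := by
  obtain ⟨u, hu, h⟩ := (exists_eigenvector_iff hJ θ E).2 h
  exact J.exists_eigenvalue_eq q θ E hu h

theorem initialState_combination (J : JacobiMatrix) (q : ℕ) [NeZero q] (θ : ℝ) (c d : ℂ)
    (u v : Fin q → ℂ) : J.initialState q θ (c • u + d • v)
      = c • J.initialState q θ u + d • J.initialState q θ v := by
  ext i
  fin_cases i
  · simp [initialState, state, quasiExt]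
  · simp [initialState, state, quasiExt]
    ring

/-- This is simplicity of the spectrum. Independent initial states would make the transfer matrix
equal to `z` times the identity; its determinant one then forces `z² = 1`, that is, a vanishing
sine. -/
theorem linearDependent_of_same_eigenvalue {J : JacobiMatrix} {q : ℕ} [NeZero q]
    (hJ : J.IsPeriodic q) {θ : ℝ} (hθ : Real.sin (2 * Real.pi * θ) ≠ 0) {E : ℂ}
    {u v : Fin q → ℂ} (hu : J.floquet q θ *ᵥ u = E • u) (hv : J.floquet q θ *ᵥ v = E • v) :
    ∃ c d : ℂ, (c ≠ 0 ∨ d ≠ 0) ∧ c • u + d • v = 0 := by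
  set z := multiplier θ with hz
  set x := J.initialState q θ u with hx
  set y := J.initialState q θ v with hy
  have hTx : J.transfer q E *ᵥ x = z • x := transfer_mulVec_initialState hJ hu
  have hTy : J.transfer q E *ᵥ y = z • y := transfer_mulVec_initialState hJ hv
  set X : Matrix (Fin 2) (Fin 2) ℂ := !![x 0, y 0; x 1, y 1] with hX
  have hTX : J.transfer q E * X = z • X := by
    ext i j
    fin_cases j
    · have := congrFun hTx i
      rw [Matrix.mul_apply, Fin.sum_univ_two]
      rw [Matrix.mulVec, dotProduct, Fin.sum_univ_two] at this
      fin_cases i <;> simpa [hX] using this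
    · have := congrFun hTy i
      rw [Matrix.mul_apply, Fin.sum_univ_two]
      rw [Matrix.mulVec, dotProduct, Fin.sum_univ_two] at this
      fin_cases i <;> simpa [hX] using this
  have hdet : X.det = 0 := by
    by_contra hne
    have h1 := congrArg Matrix.det hTX
    rw [Matrix.det_mul, det_transfer, Matrix.det_smul, Fintype.card_fin, one_mul] at h1
    have h2 : z ^ 2 = 1 := by
      have : (z ^ 2 - 1) * X.det = 0 := by linear_combination -h1
      exact sub_eq_zero.1 ((mul_eq_zero.1 this).resolve_right hne)
    exact hθ (sin_eq_zero_of_multiplier_sq h2)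
  obtain ⟨c, hc, hXc⟩ := Matrix.exists_mulVec_eq_zero_iff.2 hdet
  refine ⟨c 0, c 1, ?_, ?_⟩
  · by_contra! h
    exact hc (by ext i; fin_cases i; exacts [h.1, h.2])
  · refine eq_zero_of_initialState_eq_zero hJ (E := E) (θ := θ) ?_ ?_
    · rw [Matrix.mulVec_add, Matrix.mulVec_smul, Matrix.mulVec_smul, hu, hv, smul_add,
        smul_comm E, smul_comm E]
    · rw [initialState_combination, ← hx, ← hy]
      ext i
      have := congrFun hXc i
      rw [Matrix.mulVec, dotProduct, Fin.sum_univ_two] at this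
      fin_cases i <;>
      · simp [hX] at this
        simp
        linear_combination this

theorem eigenvalue_ne {J : JacobiMatrix} {q : ℕ} [NeZero q] (hJ : J.IsPeriodic q) {θ : ℝ}
    (hθ : Real.sin (2 * Real.pi * θ) ≠ 0) {j k : Fin q} (hjk : j ≠ k) :
    J.eigenvalue q j θ ≠ J.eigenvalue q k θ := by
  intro h
  have h1 := J.mulVec_eigenbasis q θ j
  rw [h] at h1
  obtain ⟨c, d, hcd, h0⟩ := linearDependent_of_same_eigenvalue hJ hθ h1 (J.mulVec_eigenbasis q θ k)
  have h0' : c • J.eigenbasis q θ j + d • J.eigenbasis q θ k = 0 := WithLp.ofLp_injective 2 h0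
  have e1 := congrArg (fun x => ⟪J.eigenbasis q θ j, x⟫_ℂ) h0'
  have e2 := congrArg (fun x => ⟪J.eigenbasis q θ k, x⟫_ℂ) h0'
  simp [hjk, hjk.symm] at e1 e2
  rcases hcd with h | h
  exacts [h e1, h e2]

/-! ### Bounds for the fibres -/

theorem norm_floquetCLM_le {J : JacobiMatrix} {q : ℕ} [NeZero q] (hJ : J.IsPeriodic q) {R : ℝ}
    (hR : 0 < R) (hb : J.IsRBounded R) (θ : ℝ) (x : EuclideanSpace ℂ (Fin q)) :
    ‖J.floquetCLM q θ x‖ ≤ 3 * R * ‖x‖ := by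
  rw [floquetCLM, floquet_eq_bandMatrix]
  refine (norm_bandMatrix_mulVec_le q (by simp) (by simp) J.a J.b (fun n => (hJ n).1)
    (norm_multiplier θ) (hb.abs_a_le hR) (fun n => (hb n).2.2) x).trans (le_of_eq ?_)
  ring

theorem norm_momentumCLM_le {J : JacobiMatrix} {q : ℕ} [NeZero q] (hJ : J.IsPeriodic q) {R : ℝ}
    (hR : 0 < R) (hb : J.IsRBounded R) (θ : ℝ) (x : EuclideanSpace ℂ (Fin q)) :
    ‖J.momentumCLM q θ x‖ ≤ 2 * R * ‖x‖ := by
  rw [momentumCLM, floquetMomentum_eq_bandMatrix]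
  refine (norm_bandMatrix_mulVec_le q (by simp) (by simp) J.a (fun _ => 0) (fun n => (hJ n).1)
    (norm_multiplier θ) (hb.abs_a_le hR) (C₂ := 0) (fun n => by simp) x).trans (le_of_eq ?_)
  ring

theorem bandMatrix_sub (q : ℕ) (α β : ℂ) (a b a' b' : ℤ → ℝ) (z : ℂ) :
    bandMatrix q α β a b z - bandMatrix q α β a' b' z
      = bandMatrix q α β (fun n => a n - a' n) (fun n => b n - b' n) z := by
  ext j k
  simp only [bandMatrix, Matrix.sub_apply, Matrix.of_apply]
  split_ifs <;> push_cast <;> ring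

theorem norm_floquetCLM_sub_le {J J' : JacobiMatrix} {q : ℕ} [NeZero q] (hJ : J.IsPeriodic q)
    (hJ' : J'.IsPeriodic q) {δ : ℝ} (ha : ∀ n, |J.a n - J'.a n| ≤ δ)
    (hb : ∀ n, |J.b n - J'.b n| ≤ δ) (θ : ℝ) (x : EuclideanSpace ℂ (Fin q)) :
    ‖J.floquetCLM q θ x - J'.floquetCLM q θ x‖ ≤ 3 * δ * ‖x‖ := by
  rw [floquetCLM, floquetCLM, ← _root_.sub_apply, ← map_sub, floquet_eq_bandMatrix,
    floquet_eq_bandMatrix, bandMatrix_sub]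
  refine (norm_bandMatrix_mulVec_le q (by simp) (by simp) _ _
    (fun n => by rw [(hJ n).1, (hJ' n).1]) (norm_multiplier θ) ha hb x).trans (le_of_eq ?_)
  ring

theorem norm_momentumCLM_sub_le {J J' : JacobiMatrix} {q : ℕ} [NeZero q] (hJ : J.IsPeriodic q)
    (hJ' : J'.IsPeriodic q) {δ : ℝ} (ha : ∀ n, |J.a n - J'.a n| ≤ δ) (θ : ℝ)
    (x : EuclideanSpace ℂ (Fin q)) :
    ‖J.momentumCLM q θ x - J'.momentumCLM q θ x‖ ≤ 2 * δ * ‖x‖ := by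
  rw [momentumCLM, momentumCLM, ← _root_.sub_apply, ← map_sub, floquetMomentum_eq_bandMatrix,
    floquetMomentum_eq_bandMatrix, bandMatrix_sub]
  refine (norm_bandMatrix_mulVec_le q (by simp) (by simp) _ _
    (fun n => by rw [(hJ n).1, (hJ' n).1]) (norm_multiplier θ) ha (C₂ := 0)
    (fun n => by simp) x).trans (le_of_eq ?_)
  ring

theorem abs_eigenvalue_le {J : JacobiMatrix} {q : ℕ} [NeZero q] (hJ : J.IsPeriodic q) {R : ℝ}
    (hR : 0 < R) (hb : J.IsRBounded R) (θ : ℝ) (k : Fin q) : |J.eigenvalue q k θ| ≤ 3 * R := by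
  have h := norm_floquetCLM_le hJ hR hb θ (J.eigenbasis q θ k)
  rw [floquetCLM_eigenbasis, norm_smul, (J.eigenbasis q θ).orthonormal.1 k, Complex.norm_real,
    mul_one, mul_one] at h
  exact h

/-! ### Differentiability of the eigenvalues and the velocity -/

/-- The lower left corner entry of the Floquet matrix, without its phase. -/
def corner (J : JacobiMatrix) (q : ℕ) : Matrix (Fin q) (Fin q) ℂ :=
  Matrix.of fun j k => if (k : ℕ) = 0 ∧ (j : ℕ) + 1 = q then (J.a j : ℂ) else 0

/-- The derivative of the Floquet matrix with respect to `θ`. -/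
def floquetDeriv (J : JacobiMatrix) (q : ℕ) (θ : ℝ) : Matrix (Fin q) (Fin q) ℂ :=
  (multiplier θ * (2 * Real.pi * Complex.I)) • J.corner q
    + (-((multiplier θ)⁻¹ * (2 * Real.pi * Complex.I))) • (J.corner q)ᵀ

theorem floquet_eq_add_corner (J : JacobiMatrix) (q : ℕ) (θ : ℝ) :
    J.floquet q θ = bandMatrix q 1 1 J.a J.b 0 + multiplier θ • J.corner q
      + (multiplier θ)⁻¹ • (J.corner q)ᵀ := by
  rw [floquet_eq_bandMatrix]
  ext j k
  simp only [bandMatrix, corner, Matrix.add_apply, Matrix.smul_apply, Matrix.of_apply,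
    Matrix.transpose_apply, smul_eq_mul]
  have i4 : ∀ c d : ℂ, (if (j : ℕ) = 0 ∧ (k : ℕ) + 1 = q then c * (J.a (k : ℕ) : ℂ) * d else 0)
      = c * d * (if (j : ℕ) = 0 ∧ (k : ℕ) + 1 = q then (J.a (k : ℕ) : ℂ) else 0) := by
    intro c d
    split_ifs <;> ring
  have i5 : ∀ c d : ℂ, (if (k : ℕ) = 0 ∧ (j : ℕ) + 1 = q then c * (J.a (j : ℕ) : ℂ) * d else 0)
      = c * d * (if (k : ℕ) = 0 ∧ (j : ℕ) + 1 = q then (J.a (j : ℕ) : ℂ) else 0) := by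
    intro c d
    split_ifs <;> ring
  rw [i4, i5, i4, i5]
  ring

theorem hasDerivAt_multiplier (θ : ℝ) :
    HasDerivAt multiplier (multiplier θ * (2 * Real.pi * Complex.I)) θ := by
  have h : HasDerivAt (fun t : ℝ => 2 * Real.pi * (t : ℂ) * Complex.I)
      (2 * Real.pi * Complex.I) θ := by
    have := ((Complex.ofRealCLM.hasDerivAt (x := θ)).const_mul (2 * Real.pi : ℂ)).mul_const
      Complex.I
    simpa using this
  exact h.cexp

theorem hasDerivAt_multiplier_inv (θ : ℝ) :
    HasDerivAt (fun t => (multiplier t)⁻¹)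
      (-((multiplier θ)⁻¹ * (2 * Real.pi * Complex.I))) θ := by
  have h := (hasDerivAt_multiplier θ).fun_inv (multiplier_ne_zero θ)
  refine h.congr_deriv ?_
  have := multiplier_ne_zero θ
  field_simp

theorem hasDerivAt_floquetCLM (J : JacobiMatrix) (q : ℕ) (θ : ℝ) :
    HasDerivAt (J.floquetCLM q) (toEuclideanCLM (𝕜 := ℂ) (J.floquetDeriv q θ)) θ := by
  have h : J.floquetCLM q = fun t => toEuclideanCLM (𝕜 := ℂ) (bandMatrix q 1 1 J.a J.b 0)
      + multiplier t • toEuclideanCLM (𝕜 := ℂ) (J.corner q)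
      + (multiplier t)⁻¹ • toEuclideanCLM (𝕜 := ℂ) (J.corner q)ᵀ := by
    funext t
    rw [floquetCLM, floquet_eq_add_corner, map_add, map_add, map_smul, map_smul]
  rw [h, floquetDeriv, map_add, map_smul, map_smul]
  have h1 := (hasDerivAt_multiplier θ).smul_const (toEuclideanCLM (𝕜 := ℂ) (J.corner q))
  have h2 := (hasDerivAt_multiplier_inv θ).smul_const (toEuclideanCLM (𝕜 := ℂ) (J.corner q)ᵀ)
  exact (h1.const_add _).add h2

/-- The position inside the block jumps by `q - 1` across a corner, while the true hop has length
one in the opposite direction. The discrepancy `q` is supplied by the `θ`-derivative, which sees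
only the corners. -/
theorem floquetMomentum_eq_commutator (J : JacobiMatrix) (q : ℕ) (θ : ℝ) :
    J.floquetMomentum q θ
      = Complex.I • (J.floquet q θ * Matrix.diagonal (fun j : Fin q => ((j : ℕ) : ℂ))
          - Matrix.diagonal (fun j : Fin q => ((j : ℕ) : ℂ)) * J.floquet q θ)
        + ((q : ℂ) / (2 * Real.pi)) • J.floquetDeriv q θ := by
  have hpi : (Real.pi : ℂ) ≠ 0 := by exact_mod_cast Real.pi_ne_zero
  ext j k
  rw [floquet_eq_bandMatrix, floquetMomentum_eq_bandMatrix]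
  simp only [bandMatrix, floquetDeriv, corner, Matrix.add_apply, Matrix.sub_apply,
    Matrix.smul_apply, Matrix.of_apply, Matrix.transpose_apply, Matrix.mul_diagonal,
    Matrix.diagonal_mul, smul_eq_mul]
  have e1 : (if j = k then (J.b (j : ℕ) : ℂ) else 0) * ((k : ℕ) : ℂ)
      = ((j : ℕ) : ℂ) * (if j = k then (J.b (j : ℕ) : ℂ) else 0) := by
    split_ifs with h
    · rw [h]; ring
    · simp
  have e2 : ∀ x : ℂ, (if (j : ℕ) + 1 = k then x else 0) * ((k : ℕ) : ℂ)
      = ((j : ℕ) : ℂ) * (if (j : ℕ) + 1 = k then x else 0) + (if (j : ℕ) + 1 = k then x else 0) := by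
    intro x
    split_ifs with h
    · rw [← h]; push_cast; ring
    · simp
  have e3 : ∀ x : ℂ, ((j : ℕ) : ℂ) * (if (k : ℕ) + 1 = j then x else 0)
      = (if (k : ℕ) + 1 = j then x else 0) * ((k : ℕ) : ℂ) + (if (k : ℕ) + 1 = j then x else 0) := by
    intro x
    split_ifs with h
    · rw [← h]; push_cast; ring
    · simp
  have e4 : ∀ x : ℂ, (if (j : ℕ) = 0 ∧ (k : ℕ) + 1 = q then x else 0) * ((k : ℕ) : ℂ)
      = ((j : ℕ) : ℂ) * (if (j : ℕ) = 0 ∧ (k : ℕ) + 1 = q then x else 0)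
        + ((q : ℂ) - 1) * (if (j : ℕ) = 0 ∧ (k : ℕ) + 1 = q then x else 0) := by
    intro x
    split_ifs with h
    · have hq : ((k : ℕ) : ℂ) + 1 = q := by exact_mod_cast h.2
      rw [h.1, ← hq]; push_cast; ring
    · simp
  have e5 : ∀ x : ℂ, ((j : ℕ) : ℂ) * (if (k : ℕ) = 0 ∧ (j : ℕ) + 1 = q then x else 0)
      = (if (k : ℕ) = 0 ∧ (j : ℕ) + 1 = q then x else 0) * ((k : ℕ) : ℂ)
        + ((q : ℂ) - 1) * (if (k : ℕ) = 0 ∧ (j : ℕ) + 1 = q then x else 0) := by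
    intro x
    split_ifs with h
    · have hq : ((j : ℕ) : ℂ) + 1 = q := by exact_mod_cast h.2
      rw [h.1, ← hq]; push_cast; ring
    · simp
  have i2 : (if (j : ℕ) + 1 = k then Complex.I * (J.a (j : ℕ) : ℂ) else 0)
      = Complex.I * (if (j : ℕ) + 1 = k then 1 * (J.a (j : ℕ) : ℂ) else 0) := by
    split_ifs <;> simp
  have i3 : (if (k : ℕ) + 1 = j then -Complex.I * (J.a (k : ℕ) : ℂ) else 0)
      = -Complex.I * (if (k : ℕ) + 1 = j then 1 * (J.a (k : ℕ) : ℂ) else 0) := by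
    split_ifs <;> simp
  have i4 : ∀ c d : ℂ, (if (j : ℕ) = 0 ∧ (k : ℕ) + 1 = q then c * (J.a (k : ℕ) : ℂ) * d else 0)
      = c * d * (if (j : ℕ) = 0 ∧ (k : ℕ) + 1 = q then (J.a (k : ℕ) : ℂ) else 0) := by
    intro c d
    split_ifs <;> ring
  have i5 : ∀ c d : ℂ, (if (k : ℕ) = 0 ∧ (j : ℕ) + 1 = q then c * (J.a (j : ℕ) : ℂ) * d else 0)
      = c * d * (if (k : ℕ) = 0 ∧ (j : ℕ) + 1 = q then (J.a (j : ℕ) : ℂ) else 0) := by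
    intro c d
    split_ifs <;> ring
  simp only [add_mul, mul_add]
  have hz := multiplier_ne_zero θ
  rw [e1, e2, e3, e4, e5, i2, i3]
  simp only [i4, i5, Complex.ofReal_zero, ite_self]
  field_simp
  ring

theorem floquetMomentum_isHermitian (J : JacobiMatrix) (q : ℕ) (θ : ℝ) :
    (J.floquetMomentum q θ).IsHermitian := by
  have hz : (starRingEnd ℂ) (multiplier θ) = (multiplier θ)⁻¹ := by
    rw [Complex.inv_def, Complex.normSq_eq_norm_sq, norm_multiplier]
    simp
  rw [floquetMomentum_eq_bandMatrix]
  ext j k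
  simp only [bandMatrix, Matrix.conjTranspose_apply, Matrix.of_apply, star_add, RCLike.star_def,
    apply_ite (starRingEnd ℂ), map_mul, map_neg, map_inv₀, Complex.conj_ofReal, map_zero, hz,
    Complex.conj_I, Complex.ofReal_zero, ite_self, inv_inv, neg_neg]
  ring

theorem hasDerivAt_eigenvalue {J : JacobiMatrix} {q : ℕ} [NeZero q] (hJ : J.IsPeriodic q) {θ : ℝ}
    (hθ : Real.sin (2 * Real.pi * θ) ≠ 0) (k : Fin q) :
    HasDerivAt (J.eigenvalue q k) (⟪J.eigenbasis q θ k,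
      toEuclideanCLM (𝕜 := ℂ) (J.floquetDeriv q θ) (J.eigenbasis q θ k)⟫_ℂ).re θ :=
  SpectralBasis.hasDerivAt_eigenvalue (J.floquetCLM q) _ (J.eigenbasis q)
    (fun θ k => J.eigenvalue q k θ) (J.floquetCLM_eigenbasis q) (J.eigenvalue_mono q) θ
    (J.hasDerivAt_floquetCLM q θ) k (fun _ hi => eigenvalue_ne hJ hθ hi)

/-- The diagonal matrix elements of the momentum are the group velocities. -/
theorem inner_momentumCLM_eigenbasis {J : JacobiMatrix} {q : ℕ} [NeZero q] (hJ : J.IsPeriodic q)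
    {θ : ℝ} (hθ : Real.sin (2 * Real.pi * θ) ≠ 0) (k : Fin q) :
    ⟪J.eigenbasis q θ k, J.momentumCLM q θ (J.eigenbasis q θ k)⟫_ℂ
      = (q : ℂ) * ((deriv (J.eigenvalue q k) θ / (2 * Real.pi) : ℝ) : ℂ) := by
  set v := J.eigenbasis q θ k with hv
  set d := ⟪v, toEuclideanCLM (𝕜 := ℂ) (J.floquetDeriv q θ) v⟫_ℂ with hd
  have hreal : (⟪v, J.momentumCLM q θ v⟫_ℂ).im = 0 := by
    have h := (Matrix.isSymmetric_toEuclideanLin_iff.2 (J.floquetMomentum_isHermitian q θ)) v v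
    have h2 : (starRingEnd ℂ) ⟪v, J.momentumCLM q θ v⟫_ℂ = ⟪v, J.momentumCLM q θ v⟫_ℂ := by
      rw [inner_conj_symm]
      exact h
    exact Complex.conj_eq_iff_im.1 h2
  have hform : ⟪v, J.momentumCLM q θ v⟫_ℂ = ((q : ℂ) / (2 * Real.pi)) * d := by
    have h1 : ∀ x, ⟪v, J.floquetCLM q θ x⟫_ℂ = (J.eigenvalue q k θ : ℂ) * ⟪v, x⟫_ℂ :=
      SpectralBasis.inner_apply (J.floquetCLM q θ) (J.eigenbasis q θ)
        (fun k => J.eigenvalue q k θ) (J.floquetCLM_eigenbasis q θ) k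
    -- A commutator with `J(θ)` has zero expectation in an eigenvector, so only the derivative term
    -- remains.
    set X := toEuclideanCLM (𝕜 := ℂ) (Matrix.diagonal (fun j : Fin q => ((j : ℕ) : ℂ))) with hX
    have h2 : J.momentumCLM q θ v = Complex.I • (J.floquetCLM q θ (X v) - X (J.floquetCLM q θ v))
        + ((q : ℂ) / (2 * Real.pi)) • toEuclideanCLM (𝕜 := ℂ) (J.floquetDeriv q θ) v := by
      rw [momentumCLM, floquetMomentum_eq_commutator, map_add, map_smul, map_smul, map_sub, map_mul,
        map_mul]
      rfl
    rw [h2, hv, floquetCLM_eigenbasis, ← hv, map_smul, inner_add_right, inner_smul_right,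
      inner_smul_right, inner_sub_right, h1, inner_smul_right, sub_self, mul_zero, zero_add]
  have hq : (q : ℝ) / (2 * Real.pi) ≠ 0 := by
    have := Real.pi_ne_zero
    have h3 : (q : ℝ) ≠ 0 := by exact_mod_cast NeZero.ne q
    positivity
  have hder := (hasDerivAt_eigenvalue hJ hθ k).deriv
  rw [← hv, ← hd] at hder
  have hc : ((q : ℂ) / (2 * Real.pi)) = (((q : ℝ) / (2 * Real.pi) : ℝ) : ℂ) := by push_cast; rfl
  rw [hform, hc, Complex.im_ofReal_mul] at hreal
  have hdim : d.im = 0 := (mul_eq_zero.1 hreal).resolve_left hq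
  have hdre : d = ((d.re : ℝ) : ℂ) := Complex.ext rfl (by simp [hdim])
  rw [hform, hder, hdre, Complex.ofReal_re]
  push_cast
  ring

end JacobiMatrix
end

/-! ### Bounds on the discriminant, and the resulting slopes and gaps. -/

noncomputable section

open Matrix Polynomial
open scoped InnerProductSpace

/-- Cauchy's estimate on unit circles. Each derivative costs one unit of radius, so bounding two
derivatives on `[-3R, 3R]` needs the discriminant on the disc of radius `3R + 2`. -/
theorem norm_aeval_derivative_le (p : ℝ[X]) {r B : ℝ}
    (h : ∀ z : ℂ, ‖z‖ ≤ r + 1 → ‖aeval z p‖ ≤ B) (z : ℂ) (hz : ‖z‖ ≤ r) :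
    ‖aeval z (derivative p)‖ ≤ B := by
  have h1 := Complex.norm_deriv_le_of_forall_mem_sphere_norm_le (f := fun w : ℂ => aeval w p)
    (c := z) (R := 1) (C := B) one_pos
    (p.differentiable_aeval.diffContOnCl) (fun w hw => h w (by
      have h2 : ‖w - z‖ = 1 := by simpa using hw
      have h3 := norm_add_le (w - z) z
      rw [sub_add_cancel] at h3
      linarith))
  rwa [p.deriv_aeval, div_one] at h1

namespace JacobiMatrix

/-- A bound for the discriminant of period `q` and its first two derivatives. -/
def discBound (R : ℝ) (q : ℕ) : ℝ := (14 * R ^ 2) ^ q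

theorem one_le_discBound {R : ℝ} (hR : 1 ≤ R) (q : ℕ) : 1 ≤ discBound R q :=
  one_le_pow₀ (by nlinarith)

/-- The absolute row sums of one step are at most `(4R + 2)R + R ≤ 7R²`. -/
theorem norm_transfer_apply_le {J : JacobiMatrix} {R : ℝ} (hR : 1 ≤ R) (hb : J.IsRBounded R)
    {E : ℂ} (hE : ‖E‖ ≤ 3 * R + 2) (n : ℕ) (i j : Fin 2) :
    ‖J.transfer n E i j‖ ≤ (7 * R ^ 2) ^ n := by
  have hR0 : 0 < R := by linarith
  induction n generalizing i with
  | zero =>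
    rw [transfer_zero, pow_zero, Matrix.one_apply]
    split_ifs <;> simp
  | succ n ih =>
    have h0 := ih 0
    have h1 := ih 1
    have ha := hb.a_pos hR0 n
    have hinv : (J.a n)⁻¹ ≤ R := by
      have := (hb n).1
      rw [one_div] at this
      exact inv_le_of_inv_le₀ hR0 this
    have hK : 0 ≤ (7 * R ^ 2) ^ n := by positivity
    have hinv0 : 0 ≤ (J.a n)⁻¹ := by positivity
    have key : ∀ x y : ℂ, ‖x‖ + ‖y‖ ≤ 7 * R ^ 2 →
        ‖x * J.transfer n E 0 j + y * J.transfer n E 1 j‖ ≤ (7 * R ^ 2) ^ (n + 1) := by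
      intro x y hxy
      calc ‖x * J.transfer n E 0 j + y * J.transfer n E 1 j‖
          ≤ ‖x‖ * ‖J.transfer n E 0 j‖ + ‖y‖ * ‖J.transfer n E 1 j‖ := by
            rw [← norm_mul, ← norm_mul]; exact norm_add_le _ _
        _ ≤ ‖x‖ * (7 * R ^ 2) ^ n + ‖y‖ * (7 * R ^ 2) ^ n := by gcongr
        _ = (‖x‖ + ‖y‖) * (7 * R ^ 2) ^ n := by ring
        _ ≤ 7 * R ^ 2 * (7 * R ^ 2) ^ n := by gcongr
        _ = _ := by ring
    rw [transfer_succ, step_eq, Matrix.mul_apply, Fin.sum_univ_two]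
    fin_cases i
    · refine key _ _ ?_
      simp only [Fin.zero_eta, Matrix.of_apply, Matrix.cons_val', Matrix.cons_val_zero,
        Matrix.cons_val_one, Matrix.cons_val_fin_one, norm_div, norm_neg, norm_one,
        Complex.norm_real, Real.norm_eq_abs, abs_of_pos ha]
      have h2 : ‖E - J.b n‖ ≤ 4 * R + 2 := by
        have := norm_sub_le E (J.b n)
        rw [Complex.norm_real, Real.norm_eq_abs] at this
        have := (hb n).2.2
        linarith
      rw [div_eq_mul_inv, div_eq_mul_inv, one_mul]
      have h3 : ‖E - J.b n‖ * (J.a n)⁻¹ ≤ (4 * R + 2) * R := by gcongr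
      nlinarith
    · refine key _ _ ?_
      simp only [Fin.mk_one, Matrix.of_apply, Matrix.cons_val', Matrix.cons_val_zero,
        Matrix.cons_val_one, Matrix.cons_val_fin_one, norm_zero,
        Complex.norm_real, Real.norm_eq_abs, abs_of_pos ha]
      have := (hb n).2.1
      nlinarith

/-- The trace has two entries; the factor 2 is absorbed by passing from `7` to `14`, which needs `q
≥ 1`. -/
theorem norm_aeval_disc_le {J : JacobiMatrix} {R : ℝ} (hR : 1 ≤ R) (hb : J.IsRBounded R)
    {q : ℕ} (hq : q ≠ 0) {E : ℂ} (hE : ‖E‖ ≤ 3 * R + 2) :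
    ‖aeval E (J.disc q)‖ ≤ discBound R q := by
  rw [← trace_transfer, Matrix.trace_fin_two, discBound]
  have h0 := norm_transfer_apply_le hR hb hE q 0 0
  have h1 := norm_transfer_apply_le hR hb hE q 1 1
  have h2 : (2 : ℝ) ≤ 2 ^ q := by
    calc (2 : ℝ) = 2 ^ 1 := by norm_num
      _ ≤ 2 ^ q := pow_le_pow_right₀ (by norm_num) (Nat.one_le_iff_ne_zero.2 hq)
  calc ‖J.transfer q E 0 0 + J.transfer q E 1 1‖ ≤ (7 * R ^ 2) ^ q + (7 * R ^ 2) ^ q :=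
        (norm_add_le _ _).trans (add_le_add h0 h1)
    _ = 2 * (7 * R ^ 2) ^ q := by ring
    _ ≤ 2 ^ q * (7 * R ^ 2) ^ q := by gcongr
    _ = (14 * R ^ 2) ^ q := by rw [← mul_pow]; ring

theorem abs_eval_le_of_norm_aeval_le {p : ℝ[X]} {x B : ℝ} (h : ‖aeval (x : ℂ) p‖ ≤ B) :
    |p.eval x| ≤ B := by
  have h2 : aeval (x : ℂ) p = ((p.eval x : ℝ) : ℂ) := by
    have := aeval_algebraMap_apply ℂ x p
    simpa using this
  rwa [h2, Complex.norm_real, Real.norm_eq_abs] at h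

theorem abs_eval_derivative_disc_le {J : JacobiMatrix} {R : ℝ} (hR : 1 ≤ R) (hb : J.IsRBounded R)
    {q : ℕ} (hq : q ≠ 0) {x : ℝ} (hx : |x| ≤ 3 * R) :
    |(derivative (J.disc q)).eval x| ≤ discBound R q := by
  refine abs_eval_le_of_norm_aeval_le (norm_aeval_derivative_le _ (r := 3 * R + 1)
    (fun z hz => norm_aeval_disc_le hR hb hq (by linarith)) _ ?_)
  rw [Complex.norm_real, Real.norm_eq_abs]
  linarith

theorem abs_eval_derivative_derivative_disc_le {J : JacobiMatrix} {R : ℝ} (hR : 1 ≤ R)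
    (hb : J.IsRBounded R) {q : ℕ} (hq : q ≠ 0) {x : ℝ} (hx : |x| ≤ 3 * R) :
    |(derivative (derivative (J.disc q))).eval x| ≤ discBound R q := by
  refine abs_eval_le_of_norm_aeval_le (norm_aeval_derivative_le _ (r := 3 * R)
    (fun z hz => norm_aeval_derivative_le _ (r := 3 * R + 1)
      (fun z hz => norm_aeval_disc_le hR hb hq (by linarith)) _ hz) _ ?_)
  rwa [Complex.norm_real, Real.norm_eq_abs]

/-- Chain rule applied to `D(λ_k(θ)) = 2 cos 2πθ`. -/
theorem derivative_disc_mul_deriv_eigenvalue {J : JacobiMatrix} {q : ℕ} [NeZero q]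
    (hJ : J.IsPeriodic q) {θ : ℝ} (hθ : Real.sin (2 * Real.pi * θ) ≠ 0) (k : Fin q) :
    (derivative (J.disc q)).eval (J.eigenvalue q k θ) * deriv (J.eigenvalue q k) θ
      = -(4 * Real.pi * Real.sin (2 * Real.pi * θ)) := by
  have h1 : HasDerivAt (fun t => (J.disc q).eval (J.eigenvalue q k t))
      ((derivative (J.disc q)).eval (J.eigenvalue q k θ) * deriv (J.eigenvalue q k) θ) θ :=
    ((J.disc q).hasDerivAt (J.eigenvalue q k θ)).comp θ
      (hasDerivAt_eigenvalue hJ hθ k).differentiableAt.hasDerivAt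
  have h2 : HasDerivAt (fun t => 2 * Real.cos (2 * Real.pi * t))
      (-(4 * Real.pi * Real.sin (2 * Real.pi * θ))) θ := by
    have := (((hasDerivAt_id θ).const_mul (2 * Real.pi)).cos).const_mul 2
    refine this.congr_deriv ?_
    simp
    ring
  have h3 : (fun t => (J.disc q).eval (J.eigenvalue q k t))
      = fun t => 2 * Real.cos (2 * Real.pi * t) := by
    funext t
    exact disc_eval_eigenvalue hJ t k
  rw [h3] at h1
  exact h1.unique h2

theorem sin_le_discBound_mul_deriv {J : JacobiMatrix} {q : ℕ} [NeZero q] (hJ : J.IsPeriodic q)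
    {R : ℝ} (hR : 1 ≤ R) (hb : J.IsRBounded R) (k : Fin q) (θ : ℝ) :
    |Real.sin (2 * Real.pi * θ)| ≤ discBound R q * |deriv (J.eigenvalue q k) θ| := by
  have hB := one_le_discBound hR q
  by_cases hθ : Real.sin (2 * Real.pi * θ) = 0
  · rw [hθ, abs_zero]
    positivity
  have h1 := congrArg abs (derivative_disc_mul_deriv_eigenvalue hJ hθ k)
  rw [abs_mul, abs_neg, abs_mul, abs_of_pos (by positivity : 0 < 4 * Real.pi)] at h1
  have h2 := abs_eval_derivative_disc_le hR hb (NeZero.ne q)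
    (abs_eigenvalue_le hJ (by linarith) hb θ k)
  have h3 : |(derivative (J.disc q)).eval (J.eigenvalue q k θ)| * |deriv (J.eigenvalue q k) θ|
      ≤ discBound R q * |deriv (J.eigenvalue q k) θ| := by gcongr
  have h4 := abs_nonneg (Real.sin (2 * Real.pi * θ))
  have h5 : 1 ≤ 4 * Real.pi := by linarith [Real.two_le_pi]
  nlinarith

/-- At a critical point, the discriminant is outside `(-2, 2)`. -/
theorem two_le_abs_disc_of_derivative_eq_zero {J : JacobiMatrix} {q : ℕ} [NeZero q]
    (hJ : J.IsPeriodic q) {c : ℝ} (hc : (derivative (J.disc q)).eval c = 0) :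
    2 ≤ |(J.disc q).eval c| := by
  by_contra! h
  rw [abs_lt] at h
  set x := (J.disc q).eval c / 2 with hx
  set θ := Real.arccos x / (2 * Real.pi) with hθ
  have hpi := Real.pi_pos
  have h1 : 2 * Real.pi * θ = Real.arccos x := by
    rw [hθ]; field_simp
  have hcos : Real.cos (2 * Real.pi * θ) = x := by
    rw [h1, Real.cos_arccos] <;> linarith
  have hsin : Real.sin (2 * Real.pi * θ) ≠ 0 := by
    rw [h1, Real.sin_arccos]
    have : 0 < 1 - x ^ 2 := by nlinarith
    positivity
  -- With a value in `(-2, 2)` the point `c` would be an eigenvalue at a `θ` with nonzero sine,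
  -- where the chain rule forbids `D'(c) = 0`.
  obtain ⟨k, hk⟩ := exists_eigenvalue_of_disc_eval hJ (θ := θ) (E := c) (by rw [hcos]; linarith)
  have h2 := derivative_disc_mul_deriv_eigenvalue hJ hsin k
  rw [hk, hc, zero_mul] at h2
  have : 4 * Real.pi * Real.sin (2 * Real.pi * θ) ≠ 0 := by positivity
  exact this (by linarith)

/-- Rolle gives a critical point `c` between the energies, and there `|D(c)| ≥ 2`. Hence `|D(c) -
D(E₁)| ≥ 2 - 2|cos| ≥ sin²`. As `D'(c) = 0`, the second derivative bounds the same difference by `B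
(c - E₁)²`, and taking roots gives a bound linear in the gap. -/
theorem sin_le_of_disc_eq_of_lt {J : JacobiMatrix} {q : ℕ} [NeZero q] (hJ : J.IsPeriodic q)
    {R : ℝ} (hR : 1 ≤ R) (hb : J.IsRBounded R) {E₁ E₂ θ : ℝ} (h₁ : |E₁| ≤ 3 * R)
    (h₂ : |E₂| ≤ 3 * R) (hlt : E₁ < E₂)
    (he₁ : (J.disc q).eval E₁ = 2 * Real.cos (2 * Real.pi * θ))
    (he₂ : (J.disc q).eval E₂ = 2 * Real.cos (2 * Real.pi * θ)) :
    |Real.sin (2 * Real.pi * θ)| ≤ discBound R q * (E₂ - E₁) := by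
  have hB := one_le_discBound hR q
  obtain ⟨c, hc, hc0⟩ := exists_deriv_eq_zero (f := fun x => (J.disc q).eval x) hlt
    (J.disc q).continuous.continuousOn (by rw [he₁, he₂])
  rw [Polynomial.deriv] at hc0
  have h2 := two_le_abs_disc_of_derivative_eq_zero hJ hc0
  rw [abs_le] at h₁ h₂
  have hconv : ∀ x ∈ Set.Icc E₁ c, |x| ≤ 3 * R := fun x hx => by
    rw [abs_le]
    constructor <;> linarith [hx.1, hx.2, hc.1, hc.2]
  have hE1 : E₁ ∈ Set.Icc E₁ c := ⟨le_rfl, hc.1.le⟩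
  have hcm : c ∈ Set.Icc E₁ c := ⟨hc.1.le, le_rfl⟩
  have hd : ∀ x ∈ Set.Icc E₁ c, ‖(derivative (J.disc q)).eval x‖ ≤ discBound R q * (c - E₁) := by
    intro x hx
    have := (convex_Icc E₁ c).norm_image_sub_le_of_norm_deriv_le
      (f := fun x => (derivative (J.disc q)).eval x) (C := discBound R q)
      (fun x _ => (derivative (J.disc q)).differentiableAt)
      (fun x hx => by
        rw [Polynomial.deriv]
        exact abs_eval_derivative_derivative_disc_le hR hb (NeZero.ne q) (hconv x hx)) hcm hx
    rw [hc0, sub_zero, Real.norm_eq_abs (x - c), abs_sub_comm, abs_of_nonneg (by linarith [hx.2])]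
      at this
    refine this.trans ?_
    gcongr
    exact hx.1
  have hf := (convex_Icc E₁ c).norm_image_sub_le_of_norm_deriv_le
    (f := fun x => (J.disc q).eval x) (C := discBound R q * (c - E₁))
    (fun x _ => (J.disc q).differentiableAt)
    (fun x hx => by rw [Polynomial.deriv]; exact hd x hx) hE1 hcm
  rw [he₁, Real.norm_eq_abs, Real.norm_eq_abs, abs_of_pos (by linarith [hc.1] : 0 < c - E₁)] at hf
  set s := Real.sin (2 * Real.pi * θ)
  set t := Real.cos (2 * Real.pi * θ)
  have hst : s ^ 2 + t ^ 2 = 1 := Real.sin_sq_add_cos_sq _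
  have ht1 : |t| ≤ 1 := Real.abs_cos_le_one _
  have h3 : 2 - 2 * |t| ≤ |(J.disc q).eval c - 2 * t| := by
    have := abs_sub_abs_le_abs_sub ((J.disc q).eval c) (2 * t)
    rw [abs_mul, abs_two] at this
    linarith
  have h4 : s ^ 2 ≤ 2 - 2 * |t| := by
    rw [← sq_abs t] at hst
    nlinarith [abs_nonneg t]
  have h5 : |s| ^ 2 ≤ (discBound R q * (c - E₁)) ^ 2 := by
    rw [sq_abs]
    have : 0 < c - E₁ := by linarith [hc.1]
    nlinarith [mul_pos this this]
  have h6 : |s| ≤ discBound R q * (c - E₁) :=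
    le_of_sq_le_sq h5 (mul_nonneg (by linarith) (by linarith [hc.1]))
  refine h6.trans ?_
  gcongr
  exact hc.2.le

theorem sin_le_of_disc_eq {J : JacobiMatrix} {q : ℕ} [NeZero q] (hJ : J.IsPeriodic q)
    {R : ℝ} (hR : 1 ≤ R) (hb : J.IsRBounded R) {E₁ E₂ θ : ℝ} (h₁ : |E₁| ≤ 3 * R)
    (h₂ : |E₂| ≤ 3 * R) (hne : E₁ ≠ E₂)
    (he₁ : (J.disc q).eval E₁ = 2 * Real.cos (2 * Real.pi * θ))
    (he₂ : (J.disc q).eval E₂ = 2 * Real.cos (2 * Real.pi * θ)) :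
    |Real.sin (2 * Real.pi * θ)| ≤ discBound R q * |E₁ - E₂| := by
  rcases hne.lt_or_gt with h | h
  · rw [abs_sub_comm, abs_of_pos (sub_pos.2 h)]
    exact sin_le_of_disc_eq_of_lt hJ hR hb h₁ h₂ h he₁ he₂
  · rw [abs_of_pos (sub_pos.2 h)]
    exact sin_le_of_disc_eq_of_lt hJ hR hb h₂ h₁ h he₂ he₁

theorem abs_disc_sub_le {J : JacobiMatrix} {q : ℕ} [NeZero q] {R : ℝ} (hR : 1 ≤ R)
    (hb : J.IsRBounded R) {E₁ E₂ : ℝ} (h₁ : |E₁| ≤ 3 * R) (h₂ : |E₂| ≤ 3 * R) :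
    |(J.disc q).eval E₁ - (J.disc q).eval E₂| ≤ discBound R q * |E₁ - E₂| := by
  have := (convex_Icc (-(3 * R)) (3 * R)).norm_image_sub_le_of_norm_deriv_le
    (f := fun x => (J.disc q).eval x) (C := discBound R q)
    (fun x _ => (J.disc q).differentiableAt)
    (fun x hx => by
      rw [Polynomial.deriv]
      exact abs_eval_derivative_disc_le hR hb (NeZero.ne q) (abs_le.2 hx)) (abs_le.1 h₂) (abs_le.1 h₁)
  simpa [Real.norm_eq_abs] using this

theorem sin_le_eigenvalue_gap {J : JacobiMatrix} {q : ℕ} [NeZero q] (hJ : J.IsPeriodic q)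
    {R : ℝ} (hR : 1 ≤ R) (hb : J.IsRBounded R) (θ : ℝ) {j k : Fin q} (hjk : j ≠ k) :
    |Real.sin (2 * Real.pi * θ)|
      ≤ discBound R q * |J.eigenvalue q j θ - J.eigenvalue q k θ| := by
  have hB := one_le_discBound hR q
  by_cases hθ : Real.sin (2 * Real.pi * θ) = 0
  · rw [hθ, abs_zero]
    positivity
  · exact sin_le_of_disc_eq hJ hR hb (abs_eigenvalue_le hJ (by linarith) hb θ j)
      (abs_eigenvalue_le hJ (by linarith) hb θ k) (eigenvalue_ne hJ hθ hjk)
      (disc_eval_eigenvalue hJ θ j) (disc_eval_eigenvalue hJ θ k)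

end JacobiMatrix
end

noncomputable section

open Matrix Polynomial
open scoped InnerProductSpace

/-! ### Trigonometric estimates -/

theorem abs_sin_nat_mul_le (n : ℕ) (x : ℝ) : |Real.sin (n * x)| ≤ n * |Real.sin x| := by
  induction n with
  | zero => simp
  | succ n ih =>
    push_cast
    rw [add_mul, one_mul, Real.sin_add]
    calc |Real.sin (n * x) * Real.cos x + Real.cos (n * x) * Real.sin x|
        ≤ |Real.sin (n * x)| * |Real.cos x| + |Real.cos (n * x)| * |Real.sin x| := by
          rw [← abs_mul, ← abs_mul]; exact abs_add_le _ _
      _ ≤ (n * |Real.sin x|) * 1 + 1 * |Real.sin x| := by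
          gcongr
          · exact Real.abs_cos_le_one _
          · exact Real.abs_cos_le_one _
      _ = (n + 1) * |Real.sin x| := by ring

/-- Jordan's inequality for `2r ≤ m`; the other half follows by the reflection `r ↦ m - r`. -/
theorem inv_le_sin_of_nat {m r : ℕ} (hr : 0 < r) (hrm : r < m) :
    1 / (m : ℝ) ≤ Real.sin (Real.pi * (r / m)) := by
  have hpi := Real.pi_pos
  have key : ∀ s : ℕ, 0 < s → 2 * s ≤ m → 1 / (m : ℝ) ≤ Real.sin (Real.pi * (s / m)) := by
    intro s hs hsm
    have hm : 0 < (m : ℝ) := by exact_mod_cast (by omega : 0 < m)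
    have hs' : (1 : ℝ) ≤ s := by exact_mod_cast hs
    have hsm' : 2 * (s : ℝ) ≤ m := by exact_mod_cast hsm
    have h1 : Real.pi * ((s : ℝ) / m) ≤ Real.pi / 2 := by
      have : (s : ℝ) / m ≤ 1 / 2 := by rw [div_le_div_iff₀ hm two_pos]; linarith
      nlinarith
    refine le_trans ?_ (Real.mul_le_sin (by positivity) h1)
    rw [show 2 / Real.pi * (Real.pi * ((s : ℝ) / m)) = 2 * s / m by field_simp]
    gcongr
    linarith
  rcases le_or_gt (2 * r) m with h | h
  · exact key r hr h
  · have h1 := key (m - r) (by omega) (by omega)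
    have hm : (m : ℝ) ≠ 0 := by exact_mod_cast (by omega : m ≠ 0)
    rw [Nat.cast_sub hrm.le, sub_div, div_self hm, mul_sub, mul_one, Real.sin_pi_sub] at h1
    exact h1

/-- Two different values of `cos 2πx` at points `x` with `mx = θ` modulo one differ by a definite
amount. -/
theorem phase_gap {m l₁ l₂ : ℕ} (h₁ : l₁ < m) (h₂ : l₂ < m) (θ : ℝ)
    (hne : Real.cos (2 * Real.pi * ((θ + l₁) / m)) ≠ Real.cos (2 * Real.pi * ((θ + l₂) / m))) :
    |Real.sin (2 * Real.pi * θ)| / m * (|Real.sin (2 * Real.pi * ((θ + l₁) / m))| + 1 / m)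
      ≤ 2 * |Real.cos (2 * Real.pi * ((θ + l₁) / m)) -
          Real.cos (2 * Real.pi * ((θ + l₂) / m))| := by
  have hm0 : 0 < m := by omega
  have hm : (0 : ℝ) < m := by exact_mod_cast hm0
  set α := Real.pi * ((θ + l₁) / m + (θ + l₂) / m) with hα
  set β := Real.pi * ((θ + l₁) / m - (θ + l₂) / m) with hβ
  have hcc : Real.cos (2 * Real.pi * ((θ + l₁) / m)) - Real.cos (2 * Real.pi * ((θ + l₂) / m))
      = -2 * Real.sin α * Real.sin β := by
    rw [Real.cos_sub_cos, hα, hβ]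
    congr 2 <;> ring_nf
  have hs0 : -2 * Real.sin α * Real.sin β ≠ 0 := by
    rw [← hcc]; exact sub_ne_zero.2 hne
  have hβ0 : Real.sin β ≠ 0 := right_ne_zero_of_mul hs0
  have hS : |Real.sin (2 * Real.pi * θ)| / m ≤ |Real.sin α| := by
    rw [div_le_iff₀ hm]
    have h := abs_sin_nat_mul_le m α
    have e : (m : ℝ) * α = 2 * Real.pi * θ + ((l₁ + l₂ : ℕ) : ℝ) * Real.pi := by
      rw [hα]; push_cast; field_simp; ring
    rw [e, Real.sin_add_nat_mul_pi, abs_mul, abs_pow, abs_neg, abs_one, one_pow, one_mul] at h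
    linarith
  have hD : 1 / (m : ℝ) ≤ |Real.sin β| := by
    have e : ∀ l l' : ℕ, l' ≤ l → Real.pi * ((θ + l) / m - (θ + l') / m)
        = Real.pi * (((l - l' : ℕ) : ℝ) / m) := by
      intro l l' h
      rw [Nat.cast_sub h]; ring
    rcases lt_trichotomy l₁ l₂ with h | h | h
    · have e1 : β = -(Real.pi * ((θ + l₂) / m - (θ + l₁) / m)) := by rw [hβ]; ring
      rw [e1, Real.sin_neg, abs_neg, e _ _ h.le]
      exact (inv_le_sin_of_nat (by omega) (by omega)).trans (le_abs_self _)
    · exfalso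
      apply hβ0
      rw [hβ, h, sub_self, mul_zero, Real.sin_zero]
    · rw [hβ, e _ _ h.le]
      exact (inv_le_sin_of_nat (by omega) (by omega)).trans (le_abs_self _)
  have hy : |Real.sin (2 * Real.pi * ((θ + l₁) / m))| ≤ |Real.sin α| + |Real.sin β| := by
    have e : 2 * Real.pi * ((θ + l₁) / m) = α + β := by rw [hα, hβ]; ring
    rw [e, Real.sin_add]
    calc |Real.sin α * Real.cos β + Real.cos α * Real.sin β|
        ≤ |Real.sin α| * |Real.cos β| + |Real.cos α| * |Real.sin β| := by
          rw [← abs_mul, ← abs_mul]; exact abs_add_le _ _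
      _ ≤ |Real.sin α| * 1 + 1 * |Real.sin β| := by
          gcongr
          · exact Real.abs_cos_le_one _
          · exact Real.abs_cos_le_one _
      _ = _ := by ring
  rw [hcc, abs_mul, abs_mul, abs_neg, abs_two]
  set S := |Real.sin α|
  set D := |Real.sin β|
  set y := |Real.sin (2 * Real.pi * ((θ + l₁) / m))|
  set d := |Real.sin (2 * Real.pi * θ)|
  have hd1 : d ≤ 1 := Real.abs_sin_le_one _
  have hd0 : 0 ≤ d := abs_nonneg _
  have hdm : d / m ≤ 1 / m := by gcongr
  have hdm0 : 0 ≤ d / m := by positivity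
  have hdD : d / m ≤ D := hdm.trans hD
  -- Each of `S`, `D` is at least `d / m`, and the larger one controls `y + 1 / m` up to a factor 4
  -- because `y ≤ S + D` and `1 / m ≤ D`.
  rcases le_total S D with h | h
  · have : d / m * (y + 1 / m) ≤ S * (4 * D) := by
      have h1 : y + 1 / m ≤ 4 * D := by linarith
      have h0 : 0 ≤ y + 1 / m := by positivity
      gcongr
    linarith
  · have : d / m * (y + 1 / m) ≤ D * (4 * S) := by
      have h1 : y + 1 / m ≤ 4 * S := by linarith
      have h0 : 0 ≤ y + 1 / m := by positivity
      gcongr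
    linarith

theorem multiplier_add (x y : ℝ) : multiplier (x + y) = multiplier x * multiplier y := by
  rw [multiplier, multiplier, multiplier, ← Complex.exp_add]
  push_cast
  ring_nf

theorem exists_multiplier_of_pow_eq {m : ℕ} (hm : m ≠ 0) {ζ : ℂ} {θ : ℝ}
    (h : ζ ^ m = multiplier θ) : ∃ l < m, ζ = multiplier ((θ + l) / m) := by
  have hm' : (m : ℂ) ≠ 0 := by exact_mod_cast hm
  set ω := multiplier (θ / m) with hω
  have hω0 : ω ≠ 0 := multiplier_ne_zero _
  have hωm : ω ^ m = multiplier θ := by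
    rw [hω, multiplier, multiplier, ← Complex.exp_nat_mul]
    congr 1
    push_cast
    field_simp
  have h1 : (ζ / ω) ^ m = 1 := by
    rw [div_pow, h, hωm, div_self (multiplier_ne_zero θ)]
  have : NeZero m := ⟨hm⟩
  obtain ⟨l, hl, hlz⟩ := (Complex.isPrimitiveRoot_exp m hm).eq_pow_of_pow_eq_one h1
  refine ⟨l, hl, ?_⟩
  rw [eq_div_iff hω0] at hlz
  rw [← hlz, add_div, multiplier_add, mul_comm, ← Complex.exp_nat_mul, ← hω, multiplier]
  congr 2
  push_cast
  ring

/-! ### Bloch waves of a smaller period: phases, gaps and selection rule. -/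

namespace JacobiMatrix

theorem IsPeriodic.mul {J : JacobiMatrix} {q' : ℕ} (hJ : J.IsPeriodic q') (m : ℕ) :
    J.IsPeriodic (q' * m) := by
  intro n
  induction m with
  | zero => simp
  | succ m ih =>
    have h := hJ (n + ((q' * m : ℕ) : ℤ))
    rw [ih.1, ih.2] at h
    have e : n + ((q' * (m + 1) : ℕ) : ℤ) = n + ((q' * m : ℕ) : ℤ) + q' := by push_cast; ring
    rw [e]
    exact h

variable {J : JacobiMatrix} {q q' m : ℕ} [NeZero q] [NeZero q']

omit [NeZero q'] in
/-- An eigenvector of the Floquet matrix of period `q = q' m`, where `q'` is a period, is a Bloch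
wave for the period `q'`. -/
theorem exists_bloch (hJ : J.IsPeriodic q') (hq : q = q' * m) {θ : ℝ}
    (hθ : Real.sin (2 * Real.pi * θ) ≠ 0) (k : Fin q) :
    ∃ l < m,
      (∀ n, quasiExt q (multiplier θ) (J.eigenbasis q θ k).ofLp (n + q')
        = multiplier ((θ + l) / m) * quasiExt q (multiplier θ) (J.eigenbasis q θ k).ofLp n)
      ∧ (J.disc q').eval (J.eigenvalue q k θ) = 2 * Real.cos (2 * Real.pi * ((θ + l) / m)) := by
  have hJq : J.IsPeriodic q := hq ▸ hJ.mul m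
  have hm : m ≠ 0 := by
    rintro rfl
    exact NeZero.ne q (by simpa using hq)
  have hz := multiplier_ne_zero θ
  set u := (J.eigenbasis q θ k).ofLp with hu
  have hu0 : u ≠ 0 := J.eigenbasis_ofLp_ne_zero q θ k
  have heig : J.floquet q θ *ᵥ u = (J.eigenvalue q k θ : ℂ) • u := J.mulVec_eigenbasis q θ k
  set w := quasiExt q (multiplier θ) u with hw
  have hwq : ∀ n, w (n + q) = multiplier θ * w n := quasiExt_add_period q hz u
  have hwJ : ∀ n, J.seqOp w n = (J.eigenvalue q k θ : ℂ) * w n := seqOp_of_mulVec_eq hJq heig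
  -- The shift by `q'` commutes with `J` and preserves quasi-periodicity, so the shifted sequence
  -- solves the same eigenvalue problem. Simplicity makes it a multiple `ζ` of `w`, and `m` shifts
  -- give `ζ ^ m = multiplier θ`.
  set w' : ℤ → ℂ := fun n => w (n + q') with hw'
  set u' : Fin q → ℂ := fun j => w' (j : ℕ) with hu'
  have hw'q : ∀ n, w' (n + q) = multiplier θ * w' n := by
    intro n
    simp only [hw']
    rw [← hwq]
    congr 1
    ring
  have hw'u' : w' = quasiExt q (multiplier θ) u' := eq_quasiExt q hz u' w' hw'q (fun _ => rfl)
  have hw'J : ∀ n, J.seqOp w' n = (J.eigenvalue q k θ : ℂ) * w' n := by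
    intro n
    simp only [hw']
    rw [← hwJ, seqOp, seqOp, (hJ n).1, (hJ n).2]
    have h3 := (hJ (n - 1)).1
    rw [show n - 1 + (q' : ℤ) = n + q' - 1 by ring] at h3
    rw [h3, show n + 1 + (q' : ℤ) = n + q' + 1 by ring, show n - 1 + (q' : ℤ) = n + q' - 1 by ring]
  have heig' : J.floquet q θ *ᵥ u' = (J.eigenvalue q k θ : ℂ) • u' := by
    ext j
    rw [floquet_mulVec J hJq, ← hw'u', hw'J]
    rfl
  obtain ⟨c, d, hcd, h0⟩ := linearDependent_of_same_eigenvalue hJq hθ heig heig'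
  have hd : d ≠ 0 := by
    rintro rfl
    rw [zero_smul, add_zero] at h0
    rcases hcd with h | h
    · exact hu0 ((smul_eq_zero.1 h0).resolve_left h)
    · exact h rfl
  set ζ := -c / d with hζ
  have hu'ζ : u' = ζ • u := by
    have h1 : d • u' = (-c) • u := by
      rw [neg_smul]; exact eq_neg_of_add_eq_zero_right h0
    rw [hζ, div_eq_inv_mul, mul_smul, ← h1, smul_smul, inv_mul_cancel₀ hd, one_smul]
  have hwζ : ∀ n, w (n + q') = ζ * w n := by
    intro n
    change w' n = _
    rw [hw'u', hu'ζ, hw, quasiExt, quasiExt, Pi.smul_apply, smul_eq_mul]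
    ring
  obtain ⟨n₀, hn₀⟩ : ∃ n, w n ≠ 0 := by
    by_contra! h
    refine hu0 (funext fun j => ?_)
    have := h (j : ℕ)
    rwa [hw, quasiExt_coe] at this
  have hwpow : ∀ i : ℕ, ∀ n, w (n + i * q') = ζ ^ i * w n := by
    intro i
    induction i with
    | zero => simp
    | succ i ih =>
      intro n
      have : n + ((i + 1 : ℕ) : ℤ) * q' = n + i * q' + q' := by push_cast; ring
      rw [this, hwζ, ih, pow_succ]
      ring
  have hζm : ζ ^ m = multiplier θ := by
    have h1 := hwpow m n₀
    have h2 := hwq n₀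
    rw [hq, show ((q' * m : ℕ) : ℤ) = m * q' by push_cast; ring, h1] at h2
    exact mul_right_cancel₀ hn₀ h2
  obtain ⟨l, hl, hζl⟩ := exists_multiplier_of_pow_eq hm hζm
  refine ⟨l, hl, fun n => by rw [← hζl]; exact hwζ n, ?_⟩
  have hζ0 : ζ ≠ 0 := by rw [hζl]; exact multiplier_ne_zero _
  have hx0 : J.state w 0 ≠ 0 := by
    intro h
    refine hu0 (funext fun j => ?_)
    have := eq_zero_of_state_eq_zero J _ w hwJ h j
    rwa [hw, quasiExt_coe] at this
  have hTx : J.transfer q' (J.eigenvalue q k θ) *ᵥ J.state w 0 = ζ • J.state w 0 := by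
    rw [transfer_mulVec_state J _ w hwJ]
    have := state_quasi hJ hwζ 0
    rwa [zero_add] at this
  have htr := (exists_mulVec_eq_smul_iff (det_transfer J q' _) hζ0).1 ⟨_, hx0, hTx⟩
  have h2 : aeval ((J.eigenvalue q k θ : ℝ) : ℂ) (J.disc q')
      = (((J.disc q').eval (J.eigenvalue q k θ) : ℝ) : ℂ) := by
    have := aeval_algebraMap_apply ℂ (J.eigenvalue q k θ) (J.disc q')
    simpa using this
  rw [trace_transfer, h2, hζl, multiplier_add_inv] at htr
  exact_mod_cast htr

/-- The index of the Bloch phase of an eigenvector. -/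
def phaseIndex (J : JacobiMatrix) (q q' m : ℕ) [NeZero q] [NeZero q'] (hJ : J.IsPeriodic q')
    (hq : q = q' * m) (θ : ℝ) (hθ : Real.sin (2 * Real.pi * θ) ≠ 0) (k : Fin q) : Fin m :=
  ⟨(exists_bloch hJ hq hθ k).choose, (exists_bloch hJ hq hθ k).choose_spec.1⟩

theorem bloch_phaseIndex (hJ : J.IsPeriodic q') (hq : q = q' * m) {θ : ℝ}
    (hθ : Real.sin (2 * Real.pi * θ) ≠ 0) (k : Fin q) (n : ℤ) :
    quasiExt q (multiplier θ) (J.eigenbasis q θ k).ofLp (n + q')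
      = multiplier ((θ + (J.phaseIndex q q' m hJ hq θ hθ k : ℕ)) / m)
        * quasiExt q (multiplier θ) (J.eigenbasis q θ k).ofLp n :=
  (exists_bloch hJ hq hθ k).choose_spec.2.1 n

theorem disc_eval_phaseIndex (hJ : J.IsPeriodic q') (hq : q = q' * m) {θ : ℝ}
    (hθ : Real.sin (2 * Real.pi * θ) ≠ 0) (k : Fin q) :
    (J.disc q').eval (J.eigenvalue q k θ)
      = 2 * Real.cos (2 * Real.pi * ((θ + (J.phaseIndex q q' m hJ hq θ hθ k : ℕ)) / m)) :=
  (exists_bloch hJ hq hθ k).choose_spec.2.2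

/-- Each phase is taken at most `q'` times: the corresponding eigenvalues are distinct, and all
belong to the `q' × q'` Floquet matrix at `(θ + l)/m`. -/
theorem sum_phaseIndex_le (hJ : J.IsPeriodic q') (hq : q = q' * m) {θ : ℝ}
    (hθ : Real.sin (2 * Real.pi * θ) ≠ 0) (f : Fin m → ℝ) (hf : ∀ l, 0 ≤ f l) :
    ∑ k, f (J.phaseIndex q q' m hJ hq θ hθ k) ≤ q' * ∑ l, f l := by
  classical
  have hJq : J.IsPeriodic q := hq ▸ hJ.mul m
  rw [← Finset.sum_fiberwise Finset.univ (J.phaseIndex q q' m hJ hq θ hθ), Finset.mul_sum]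
  refine Finset.sum_le_sum fun l _ => ?_
  rw [Finset.sum_congr rfl (g := fun _ => f l)
    (fun k hk => by rw [(Finset.mem_filter.1 hk).2]), Finset.sum_const, nsmul_eq_mul]
  refine mul_le_mul_of_nonneg_right ?_ (hf l)
  have hex : ∀ k : Fin q, J.phaseIndex q q' m hJ hq θ hθ k = l →
      ∃ i : Fin q', J.eigenvalue q' i ((θ + (l : ℕ)) / m) = J.eigenvalue q k θ := by
    intro k hk
    have h := disc_eval_phaseIndex hJ hq hθ k
    rw [hk] at h
    exact exists_eigenvalue_of_disc_eval hJ h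
  have hcard : (Finset.univ.filter fun k => J.phaseIndex q q' m hJ hq θ hθ k = l).card
      ≤ (Finset.univ : Finset (Fin q')).card := by
    refine Finset.card_le_card_of_injOn
      (fun k => if h : J.phaseIndex q q' m hJ hq θ hθ k = l then (hex k h).choose else 0)
      (fun _ _ => Finset.mem_coe.2 (Finset.mem_univ _)) ?_
    intro j hj k hk hjk
    have hj' : J.phaseIndex q q' m hJ hq θ hθ j = l := by simpa using hj
    have hk' : J.phaseIndex q q' m hJ hq θ hθ k = l := by simpa using hk
    simp only [hj', hk', dif_pos] at hjk
    have e1 := (hex j hj').choose_spec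
    have e2 := (hex k hk').choose_spec
    rw [hjk] at e1
    by_contra hne
    exact eigenvalue_ne hJq hθ hne (e1.symm.trans e2)
  rw [Finset.card_univ, Fintype.card_fin] at hcard
  exact_mod_cast hcard

/-- Distinct eigenvalues of the Floquet matrix of period `q' m` are separated in terms of the
discriminant of period `q'`. -/
theorem lifted_gap (hJ : J.IsPeriodic q') (hq : q = q' * m) {R : ℝ} (hR : 1 ≤ R)
    (hb : J.IsRBounded R) {θ : ℝ} (hθ : Real.sin (2 * Real.pi * θ) ≠ 0) {j k : Fin q}
    (hjk : k ≠ j) :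
    |Real.sin (2 * Real.pi * θ)| / m *
        (|Real.sin (2 * Real.pi * ((θ + (J.phaseIndex q q' m hJ hq θ hθ j : ℕ)) / m))| + 1 / m)
      ≤ 2 * discBound R q' * |J.eigenvalue q k θ - J.eigenvalue q j θ| := by
  have hJq : J.IsPeriodic q := hq ▸ hJ.mul m
  have hR0 : 0 < R := by linarith
  have hB := one_le_discBound hR q'
  have hmN : 0 < m := Nat.pos_of_ne_zero fun h => NeZero.ne q (by simpa [h] using hq)
  have hm : (0 : ℝ) < m := by exact_mod_cast hmN
  have hm1 : (1 : ℝ) ≤ m := by exact_mod_cast hmN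
  have ej := disc_eval_phaseIndex hJ hq hθ j
  have ek := disc_eval_phaseIndex hJ hq hθ k
  set lj := J.phaseIndex q q' m hJ hq θ hθ j
  set lk := J.phaseIndex q q' m hJ hq θ hθ k
  have bj := abs_eigenvalue_le hJq hR0 hb θ j
  have bk := abs_eigenvalue_le hJq hR0 hb θ k
  -- Equal cosines put both energies at the same value of the discriminant of period `q'`, so the
  -- critical point argument applies. Different cosines are separated by `phase_gap`, and the
  -- Lipschitz bound turns this into a separation of energies.
  by_cases hc : Real.cos (2 * Real.pi * ((θ + (lj : ℕ)) / m))
      = Real.cos (2 * Real.pi * ((θ + (lk : ℕ)) / m))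
  · have h1 := sin_le_of_disc_eq hJ hR hb bk bj (eigenvalue_ne hJq hθ hjk)
      (ek.trans (by rw [hc])) ej
    set y := |Real.sin (2 * Real.pi * ((θ + (lj : ℕ)) / m))| with hy
    have hd : |Real.sin (2 * Real.pi * θ)| / m ≤ y := by
      rw [div_le_iff₀ hm, hy]
      have h := abs_sin_nat_mul_le m (2 * Real.pi * ((θ + (lj : ℕ)) / m))
      have e : (m : ℝ) * (2 * Real.pi * ((θ + (lj : ℕ)) / m))
          = 2 * Real.pi * θ + (lj : ℕ) * (2 * Real.pi) := by field_simp
      rw [e, Real.sin_add_nat_mul_two_pi] at h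
      linarith
    have hy1 : y ≤ 1 := Real.abs_sin_le_one _
    have hm2 : 1 / (m : ℝ) ≤ 1 := by rw [div_le_one hm]; exact hm1
    have hd0 : 0 ≤ |Real.sin (2 * Real.pi * θ)| / m := by positivity
    calc |Real.sin (2 * Real.pi * θ)| / m * (y + 1 / m) ≤ y * 2 := by
          gcongr; linarith
      _ ≤ _ := by linarith
  · have h1 := phase_gap lj.2 lk.2 θ hc
    have h2 := abs_disc_sub_le hR hb bk bj (q := q')
    rw [ek, ej, ← mul_sub, abs_mul, abs_two, abs_sub_comm (Real.cos _)] at h2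
    have h3 : 0 ≤ discBound R q' * |J.eigenvalue q k θ - J.eigenvalue q j θ| := by positivity
    linarith

theorem inner_eigenbasis_momentumCLM (hJq : J.IsPeriodic q) (θ : ℝ) (a j : Fin q) :
    ⟪J.eigenbasis q θ a, J.momentumCLM q θ (J.eigenbasis q θ j)⟫_ℂ
      = ∑ n : Fin q, (starRingEnd ℂ) (quasiExt q (multiplier θ) (J.eigenbasis q θ a).ofLp (n : ℕ))
          * J.seqMomentum (quasiExt q (multiplier θ) (J.eigenbasis q θ j).ofLp) (n : ℕ) := by
  rw [PiLp.inner_apply]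
  refine Finset.sum_congr rfl fun n _ => ?_
  rw [quasiExt_coe, RCLike.inner_apply, momentumCLM, ofLp_toEuclideanCLM,
    floquetMomentum_mulVec J hJq]
  ring

/-- The momentum only connects Bloch waves with the same phase, whose eigenvalues have a gap. -/
theorem lifted_momentum_gap (hJ : J.IsPeriodic q') (hq : q = q' * m) {R : ℝ} (hR : 1 ≤ R)
    (hb : J.IsRBounded R) {θ : ℝ} (hθ : Real.sin (2 * Real.pi * θ) ≠ 0) {a j : Fin q}
    (haj : a ≠ j)
    (h : ⟪J.eigenbasis q θ a, J.momentumCLM q θ (J.eigenbasis q θ j)⟫_ℂ ≠ 0) :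
    |Real.sin (2 * Real.pi * ((θ + (J.phaseIndex q q' m hJ hq θ hθ j : ℕ)) / m))|
      ≤ discBound R q' * |J.eigenvalue q a θ - J.eigenvalue q j θ| := by
  have hJq : J.IsPeriodic q := hq ▸ hJ.mul m
  have hR0 : 0 < R := by linarith
  have ej := disc_eval_phaseIndex hJ hq hθ j
  have ea := disc_eval_phaseIndex hJ hq hθ a
  have wj := bloch_phaseIndex hJ hq hθ j
  have wa := bloch_phaseIndex hJ hq hθ a
  rw [inner_eigenbasis_momentumCLM hJq] at h
  set xj := (θ + (J.phaseIndex q q' m hJ hq θ hθ j : ℕ)) / m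
  set xa := (θ + (J.phaseIndex q q' m hJ hq θ hθ a : ℕ)) / m
  have hconj : ∀ x : ℝ, (starRingEnd ℂ) (multiplier x) = (multiplier x)⁻¹ := by
    intro x
    rw [Complex.inv_def, Complex.normSq_eq_norm_sq, norm_multiplier]
    simp
  set F : ℤ → ℂ := fun n =>
    (starRingEnd ℂ) (quasiExt q (multiplier θ) (J.eigenbasis q θ a).ofLp n)
      * J.seqMomentum (quasiExt q (multiplier θ) (J.eigenbasis q θ j).ofLp) n with hF
  have hFq : ∀ n, F (n + q) = F n := by
    intro n
    simp only [hF]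
    rw [quasiExt_add_period q (multiplier_ne_zero θ),
      seqMomentum_quasi hJq (quasiExt_add_period q (multiplier_ne_zero θ) _), map_mul, hconj]
    have := multiplier_ne_zero θ
    field_simp
  have hFq' : ∀ n, F (n + q') = (multiplier xa)⁻¹ * multiplier xj * F n := by
    intro n
    simp only [hF]
    rw [wa, seqMomentum_quasi hJ wj, map_mul, hconj]
    ring
  -- A sum over a full period is invariant under the shift by `q'`, which also multiplies it by the
  -- ratio of the Bloch multipliers. A nonzero matrix element therefore forces the multipliers to
  -- agree.
  have hsum := sum_fin_add_of_periodic q F hFq q'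
  simp only [hFq'] at hsum
  rw [← Finset.mul_sum] at hsum
  have h1 : (multiplier xa)⁻¹ * multiplier xj = 1 := by
    have h2 : ((multiplier xa)⁻¹ * multiplier xj - 1) * ∑ n : Fin q, F (n : ℕ) = 0 := by
      linear_combination hsum
    exact sub_eq_zero.1 ((mul_eq_zero.1 h2).resolve_right h)
  have h3 : multiplier xj = multiplier xa := by
    have := multiplier_ne_zero xa
    field_simp at h1
    exact h1
  have h4 : 2 * Real.cos (2 * Real.pi * xa) = 2 * Real.cos (2 * Real.pi * xj) := by
    have e1 := multiplier_add_inv xa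
    rw [← h3, multiplier_add_inv] at e1
    exact_mod_cast e1.symm
  exact sin_le_of_disc_eq hJ hR hb (abs_eigenvalue_le hJq hR0 hb θ a)
    (abs_eigenvalue_le hJq hR0 hb θ j) (eigenvalue_ne hJq hθ haj) (ea.trans h4) ej

end JacobiMatrix
end

/-! ### Time averages in the eigenbasis; resonant and non-resonant pairs. -/

noncomputable section

open Matrix Polynomial
open scoped InnerProductSpace

section MatrixExp

attribute [local instance] Matrix.linftyOpNormedRing Matrix.linftyOpNormedAlgebra

theorem exp_smul_mulVec {n : Type*} [Fintype n] [DecidableEq n] (M : Matrix n n ℂ) (v : n → ℂ)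
    (c l : ℂ) (h : M *ᵥ v = l • v) :
    NormedSpace.exp (c • M) *ᵥ v = Complex.exp (c * l) • v := by
  have hpow : ∀ k : ℕ, (c • M) ^ k *ᵥ v = (c * l) ^ k • v := by
    intro k
    induction k with
    | zero => simp
    | succ k ih =>
      rw [pow_succ, ← Matrix.mulVec_mulVec, Matrix.smul_mulVec, h, smul_smul, Matrix.mulVec_smul,
        ih, smul_smul, pow_succ, mul_comm]
  have h1 := NormedSpace.exp_series_hasSum_exp' (𝕂 := ℂ) (c • M)
  let L : Matrix n n ℂ →ₗ[ℂ] (n → ℂ) :=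
    { toFun := fun N => N *ᵥ v
      map_add' := fun N N' => Matrix.add_mulVec N N' v
      map_smul' := fun z N => Matrix.smul_mulVec z N v }
  have h2 := h1.map L.toAddMonoidHom (LinearMap.continuous_of_finiteDimensional L)
  have h3 := NormedSpace.exp_series_hasSum_exp' (𝕂 := ℂ) (c * l)
  have h4 := h3.smul_const v
  rw [← Complex.exp_eq_exp_ℂ] at h4
  refine HasSum.unique h2 ?_
  convert h4 using 1
  funext k
  change ((k.factorial : ℂ)⁻¹ • (c • M) ^ k) *ᵥ v = _
  rw [Matrix.smul_mulVec, hpow, smul_smul, smul_eq_mul]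

theorem continuous_exp_smul {n : Type*} [Fintype n] [DecidableEq n] (M : Matrix n n ℂ) {f : ℝ → ℂ}
    (hf : Continuous f) : Continuous fun s => NormedSpace.exp (f s • M) :=
  (NormedSpace.exp_continuous (𝔸 := Matrix n n ℂ)).comp (hf.smul continuous_const)

end MatrixExp

namespace SpectralBasis

variable {E : Type*} [NormedAddCommGroup E] [InnerProductSpace ℂ E] {q : ℕ}

theorem inner_apply_complex (T : E →L[ℂ] E) (v : OrthonormalBasis (Fin q) ℂ E) (l : Fin q → ℂ)
    (h : ∀ i, T (v i) = l i • v i) (i : Fin q) (x : E) :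
    ⟪v i, T x⟫_ℂ = l i * ⟪v i, x⟫_ℂ := by
  conv_lhs => rw [← v.sum_repr' x]
  simp only [map_sum, map_smul, h, inner_sum, inner_smul_right]
  rw [Finset.sum_eq_single i]
  · simp [mul_comm]
  · intro j _ hj
    simp [Ne.symm hj]
  · simp

/-- Parseval in each index separately. It allows the Hilbert–Schmidt norm to be computed in an
eigenbasis that varies with `θ`. -/
theorem sum_norm_inner_sq_eq [FiniteDimensional ℂ E] (T : E →L[ℂ] E)
    (v w : OrthonormalBasis (Fin q) ℂ E) :
    ∑ j, ∑ k, ‖⟪v j, T (v k)⟫_ℂ‖ ^ 2 = ∑ j, ∑ k, ‖⟪w j, T (w k)⟫_ℂ‖ ^ 2 := by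
  have := FiniteDimensional.complete ℂ E
  have h1 : ∀ x : E, ∑ k, ‖⟪x, T (v k)⟫_ℂ‖ ^ 2 = ∑ k, ‖⟪x, T (w k)⟫_ℂ‖ ^ 2 := by
    intro x
    simp only [← ContinuousLinearMap.adjoint_inner_left]
    rw [v.sum_sq_norm_inner_left, w.sum_sq_norm_inner_left]
  rw [Finset.sum_congr rfl fun j _ => h1 (v j), Finset.sum_comm,
    Finset.sum_comm (f := fun j k => ‖⟪w j, T (w k)⟫_ℂ‖ ^ 2)]
  refine Finset.sum_congr rfl fun k _ => ?_
  rw [v.sum_sq_norm_inner_right, w.sum_sq_norm_inner_right]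

end SpectralBasis

theorem hsNormSq_eq_sum_inner {q : ℕ} (M : Matrix (Fin q) (Fin q) ℂ)
    (v : OrthonormalBasis (Fin q) ℂ (EuclideanSpace ℂ (Fin q))) :
    hsNormSq M = ∑ j, ∑ k, ‖⟪v j, toEuclideanCLM (𝕜 := ℂ) M (v k)⟫_ℂ‖ ^ 2 := by
  rw [SpectralBasis.sum_norm_inner_sq_eq _ v (EuclideanSpace.basisFun (Fin q) ℂ), hsNormSq]
  refine Finset.sum_congr rfl fun j _ => Finset.sum_congr rfl fun k _ => ?_
  simp [EuclideanSpace.basisFun_apply, EuclideanSpace.inner_single_left, ofLp_toEuclideanCLM]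

/-- The average of `e^{isμ}` over `[0, t]`. -/
def phaseAverage (t μ : ℝ) : ℂ := (t : ℂ)⁻¹ * ∫ s in (0 : ℝ)..t, Complex.exp (Complex.I * s * μ)

theorem phaseAverage_zero {t : ℝ} (ht : t ≠ 0) : phaseAverage t 0 = 1 := by
  have : (t : ℂ) ≠ 0 := by exact_mod_cast ht
  simp [phaseAverage, this]

theorem norm_exp_I_mul (s μ : ℝ) : ‖Complex.exp (Complex.I * s * μ)‖ = 1 := by
  rw [Complex.norm_exp]
  simp

theorem norm_phaseAverage_le_one {t : ℝ} (ht : t ≠ 0) (μ : ℝ) : ‖phaseAverage t μ‖ ≤ 1 := by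
  have h := intervalIntegral.norm_integral_le_of_norm_le_const (a := 0) (b := t) (C := 1)
    (f := fun s : ℝ => Complex.exp (Complex.I * s * μ)) (fun s _ => (norm_exp_I_mul s μ).le)
  have ht' : 0 < |t| := abs_pos.2 ht
  rw [phaseAverage, norm_mul, norm_inv, Complex.norm_real, Real.norm_eq_abs,
    inv_mul_le_iff₀ ht', mul_one]
  simpa using h

theorem norm_phaseAverage_le {t μ : ℝ} (ht : t ≠ 0) (hμ : μ ≠ 0) :
    ‖phaseAverage t μ‖ ≤ 2 / (|t| * |μ|) := by
  have ht' : 0 < |t| := abs_pos.2 ht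
  have hμ' : 0 < |μ| := abs_pos.2 hμ
  have hc : Complex.I * μ ≠ 0 := mul_ne_zero Complex.I_ne_zero (by exact_mod_cast hμ)
  have h1 : ∫ s in (0 : ℝ)..t, Complex.exp (Complex.I * s * μ)
      = (Complex.exp (Complex.I * t * μ) - 1) / (Complex.I * μ) := by
    have := integral_exp_mul_complex (a := 0) (b := t) hc
    rw [show (fun s : ℝ => Complex.exp (Complex.I * s * μ))
      = fun s : ℝ => Complex.exp (Complex.I * μ * s) by funext s; ring_nf, this]
    simp
    ring_nf
  rw [phaseAverage, h1, norm_mul, norm_inv, norm_div, norm_mul, Complex.norm_I, one_mul,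
    Complex.norm_real, Complex.norm_real, Real.norm_eq_abs, Real.norm_eq_abs]
  have h2 : ‖Complex.exp (Complex.I * t * μ) - 1‖ ≤ 2 := by
    refine (norm_sub_le _ _).trans ?_
    rw [norm_exp_I_mul, norm_one]
    norm_num
  rw [inv_mul_eq_div, div_div, mul_comm |μ| |t|]
  gcongr

namespace JacobiMatrix

variable {J : JacobiMatrix} {q : ℕ} [NeZero q]

/-- Conjugation by the evolution multiplies a matrix element by `e^{is(λ_j-λ_k)}`. The average is
defined entrywise, so the pairing is written as a finite sum to be moved under the integral. -/
theorem inner_timeAverageFiber (J : JacobiMatrix) (q : ℕ) (t θ : ℝ) (j k : Fin q) :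
    ⟪J.eigenbasis q θ j,
        toEuclideanCLM (𝕜 := ℂ) (J.timeAverageFiber q t θ) (J.eigenbasis q θ k)⟫_ℂ
      = phaseAverage t (J.eigenvalue q j θ - J.eigenvalue q k θ)
        * ⟪J.eigenbasis q θ j, J.momentumCLM q θ (J.eigenbasis q θ k)⟫_ℂ := by
  set v := J.eigenbasis q θ with hv
  set G : ℝ → Matrix (Fin q) (Fin q) ℂ := fun s =>
    NormedSpace.exp ((Complex.I * s) • J.floquet q θ) * J.floquetMomentum q θ *
      NormedSpace.exp ((-(Complex.I * s)) • J.floquet q θ) with hG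
  have hGc : ∀ a b, Continuous fun s => G s a b := by
    intro a b
    have h1 := continuous_exp_smul (J.floquet q θ) (f := fun s : ℝ => Complex.I * s) (by fun_prop)
    have h2 := continuous_exp_smul (J.floquet q θ) (f := fun s : ℝ => -(Complex.I * s))
      (by fun_prop)
    exact ((h1.matrix_mul continuous_const).matrix_mul h2).matrix_elem a b
  have hinner : ∀ M : Matrix (Fin q) (Fin q) ℂ, ⟪v j, toEuclideanCLM (𝕜 := ℂ) M (v k)⟫_ℂ
      = ∑ a, ∑ b, (v k) b * (starRingEnd ℂ) ((v j) a) * M a b := by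
    intro M
    rw [PiLp.inner_apply]
    refine Finset.sum_congr rfl fun a _ => ?_
    rw [RCLike.inner_apply, ofLp_toEuclideanCLM, Matrix.mulVec, dotProduct, Finset.sum_mul]
    refine Finset.sum_congr rfl fun b _ => ?_
    ring
  have hGs : ∀ s, ⟪v j, toEuclideanCLM (𝕜 := ℂ) (G s) (v k)⟫_ℂ
      = Complex.exp (Complex.I * s * (J.eigenvalue q j θ - J.eigenvalue q k θ : ℝ))
        * ⟪v j, J.momentumCLM q θ (v k)⟫_ℂ := by
    intro s
    have hexp : ∀ (c : ℂ) (i : Fin q),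
        toEuclideanCLM (𝕜 := ℂ) (NormedSpace.exp (c • J.floquet q θ)) (v i)
          = Complex.exp (c * J.eigenvalue q i θ) • v i := by
      intro c i
      apply WithLp.ofLp_injective
      rw [ofLp_toEuclideanCLM, exp_smul_mulVec _ _ _ _ (J.mulVec_eigenbasis q θ i)]
      rfl
    have h1 : toEuclideanCLM (𝕜 := ℂ) (G s) (v k)
        = toEuclideanCLM (𝕜 := ℂ) (NormedSpace.exp ((Complex.I * s) • J.floquet q θ))
          (J.momentumCLM q θ (toEuclideanCLM (𝕜 := ℂ)
            (NormedSpace.exp ((-(Complex.I * s)) • J.floquet q θ)) (v k))) := by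
      simp only [hG, map_mul]
      rfl
    rw [h1, hexp, map_smul, map_smul, inner_smul_right,
      SpectralBasis.inner_apply_complex _ v _ (hexp (Complex.I * s)), ← mul_assoc,
      ← Complex.exp_add]
    congr 2
    push_cast
    ring
  have hT : ∀ a b, J.timeAverageFiber q t θ a b = (t : ℂ)⁻¹ * ∫ s in (0 : ℝ)..t, G s a b :=
    fun a b => rfl
  calc ⟪v j, toEuclideanCLM (𝕜 := ℂ) (J.timeAverageFiber q t θ) (v k)⟫_ℂ
      = ∑ a, ∑ b, (t : ℂ)⁻¹ * ∫ s in (0 : ℝ)..t, (v k) b * (starRingEnd ℂ) ((v j) a) * G s a b := by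
        rw [hinner]
        refine Finset.sum_congr rfl fun a _ => Finset.sum_congr rfl fun b _ => ?_
        rw [hT, intervalIntegral.integral_const_mul]
        ring
    _ = (t : ℂ)⁻¹ * ∫ s in (0 : ℝ)..t, ⟪v j, toEuclideanCLM (𝕜 := ℂ) (G s) (v k)⟫_ℂ := by
        simp only [hinner, ← Finset.mul_sum]
        rw [intervalIntegral.integral_finsetSum]
        · congr 1
          refine Finset.sum_congr rfl fun a _ => ?_
          rw [intervalIntegral.integral_finsetSum]
          intro b _
          exact (((hGc a b).const_mul _)).intervalIntegrable _ _
        · intro a _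
          exact (continuous_finsetSum _ fun b _ => (hGc a b).const_mul _).intervalIntegrable _ _
    _ = _ := by
        simp only [hGs]
        rw [intervalIntegral.integral_mul_const, phaseAverage, mul_assoc]

/-- Simple spectrum turns the spectral projections into the coordinate projections of the
eigenbasis. -/
theorem eigenprojection_eigenbasis (hJ : J.IsPeriodic q) {θ : ℝ}
    (hθ : Real.sin (2 * Real.pi * θ) ≠ 0) (k i : Fin q) :
    toEuclideanCLM (𝕜 := ℂ) (J.eigenprojection q k θ) (J.eigenbasis q θ i)
      = if k = i then J.eigenbasis q θ i else 0 := by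
  set S := Module.End.eigenspace (Matrix.toEuclideanLin (J.floquet q θ))
    (J.eigenvalue q k θ : ℂ) with hS
  have h1 : ∀ x, toEuclideanCLM (𝕜 := ℂ) (J.eigenprojection q k θ) x = S.starProjection x := by
    intro x
    have : Matrix.toEuclideanLin (J.eigenprojection q k θ) = (S.starProjection : _ →ₗ[ℂ] _) := by
      rw [eigenprojection, LinearEquiv.apply_symm_apply]
    exact congrArg (fun L : EuclideanSpace ℂ (Fin q) →ₗ[ℂ] EuclideanSpace ℂ (Fin q) => L x) this
  rw [h1]
  split_ifs with h
  · subst h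
    rw [Submodule.starProjection_eq_self_iff, hS, Module.End.mem_eigenspace_iff]
    exact J.floquetCLM_eigenbasis q θ k
  · rw [Submodule.starProjection_apply_eq_zero_iff, Submodule.mem_orthogonal]
    intro u hu
    rw [hS, Module.End.mem_eigenspace_iff] at hu
    have h2 := SpectralBasis.inner_apply (J.floquetCLM q θ) (J.eigenbasis q θ)
      (fun k => J.eigenvalue q k θ) (J.floquetCLM_eigenbasis q θ) i u
    have h3 : J.floquetCLM q θ u = (J.eigenvalue q k θ : ℂ) • u := hu
    rw [h3, inner_smul_right] at h2
    have h4 : ((J.eigenvalue q k θ - J.eigenvalue q i θ : ℝ) : ℂ) ≠ 0 := by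
      exact_mod_cast sub_ne_zero.2 (eigenvalue_ne hJ hθ h)
    have h5 : ⟪J.eigenbasis q θ i, u⟫_ℂ = 0 := by
      refine (mul_eq_zero.1 (?_ : ((J.eigenvalue q k θ - J.eigenvalue q i θ : ℝ) : ℂ) * _ = 0)).resolve_left h4
      push_cast
      linear_combination h2
    exact inner_eq_zero_symm.1 h5

theorem velocityFiber_eigenbasis (hJ : J.IsPeriodic q) {θ : ℝ}
    (hθ : Real.sin (2 * Real.pi * θ) ≠ 0) (i : Fin q) :
    toEuclideanCLM (𝕜 := ℂ) (J.velocityFiber q θ) (J.eigenbasis q θ i)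
      = ((q : ℂ) * ((deriv (J.eigenvalue q i) θ / (2 * Real.pi) : ℝ) : ℂ))
        • J.eigenbasis q θ i := by
  rw [velocityFiber, map_smul, map_sum]
  simp only [map_smul, _root_.smul_apply, _root_.sum_apply, eigenprojection_eigenbasis hJ hθ]
  simp [smul_smul]

/-- The diagonal cancels: the phase average at frequency zero is 1, and the diagonal of the momentum
consists of the velocities. -/
theorem inner_velocityFiber_sub_timeAverageFiber (hJ : J.IsPeriodic q) {θ : ℝ}
    (hθ : Real.sin (2 * Real.pi * θ) ≠ 0) {t : ℝ} (ht : t ≠ 0) (j k : Fin q) :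
    ⟪J.eigenbasis q θ j, toEuclideanCLM (𝕜 := ℂ)
        (J.velocityFiber q θ - J.timeAverageFiber q t θ) (J.eigenbasis q θ k)⟫_ℂ
      = if j = k then 0 else
        -(phaseAverage t (J.eigenvalue q j θ - J.eigenvalue q k θ)
          * ⟪J.eigenbasis q θ j, J.momentumCLM q θ (J.eigenbasis q θ k)⟫_ℂ) := by
  rw [map_sub, _root_.sub_apply, inner_sub_right, inner_timeAverageFiber,
    velocityFiber_eigenbasis hJ hθ, inner_smul_right]
  split_ifs with h
  · subst h
    rw [sub_self, phaseAverage_zero ht, inner_momentumCLM_eigenbasis hJ hθ]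
    simp
  · simp [h]

theorem hsNormSq_velocityFiber_sub_timeAverageFiber (hJ : J.IsPeriodic q) {θ : ℝ}
    (hθ : Real.sin (2 * Real.pi * θ) ≠ 0) {t : ℝ} (ht : t ≠ 0) :
    hsNormSq (J.velocityFiber q θ - J.timeAverageFiber q t θ)
      = ∑ k, ∑ j ∈ Finset.univ.erase k,
          ‖phaseAverage t (J.eigenvalue q j θ - J.eigenvalue q k θ)‖ ^ 2
            * ‖⟪J.eigenbasis q θ j, J.momentumCLM q θ (J.eigenbasis q θ k)⟫_ℂ‖ ^ 2 := by
  rw [hsNormSq_eq_sum_inner _ (J.eigenbasis q θ), Finset.sum_comm]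
  refine Finset.sum_congr rfl fun k _ => ?_
  rw [← Finset.add_sum_erase _ _ (Finset.mem_univ k)]
  simp only [inner_velocityFiber_sub_timeAverageFiber hJ hθ ht, if_true, norm_zero]
  rw [zero_pow two_ne_zero, zero_add]
  refine Finset.sum_congr rfl fun j hj => ?_
  rw [if_neg (Finset.mem_erase.1 hj).1, norm_neg, norm_mul, mul_pow]

/-- Splitting into resonant and non-resonant pairs of eigenvalues. -/
theorem hsNormSq_le_sum_component (hJ : J.IsPeriodic q) {R : ℝ} (hR : 0 < R)
    (hb : J.IsRBounded R) {θ : ℝ} (hθ : Real.sin (2 * Real.pi * θ) ≠ 0) {t : ℝ} (ht : t ≠ 0)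
    {ε : ℝ} (hε : 0 < ε) :
    hsNormSq (J.velocityFiber q θ - J.timeAverageFiber q t θ)
      ≤ 16 * R ^ 2 * q / (t ^ 2 * ε ^ 2)
        + ∑ k, ‖SpectralBasis.component (J.eigenbasis q θ)
            (Finset.univ.filter fun j => j ≠ k ∧ |J.eigenvalue q j θ - J.eigenvalue q k θ| ≤ ε)
            (J.momentumCLM q θ (J.eigenbasis q θ k))‖ ^ 2 := by
  classical
  set v := J.eigenbasis q θ with hv
  have hrow : ∀ k, ∑ j ∈ Finset.univ.erase k,
      ‖phaseAverage t (J.eigenvalue q j θ - J.eigenvalue q k θ)‖ ^ 2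
            * ‖⟪v j, J.momentumCLM q θ (v k)⟫_ℂ‖ ^ 2
      ≤ 16 * R ^ 2 / (t ^ 2 * ε ^ 2) + ‖SpectralBasis.component v
            (Finset.univ.filter fun j => j ≠ k ∧ |J.eigenvalue q j θ - J.eigenvalue q k θ| ≤ ε)
            (J.momentumCLM q θ (v k))‖ ^ 2 := by
    intro k
    rw [SpectralBasis.norm_sq_component, Finset.sum_filter]
    have h1 : ‖J.momentumCLM q θ (v k)‖ ≤ 2 * R := by
      have := norm_momentumCLM_le hJ hR hb θ (v k)
      rwa [v.orthonormal.1 k, mul_one] at this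
    -- Non-resonant entries carry at most `(2/(|t|ε))²`, and Parseval with `‖A(θ)‖ ≤ 2R` sums the
    -- column.
    have h2 : 16 * R ^ 2 / (t ^ 2 * ε ^ 2) ≥ ∑ j, 4 / (t ^ 2 * ε ^ 2)
        * ‖⟪v j, J.momentumCLM q θ (v k)⟫_ℂ‖ ^ 2 := by
      rw [← Finset.mul_sum, v.sum_sq_norm_inner_right]
      calc 4 / (t ^ 2 * ε ^ 2) * ‖J.momentumCLM q θ (v k)‖ ^ 2
          ≤ 4 / (t ^ 2 * ε ^ 2) * (2 * R) ^ 2 := by gcongr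
        _ = _ := by ring
    refine le_trans ?_ (add_le_add_left h2 _)
    rw [← Finset.sum_add_distrib]
    refine (Finset.sum_le_sum fun j hj => ?_).trans
      (Finset.sum_le_univ_sum_of_nonneg fun j => by positivity)
    have hjk : j ≠ k := (Finset.mem_erase.1 hj).1
    by_cases hc : |J.eigenvalue q j θ - J.eigenvalue q k θ| ≤ ε
    · rw [if_pos ⟨hjk, hc⟩]
      have h3 := norm_phaseAverage_le_one ht (J.eigenvalue q j θ - J.eigenvalue q k θ)
      have h4 : ‖phaseAverage t (J.eigenvalue q j θ - J.eigenvalue q k θ)‖ ^ 2 ≤ 1 :=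
        pow_le_one₀ (norm_nonneg _) h3
      have h5 : 0 ≤ 4 / (t ^ 2 * ε ^ 2) * ‖⟪v j, J.momentumCLM q θ (v k)⟫_ℂ‖ ^ 2 := by positivity
      have h6 := mul_le_mul_of_nonneg_right h4 (sq_nonneg ‖⟪v j, J.momentumCLM q θ (v k)⟫_ℂ‖)
      linarith
    · rw [if_neg (fun h => hc h.2), add_zero]
      push Not at hc
      have ht' : 0 < |t| := abs_pos.2 ht
      have hne : J.eigenvalue q j θ - J.eigenvalue q k θ ≠ 0 := by
        intro h0
        rw [h0, abs_zero] at hc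
        linarith
      have h3 := norm_phaseAverage_le ht hne
      have h4 : 2 / (|t| * |J.eigenvalue q j θ - J.eigenvalue q k θ|) ≤ 2 / (|t| * ε) := by
        gcongr
      have h5 : ‖phaseAverage t (J.eigenvalue q j θ - J.eigenvalue q k θ)‖ ^ 2
          ≤ (2 / (|t| * ε)) ^ 2 := by
        have := h3.trans h4
        gcongr
      have h6 : (2 / (|t| * ε)) ^ 2 = 4 / (t ^ 2 * ε ^ 2) := by
        rw [div_pow, mul_pow, sq_abs]; norm_num
      rw [h6] at h5
      gcongr
  rw [hsNormSq_velocityFiber_sub_timeAverageFiber hJ hθ ht]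
  refine (Finset.sum_le_sum fun k _ => hrow k).trans (le_of_eq ?_)
  rw [Finset.sum_add_distrib, Finset.sum_const, Finset.card_univ, Fintype.card_fin, nsmul_eq_mul]
  ring

/-- The crude bound with the spectral gap of the fibre itself. -/
theorem hsNormSq_le_of_gap (hJ : J.IsPeriodic q) {R : ℝ} (hR : 1 ≤ R)
    (hb : J.IsRBounded R) {θ : ℝ} (hθ : Real.sin (2 * Real.pi * θ) ≠ 0) {t : ℝ} (ht : t ≠ 0)
    {ε : ℝ} (hε : 0 < ε) :
    hsNormSq (J.velocityFiber q θ - J.timeAverageFiber q t θ)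
      ≤ 16 * R ^ 2 * q / (t ^ 2 * ε ^ 2)
        + 4 * R ^ 2 * q * Real.sqrt (discBound R q * ε)
          * |Real.sin (2 * Real.pi * θ)| ^ (-(3 / 4) : ℝ) := by
  have hR0 : 0 < R := by linarith
  have hB := one_le_discBound hR q
  refine (hsNormSq_le_sum_component hJ hR0 hb hθ ht hε).trans (add_le_add_right ?_ _)
  set d := |Real.sin (2 * Real.pi * θ)| with hd
  have hd0 : 0 < d := abs_pos.2 hθ
  have hd1 : d ≤ 1 := Real.abs_sin_le_one _
  have hkey : ∀ k, ‖SpectralBasis.component (J.eigenbasis q θ)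
            (Finset.univ.filter fun j => j ≠ k ∧ |J.eigenvalue q j θ - J.eigenvalue q k θ| ≤ ε)
            (J.momentumCLM q θ (J.eigenbasis q θ k))‖ ^ 2
      ≤ 4 * R ^ 2 * (Real.sqrt (discBound R q * ε) * d ^ (-(3 / 4) : ℝ)) := by
    intro k
    -- For `d > Bε` there are no resonant pairs. Otherwise the trivial bound `4R²` is multiplied by
    -- `√(Bε) d^{-3/4} ≥ d^{-1/4} ≥ 1`. The exponent `1/2` would suffice here; `3/4` is used to
    -- share one weight with the refined bound.
    rcases le_or_gt d (discBound R q * ε) with h | h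
    · have h1 : ‖J.momentumCLM q θ (J.eigenbasis q θ k)‖ ≤ 2 * R := by
        have := norm_momentumCLM_le hJ hR0 hb θ (J.eigenbasis q θ k)
        rwa [(J.eigenbasis q θ).orthonormal.1 k, mul_one] at this
      have h2 := (SpectralBasis.norm_component_le (J.eigenbasis q θ)
        (Finset.univ.filter fun j => j ≠ k ∧ |J.eigenvalue q j θ - J.eigenvalue q k θ| ≤ ε)
        _).trans h1
      have h3 : 1 ≤ Real.sqrt (discBound R q * ε) * d ^ (-(3 / 4) : ℝ) := by
        have e1 : d ^ (1 / 2 : ℝ) ≤ Real.sqrt (discBound R q * ε) := by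
          rw [← Real.sqrt_eq_rpow]; exact Real.sqrt_le_sqrt h
        calc (1 : ℝ) ≤ d ^ (-(1 / 4) : ℝ) :=
              Real.one_le_rpow_of_pos_of_le_one_of_nonpos hd0 hd1 (by norm_num)
          _ = d ^ (1 / 2 : ℝ) * d ^ (-(3 / 4) : ℝ) := by
              rw [← Real.rpow_add hd0]; norm_num
          _ ≤ _ := by gcongr
      calc _ ≤ (2 * R) ^ 2 := by gcongr
        _ = 4 * R ^ 2 * 1 := by ring
        _ ≤ _ := by gcongr
    · have hempty : (Finset.univ.filter fun j =>
          j ≠ k ∧ |J.eigenvalue q j θ - J.eigenvalue q k θ| ≤ ε) = ∅ := by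
        refine Finset.filter_eq_empty_iff.2 fun j _ hj => ?_
        have h1 := sin_le_eigenvalue_gap hJ hR hb θ hj.1
        have h2 : discBound R q * |J.eigenvalue q j θ - J.eigenvalue q k θ|
            ≤ discBound R q * ε := by
          gcongr
          exact hj.2
        linarith
      rw [hempty, SpectralBasis.norm_sq_component, Finset.sum_empty]
      positivity
  refine (Finset.sum_le_sum fun k _ => hkey k).trans (le_of_eq ?_)
  rw [Finset.sum_const, Finset.card_univ, Fintype.card_fin, nsmul_eq_mul]
  ring

end JacobiMatrix
end

noncomputable section

open Matrix AddCircle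
open scoped InnerProductSpace ENNReal

/-! ### Floquet components -/

/-- The space `L²(ℝ/ℤ)`. -/
abbrev CircleL2 : Type := Lp ℂ 2 (haarAddCircle (T := (1 : ℝ)))

theorem sub_mul_injective (q : ℕ) [NeZero q] (n : ℤ) :
    Function.Injective fun p : ℤ => n - p * q := by
  intro m p h
  have hq : (q : ℤ) ≠ 0 := by exact_mod_cast NeZero.ne q
  have h' : m * (q : ℤ) = p * q := by simpa using h
  exact mul_right_cancel₀ hq h'

/-- The sampling of a sequence along `n - qℤ`. -/
def sampling (q : ℕ) [NeZero q] (n : ℤ) : Ell2 →L[ℂ] Ell2 :=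
  weightedPullback (fun _ => 1) ⟨1, by simp⟩ (fun p => n - p * q) (sub_mul_injective q n)

theorem sampling_apply (q : ℕ) [NeZero q] (n : ℤ) (φ : Ell2) (p : ℤ) :
    sampling q n φ p = φ (n - p * q) := by
  rw [sampling, weightedPullback_apply, one_mul]

/-- The function `∑_p φ_{n+pq} e^{-2πipθ}`. -/
def floquetComponent (q : ℕ) [NeZero q] (n : ℤ) : Ell2 →L[ℂ] CircleL2 :=
  ((fourierBasis (T := (1 : ℝ))).repr.symm : Ell2 →L[ℂ] CircleL2) ∘L sampling q n

theorem floquetTransform_eq (q : ℕ) [NeZero q] (φ : Ell2) (k : Fin q) :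
    floquetTransform q φ k = floquetComponent q (k : ℕ) φ := rfl

theorem repr_floquetComponent (q : ℕ) [NeZero q] (n : ℤ) (φ : Ell2) (p : ℤ) :
    (fourierBasis (T := (1 : ℝ))).repr (floquetComponent q n φ) p = φ (n - p * q) := by
  rw [floquetComponent, ContinuousLinearMap.comp_apply]
  erw [LinearIsometryEquiv.apply_symm_apply]
  exact sampling_apply q n φ p

theorem circleL2_ext {f g : CircleL2} (h : ∀ p, (fourierBasis (T := (1 : ℝ))).repr f p
    = (fourierBasis (T := (1 : ℝ))).repr g p) : f = g := by
  apply (fourierBasis (T := (1 : ℝ))).repr.injective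
  ext p
  exact h p

/-- Multiplication of square integrable functions by bounded ones. -/
def mulLp : Lp ℂ ∞ (haarAddCircle (T := (1 : ℝ))) →L[ℂ] CircleL2 →L[ℂ] CircleL2 :=
  (ContinuousLinearMap.mul ℂ ℂ).holderL haarAddCircle ∞ 2 2

theorem coeFn_mulLp (f : Lp ℂ ∞ (haarAddCircle (T := (1 : ℝ)))) (g : CircleL2) :
    mulLp f g =ᵐ[haarAddCircle] fun x => f x * g x :=
  (ContinuousLinearMap.mul ℂ ℂ).coeFn_holder (r := 2) f g

/-- A continuous function on the circle as a bounded function. -/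
def contLp : C(AddCircle (1 : ℝ), ℂ) →L[ℂ] Lp ℂ ∞ (haarAddCircle (T := (1 : ℝ))) :=
  ContinuousMap.toLp ∞ haarAddCircle ℂ

theorem coeFn_mulLp_contLp (f : C(AddCircle (1 : ℝ), ℂ)) (g : CircleL2) :
    mulLp (contLp f) g =ᵐ[haarAddCircle] fun x => f x * g x := by
  filter_upwards [coeFn_mulLp (contLp f) g, ContinuousMap.coeFn_toLp (p := ∞) (𝕜 := ℂ)
    haarAddCircle f] with x h1 h2
  rw [h1]
  congr 1

/-- With all integers `n` admitted as indices, the components at almost every point form a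
quasi-periodic sequence. On Fourier coefficients this is an index shift. -/
theorem floquetComponent_add_period (q : ℕ) [NeZero q] (n : ℤ) (φ : Ell2) :
    floquetComponent q (n + q) φ = mulLp (contLp (fourier 1)) (floquetComponent q n φ) := by
  apply circleL2_ext
  intro p
  rw [repr_floquetComponent, fourierBasis_repr, fourierCoeff_congr_ae (coeFn_mulLp_contLp _ _)]
  have h1 : fourierCoeff (fun x => fourier 1 x * floquetComponent q n φ x) p
      = fourierCoeff (floquetComponent q n φ : AddCircle (1 : ℝ) → ℂ) (p - 1) := by
    simp only [fourierCoeff, smul_eq_mul]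
    refine integral_congr_ae (Eventually.of_forall fun x => ?_)
    simp only
    rw [← mul_assoc, ← fourier_add, show -p + 1 = -(p - 1) by ring]
  rw [h1, ← fourierBasis_repr, repr_floquetComponent,
    show n + q - p * q = n - (p - 1) * (q : ℤ) by ring]

/-! ### Completeness of the Floquet components -/

theorem inner_delta (n : ℤ) (φ : Ell2) : ⟪(lp.single 2 n (1 : ℂ) : Ell2), φ⟫_ℂ = φ n := by
  rw [lp.inner_single_left]
  simp

theorem sampling_delta (q : ℕ) [NeZero q] (j k : Fin q) (p : ℤ) :
    sampling q (k : ℕ) (lp.single 2 ((j : ℕ) - p * q : ℤ) (1 : ℂ))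
      = if j = k then lp.single 2 p (1 : ℂ) else 0 := by
  ext r
  rw [sampling_apply, lp.single_apply]
  have hq : (q : ℤ) ≠ 0 := by exact_mod_cast NeZero.ne q
  split_ifs with h
  · subst h
    rw [lp.single_apply]
    by_cases hr : r = p
    · subst hr; simp
    · rw [Pi.single_eq_of_ne, Pi.single_eq_of_ne hr]
      intro h
      exact hr (sub_mul_injective q _ h)
  · rw [Pi.single_eq_of_ne]
    · rfl
    · intro h'
      apply h
      have h1 : ((j : ℕ) : ℤ) % q = ((k : ℕ) : ℤ) % q := by
        rw [show ((j : ℕ) : ℤ) = (k : ℕ) + (p - r) * q by linear_combination -h',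
          Int.add_mul_emod_self_right]
      rw [Int.emod_eq_of_lt (by positivity) (by exact_mod_cast j.2),
        Int.emod_eq_of_lt (by positivity) (by exact_mod_cast k.2)] at h1
      ext
      exact_mod_cast h1

theorem exists_fin_sub_mul (q : ℕ) [NeZero q] (n : ℤ) :
    ∃ (j : Fin q) (p : ℤ), n = (j : ℕ) - p * q := by
  have hq : (0 : ℤ) < q := by exact_mod_cast NeZero.pos q
  have h0 := Int.emod_nonneg n hq.ne'
  have h1 := Int.emod_lt_of_pos n hq
  refine ⟨⟨(n % q).toNat, by omega⟩, -(n / q), ?_⟩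
  simp only [Int.toNat_of_nonneg h0]
  have := Int.emod_add_mul_ediv n q
  linear_combination -this

theorem floquetComponent_delta (q : ℕ) [NeZero q] (j k : Fin q) (p : ℤ) :
    floquetComponent q (k : ℕ) (lp.single 2 ((j : ℕ) - p * q : ℤ) (1 : ℂ))
      = if j = k then fourierLp 2 p else 0 := by
  rw [floquetComponent, ContinuousLinearMap.comp_apply, sampling_delta]
  split_ifs
  · rw [← coe_fourierBasis]
    exact (fourierBasis (T := (1 : ℝ))).repr_symm_single p
  · exact map_zero _

theorem inner_floquetComponent (q : ℕ) [NeZero q] (n m : ℤ) (φ ψ : Ell2) :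
    ⟪floquetComponent q n φ, floquetComponent q m ψ⟫_ℂ = ⟪sampling q n φ, sampling q m ψ⟫_ℂ :=
  (fourierBasis (T := (1 : ℝ))).repr.symm.inner_map_map _ _

open ContinuousLinearMap in
-- Together with `floquetComponent_adjoint` this says that the Floquet transform is unitary; it is
-- tested on delta sequences, each of which lives in a single component.
theorem sum_adjoint_floquetComponent (q : ℕ) [NeZero q] (φ : Ell2) :
    ∑ k : Fin q, adjoint (floquetComponent q (k : ℕ)) (floquetComponent q (k : ℕ) φ) = φ := by
  ext n
  obtain ⟨j, p, rfl⟩ := exists_fin_sub_mul q n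
  rw [← inner_delta, inner_sum]
  simp only [adjoint_inner_right, inner_floquetComponent, sampling_delta]
  rw [Finset.sum_eq_single j]
  · rw [if_pos rfl, inner_delta, sampling_apply]
  · intro k _ hk
    rw [if_neg hk.symm, inner_zero_left]
  · simp

open ContinuousLinearMap in
theorem floquetComponent_adjoint (q : ℕ) [NeZero q] (j k : Fin q) (g : CircleL2) :
    floquetComponent q (j : ℕ) (adjoint (floquetComponent q (k : ℕ)) g)
      = if j = k then g else 0 := by
  apply circleL2_ext
  intro p
  rw [repr_floquetComponent, ← inner_delta, adjoint_inner_right, floquetComponent_delta]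
  split_ifs
  · rw [HilbertBasis.repr_apply_apply, coe_fourierBasis]
  · simp

theorem sum_norm_sq_floquetComponent (q : ℕ) [NeZero q] (φ : Ell2) :
    ∑ k : Fin q, ‖floquetComponent q (k : ℕ) φ‖ ^ 2 = ‖φ‖ ^ 2 := by
  have h := congrArg (fun ψ => ⟪φ, ψ⟫_ℂ) (sum_adjoint_floquetComponent q φ)
  simp only [inner_sum, ContinuousLinearMap.adjoint_inner_right, inner_self_eq_norm_sq_to_K] at h
  exact_mod_cast h

/-! ### Operators with given fibres -/

/-- The operator which acts in Floquet space as multiplication by a bounded matrix function. -/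
def fiberOp (q : ℕ) [NeZero q] (m : Fin q → Fin q → Lp ℂ ∞ (haarAddCircle (T := (1 : ℝ)))) :
    Ell2 →L[ℂ] Ell2 :=
  ∑ j : Fin q, ∑ k : Fin q, ContinuousLinearMap.adjoint (floquetComponent q (j : ℕ)) ∘L
    mulLp (m j k) ∘L floquetComponent q (k : ℕ)

theorem fiberOp_apply (q : ℕ) [NeZero q]
    (m : Fin q → Fin q → Lp ℂ ∞ (haarAddCircle (T := (1 : ℝ)))) (φ : Ell2) :
    fiberOp q m φ = ∑ j : Fin q, ContinuousLinearMap.adjoint (floquetComponent q (j : ℕ))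
      (∑ k : Fin q, mulLp (m j k) (floquetComponent q (k : ℕ) φ)) := by
  simp [fiberOp, map_sum]

theorem floquetComponent_fiberOp (q : ℕ) [NeZero q]
    (m : Fin q → Fin q → Lp ℂ ∞ (haarAddCircle (T := (1 : ℝ)))) (φ : Ell2) (j : Fin q) :
    floquetComponent q (j : ℕ) (fiberOp q m φ)
      = ∑ k : Fin q, mulLp (m j k) (floquetComponent q (k : ℕ) φ) := by
  rw [fiberOp_apply, map_sum]
  simp [floquetComponent_adjoint]

theorem ell2_ext_floquet (q : ℕ) [NeZero q] {φ ψ : Ell2}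
    (h : ∀ j : Fin q, floquetComponent q (j : ℕ) φ = floquetComponent q (j : ℕ) ψ) : φ = ψ := by
  rw [← sum_adjoint_floquetComponent q φ, ← sum_adjoint_floquetComponent q ψ]
  simp only [h]

/-- In Floquet space, `T` acts as multiplication by a matrix function on the circle. -/
def HasCircleFibers (q : ℕ) [NeZero q] (T : Ell2 →L[ℂ] Ell2)
    (M : AddCircle (1 : ℝ) → Matrix (Fin q) (Fin q) ℂ) : Prop :=
  ∀ φ : Ell2, ∀ j : Fin q, ∀ᵐ x ∂(haarAddCircle (T := (1 : ℝ))),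
    floquetComponent q (j : ℕ) (T φ) x = ∑ k : Fin q, M x j k * floquetComponent q (k : ℕ) φ x

theorem coeFn_sum_circleL2 {ι : Type*} (s : Finset ι) (f : ι → CircleL2) :
    ⇑(∑ i ∈ s, f i) =ᵐ[haarAddCircle] fun x => ∑ i ∈ s, f i x := by
  classical
  induction s using Finset.induction_on with
  | empty =>
    simp only [Finset.sum_empty]
    exact Lp.coeFn_zero ℂ 2 (haarAddCircle (T := (1 : ℝ)))
  | insert i s hi ih =>
    rw [Finset.sum_insert hi]
    filter_upwards [Lp.coeFn_add (f i) (∑ i ∈ s, f i), ih] with x h1 h2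
    rw [h1, Pi.add_apply, h2, Finset.sum_insert hi]

theorem hasCircleFibers_fiberOp (q : ℕ) [NeZero q]
    (m : Fin q → Fin q → Lp ℂ ∞ (haarAddCircle (T := (1 : ℝ))))
    (M : AddCircle (1 : ℝ) → Matrix (Fin q) (Fin q) ℂ)
    (h : ∀ j k, m j k =ᵐ[haarAddCircle] fun x => M x j k) :
    HasCircleFibers q (fiberOp q m) M := by
  intro φ j
  rw [floquetComponent_fiberOp]
  have h1 : ∀ᵐ x ∂(haarAddCircle (T := (1 : ℝ))), ∀ k : Fin q,
      mulLp (m j k) (floquetComponent q (k : ℕ) φ) x = M x j k * floquetComponent q (k : ℕ) φ x := by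
    refine ae_all_iff.2 fun k => ?_
    filter_upwards [coeFn_mulLp (m j k) (floquetComponent q (k : ℕ) φ), h j k] with x h1 h2
    rw [h1, h2]
  filter_upwards [coeFn_sum_circleL2 Finset.univ
    fun k : Fin q => mulLp (m j k) (floquetComponent q (k : ℕ) φ), h1] with x h2 h3
  rw [h2]
  exact Finset.sum_congr rfl fun k _ => h3 k

/-- Reduces operator identities on ℓ²(ℤ) to pointwise matrix identities, in particular the
multiplicativity of `contFiberHom`. -/
theorem HasCircleFibers.unique {q : ℕ} [NeZero q] {T S : Ell2 →L[ℂ] Ell2}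
    {M : AddCircle (1 : ℝ) → Matrix (Fin q) (Fin q) ℂ} (hT : HasCircleFibers q T M)
    (hS : HasCircleFibers q S M) : T = S := by
  ext1 φ
  refine ell2_ext_floquet q fun j => Lp.ext ?_
  filter_upwards [hT φ j, hS φ j] with x h1 h2
  rw [h1, h2]

theorem HasCircleFibers.sub {q : ℕ} [NeZero q] {T S : Ell2 →L[ℂ] Ell2}
    {M N : AddCircle (1 : ℝ) → Matrix (Fin q) (Fin q) ℂ} (hT : HasCircleFibers q T M)
    (hS : HasCircleFibers q S N) : HasCircleFibers q (T - S) (fun x => M x - N x) := by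
  intro φ j
  rw [_root_.sub_apply, map_sub]
  filter_upwards [hT φ j, hS φ j, Lp.coeFn_sub (floquetComponent q (j : ℕ) (T φ))
    (floquetComponent q (j : ℕ) (S φ))] with x h1 h2 h3
  rw [h3, Pi.sub_apply, h1, h2, ← Finset.sum_sub_distrib]
  exact Finset.sum_congr rfl fun k _ => by rw [Matrix.sub_apply, sub_mul]

theorem HasCircleFibers.mul {q : ℕ} [NeZero q] {T S : Ell2 →L[ℂ] Ell2}
    {M N : AddCircle (1 : ℝ) → Matrix (Fin q) (Fin q) ℂ} (hT : HasCircleFibers q T M)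
    (hS : HasCircleFibers q S N) : HasCircleFibers q (T * S) (fun x => M x * N x) := by
  intro φ j
  filter_upwards [hT (S φ) j, ae_all_iff.2 (hS φ)] with x h1 h2
  rw [show (T * S) φ = T (S φ) from rfl, h1]
  simp only [h2, Matrix.mul_apply, Finset.sum_mul, Finset.mul_sum]
  rw [Finset.sum_comm]
  exact Finset.sum_congr rfl fun _ _ => Finset.sum_congr rfl fun _ _ => by ring

theorem hasCircleFibers_one (q : ℕ) [NeZero q] :
    HasCircleFibers q 1 (fun _ => 1) := by
  intro φ j
  refine Eventually.of_forall fun x => ?_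
  simp [Matrix.one_apply]

end

/-! ### Continuous fibres and time averages in Banach algebras. -/

noncomputable section

open Matrix AddCircle
open scoped InnerProductSpace ENNReal

section ContinuousFibers

attribute [local instance] Matrix.linftyOpNormedRing Matrix.linftyOpNormedAlgebra

/-- The Banach algebra of `q × q` matrices. -/
def MatrixAlg (q : ℕ) : Type := Matrix (Fin q) (Fin q) ℂ

instance (q : ℕ) : NormedRing (MatrixAlg q) :=
  inferInstanceAs (NormedRing (Matrix (Fin q) (Fin q) ℂ))

instance (q : ℕ) : NormedAlgebra ℂ (MatrixAlg q) :=
  inferInstanceAs (NormedAlgebra ℂ (Matrix (Fin q) (Fin q) ℂ))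

instance (q : ℕ) : FiniteDimensional ℂ (MatrixAlg q) :=
  inferInstanceAs (FiniteDimensional ℂ (Matrix (Fin q) (Fin q) ℂ))

instance (q : ℕ) : CompleteSpace (MatrixAlg q) := FiniteDimensional.complete ℂ _

/-- An entry of a continuous matrix function. -/
def entryCLM {q : ℕ} (j k : Fin q) :
    C(AddCircle (1 : ℝ), MatrixAlg q) →L[ℂ] C(AddCircle (1 : ℝ), ℂ) :=
  ContinuousLinearMap.compLeftContinuous ℂ (AddCircle (1 : ℝ))
    (LinearMap.toContinuousLinearMap (E := MatrixAlg q) (Matrix.entryLinearMap ℂ ℂ j k))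

theorem entryCLM_apply {q : ℕ} (j k : Fin q)
    (M : C(AddCircle (1 : ℝ), MatrixAlg q)) (x : AddCircle (1 : ℝ)) :
    entryCLM j k M x = (M x : Matrix (Fin q) (Fin q) ℂ) j k := rfl

/-- The operator with a given continuous matrix function as fibres. -/
def contFiberOp (q : ℕ) [NeZero q] (M : C(AddCircle (1 : ℝ), MatrixAlg q)) :
    Ell2 →L[ℂ] Ell2 :=
  fiberOp q fun j k => contLp (entryCLM j k M)

theorem hasCircleFibers_contFiberOp (q : ℕ) [NeZero q]
    (M : C(AddCircle (1 : ℝ), MatrixAlg q)) :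
    HasCircleFibers q (contFiberOp q M) M := by
  refine hasCircleFibers_fiberOp q _ _ fun j k => ?_
  filter_upwards [ContinuousMap.coeFn_toLp (p := ∞) (𝕜 := ℂ)
    haarAddCircle (entryCLM j k M)] with x h
  exact h

theorem continuous_contFiberOp (q : ℕ) [NeZero q] : Continuous (contFiberOp q) := by
  unfold contFiberOp fiberOp
  refine continuous_finsetSum _ fun j _ => continuous_finsetSum _ fun k _ => ?_
  exact continuous_const.clm_comp
    ((mulLp.continuous.comp (contLp.continuous.comp (entryCLM j k).continuous)).clm_comp
      continuous_const)

/-- Decomposable operators with continuous fibres, as an algebra homomorphism. -/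
def contFiberHom (q : ℕ) [NeZero q] :
    C(AddCircle (1 : ℝ), MatrixAlg q) →ₐ[ℂ] (Ell2 →L[ℂ] Ell2) :=
  AlgHom.ofLinearMap
    { toFun := contFiberOp q
      map_add' := fun M N => by
        simp only [contFiberOp, fiberOp, map_add, ContinuousLinearMap.add_comp,
          ContinuousLinearMap.comp_add, Finset.sum_add_distrib]
      map_smul' := fun c M => by
        simp only [contFiberOp, fiberOp, map_smul, ContinuousLinearMap.smul_comp,
          ContinuousLinearMap.comp_smul, Finset.smul_sum, RingHom.id_apply] }
    ((hasCircleFibers_contFiberOp q 1).unique (hasCircleFibers_one q))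
    (fun M N => (hasCircleFibers_contFiberOp q (M * N)).unique
      ((hasCircleFibers_contFiberOp q M).mul (hasCircleFibers_contFiberOp q N)))

/-- The evaluation of continuous matrix functions at a point. -/
def evalHom (q : ℕ) (x : AddCircle (1 : ℝ)) :
    C(AddCircle (1 : ℝ), MatrixAlg q) →ₐ[ℂ] MatrixAlg q :=
  (Pi.evalAlgHom ℂ (fun _ : AddCircle (1 : ℝ) => MatrixAlg q) x).comp
    (ContinuousMap.coeFnAlgHom ℂ)

theorem continuous_evalHom (q : ℕ) (x : AddCircle (1 : ℝ)) : Continuous (evalHom q x) :=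
  ContinuousEvalConst.continuous_eval_const x

/-- The time average `t⁻¹ ∫₀ᵗ e^{isH} A e^{-isH} ds` in a Banach algebra. -/
def heisenbergAverage {𝔸 : Type*} [NormedRing 𝔸] [NormedAlgebra ℂ 𝔸] (H A : 𝔸) (t : ℝ) : 𝔸 :=
  (t : ℂ)⁻¹ • ∫ s in (0 : ℝ)..t, NormedSpace.exp ((Complex.I * s) • H) * A *
    NormedSpace.exp ((-(Complex.I * s)) • H)

theorem continuous_exp_smul_algebra {𝔸 : Type*} [NormedRing 𝔸] [NormedAlgebra ℂ 𝔸]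
    [CompleteSpace 𝔸] (H : 𝔸) {f : ℝ → ℂ} (hf : Continuous f) :
    Continuous fun s => NormedSpace.exp (f s • H) := by
  let +nondep : NormedAlgebra ℚ 𝔸 := NormedAlgebra.restrictScalars ℚ ℂ 𝔸
  exact NormedSpace.exp_continuous.comp (hf.smul continuous_const)

/-- A continuous homomorphism passes through exponentials and Bochner integrals. It is applied to
evaluation at a point and to `contFiberHom`, thus linking the average on ℓ²(ℤ) with the averages of
the fibres. -/
theorem map_heisenbergAverage {𝔸 𝔹 : Type*} [NormedRing 𝔸] [NormedAlgebra ℂ 𝔸] [CompleteSpace 𝔸]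
    [NormedRing 𝔹] [NormedAlgebra ℂ 𝔹] [CompleteSpace 𝔹] (f : 𝔸 →ₐ[ℂ] 𝔹) (hf : Continuous f)
    (H A : 𝔸) (t : ℝ) : f (heisenbergAverage H A t) = heisenbergAverage (f H) (f A) t := by
  let +nondep : NormedAlgebra ℚ 𝔸 := NormedAlgebra.restrictScalars ℚ ℂ 𝔸
  let +nondep : NormedAlgebra ℚ 𝔹 := NormedAlgebra.restrictScalars ℚ ℂ 𝔹
  let L : 𝔸 →L[ℂ] 𝔹 := ⟨f.toLinearMap, hf⟩
  have hc : Continuous fun s : ℝ => NormedSpace.exp ((Complex.I * s) • H) * A *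
      NormedSpace.exp ((-(Complex.I * s)) • H) :=
    ((continuous_exp_smul_algebra H (by fun_prop)).mul continuous_const).mul
      (continuous_exp_smul_algebra H (by fun_prop))
  have h1 := L.intervalIntegral_comp_comm (hc.intervalIntegrable (μ := volume) 0 t)
  have h2 : ∀ x, L x = f x := fun x => rfl
  simp only [h2, map_mul, NormedSpace.map_exp f hf, map_smul] at h1
  rw [heisenbergAverage, map_smul, ← h1, heisenbergAverage]

/-- Band matrices as a continuous function of the Floquet multiplier. -/
def bandFun (q : ℕ) (α β : ℂ) (a b : ℤ → ℝ) :
    C(AddCircle (1 : ℝ), MatrixAlg q) where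
  toFun x := bandMatrix q α β a b (fourier 1 x)
  continuous_toFun := by
    have hne : ∀ x : AddCircle (1 : ℝ), (fourier 1 x : ℂ) ≠ 0 := fun x => by
      rw [fourier_apply]; exact Circle.coe_ne_zero _
    have h1 : Continuous fun x : AddCircle (1 : ℝ) => (fourier 1 x : ℂ) := (fourier 1).continuous
    have h2 := h1.inv₀ hne
    refine continuous_matrix (n := Fin q) (m := Fin q) (R := ℂ) fun j k => ?_
    simp only [bandMatrix, Matrix.of_apply]
    refine ((((continuous_const).add continuous_const).add continuous_const).add ?_).add ?_
    · split_ifs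
      · exact continuous_const.mul h2
      · exact continuous_const
    · split_ifs
      · exact continuous_const.mul h1
      · exact continuous_const

theorem fourier_coe_eq_multiplier (θ : ℝ) :
    (fourier 1 (θ : AddCircle (1 : ℝ)) : ℂ) = multiplier θ := by
  rw [fourier_coe_apply, multiplier]
  congr 1
  push_cast
  ring

end ContinuousFibers

theorem periodic_sub_mul {f : ℤ → ℝ} {q : ℕ} (h : ∀ n, f (n + q) = f n) (n p : ℤ) :
    f (n - p * q) = f n :=
  (Function.Periodic.sub_int_mul_eq (c := (q : ℤ)) h p)

/-- At almost every point the sequence of Floquet components is the quasi-periodic extension of its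
first `q` terms, so the three-term operator acts through `bandMatrix_mulVec`. -/
theorem hasCircleFibers_band (q : ℕ) [NeZero q] (α β : ℂ) (a b : ℤ → ℝ)
    (ha : ∀ n, a (n + q) = a n) (hb : ∀ n, b (n + q) = b n) (T : Ell2 →L[ℂ] Ell2)
    (hT : ∀ φ n, T φ n = α * a n * φ (n + 1) + b n * φ n + β * a (n - 1) * φ (n - 1)) :
    HasCircleFibers q T (bandFun q α β a b) := by
  intro φ j
  have h1 : ∀ᵐ x ∂(haarAddCircle (T := (1 : ℝ))), ∀ n : ℤ,
      floquetComponent q (n + q) φ x = fourier 1 x * floquetComponent q n φ x := by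
    refine ae_all_iff.2 fun n => ?_
    rw [floquetComponent_add_period]
    exact coeFn_mulLp_contLp _ _
  have h2 : floquetComponent q (j : ℕ) (T φ)
      = (α * a (j : ℕ)) • floquetComponent q ((j : ℕ) + 1) φ
        + (b (j : ℕ) : ℂ) • floquetComponent q (j : ℕ) φ
        + (β * a ((j : ℕ) - 1)) • floquetComponent q ((j : ℕ) - 1) φ := by
    apply circleL2_ext
    intro p
    have e1 := periodic_sub_mul ha (j : ℕ) p
    have e2 := periodic_sub_mul hb (j : ℕ) p
    have e3 := periodic_sub_mul ha ((j : ℕ) - 1) p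
    rw [repr_floquetComponent, hT, map_add, map_add, map_smul, map_smul, map_smul]
    simp only [lp.coeFn_add, lp.coeFn_smul, Pi.add_apply, Pi.smul_apply, repr_floquetComponent,
      smul_eq_mul]
    rw [e1, e2, show ((j : ℕ) : ℤ) - p * q - 1 = (j : ℕ) - 1 - p * q by ring, e3,
      show ((j : ℕ) : ℤ) - p * q + 1 = (j : ℕ) + 1 - p * q by ring]
  have h3 : ⇑(floquetComponent q (j : ℕ) (T φ)) =ᵐ[haarAddCircle] fun x =>
      α * a (j : ℕ) * floquetComponent q ((j : ℕ) + 1) φ x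
        + b (j : ℕ) * floquetComponent q (j : ℕ) φ x
        + β * a ((j : ℕ) - 1) * floquetComponent q ((j : ℕ) - 1) φ x := by
    rw [h2]
    filter_upwards [Lp.coeFn_add ((α * a (j : ℕ)) • floquetComponent q ((j : ℕ) + 1) φ
        + (b (j : ℕ) : ℂ) • floquetComponent q (j : ℕ) φ)
        ((β * a ((j : ℕ) - 1)) • floquetComponent q ((j : ℕ) - 1) φ),
      Lp.coeFn_add ((α * a (j : ℕ)) • floquetComponent q ((j : ℕ) + 1) φ)
        ((b (j : ℕ) : ℂ) • floquetComponent q (j : ℕ) φ),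
      Lp.coeFn_smul (α * a (j : ℕ)) (floquetComponent q ((j : ℕ) + 1) φ),
      Lp.coeFn_smul (b (j : ℕ) : ℂ) (floquetComponent q (j : ℕ) φ),
      Lp.coeFn_smul (β * a ((j : ℕ) - 1)) (floquetComponent q ((j : ℕ) - 1) φ)]
      with x g1 g2 g3 g4 g5
    rw [g1, Pi.add_apply, g2, Pi.add_apply, g3, g4, g5]
    rfl
  filter_upwards [h1, h3] with x g1 g2
  have hz : (fourier 1 x : ℂ) ≠ 0 := by rw [fourier_apply]; exact Circle.coe_ne_zero _
  have g3 := eq_quasiExt q hz (fun k : Fin q => floquetComponent q (k : ℕ) φ x)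
    (fun n => floquetComponent q n φ x) g1 (fun k => rfl)
  have g4 := bandMatrix_mulVec q α β a b ha hz (fun k : Fin q => floquetComponent q (k : ℕ) φ x) j
  rw [← g3] at g4
  rw [g2, ← g4]
  rfl

end

/-! ### From the interval to the circle; measurability and existence of the velocity operator. -/

noncomputable section

open Matrix AddCircle
open scoped InnerProductSpace ENNReal

theorem measurePreserving_circle : MeasurePreserving (fun θ : ℝ => (θ : AddCircle (1 : ℝ)))
    (volume.restrict (Set.Ioc (0 : ℝ) 1)) haarAddCircle := by
  have h := AddCircle.measurePreserving_mk 1 0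
  rw [volume_eq_smul_haarAddCircle] at h
  simpa using h

theorem ae_coe_of_ae_circle {P : AddCircle (1 : ℝ) → Prop} (h : ∀ᵐ x ∂haarAddCircle, P x) :
    ∀ᵐ θ : ℝ ∂(volume.restrict (Set.Ioc (0 : ℝ) 1)), P θ :=
  measurePreserving_circle.quasiMeasurePreserving.ae h

theorem HasCircleFibers.hasFloquetFibers {q : ℕ} [NeZero q] {T : Ell2 →L[ℂ] Ell2}
    {M : AddCircle (1 : ℝ) → Matrix (Fin q) (Fin q) ℂ} {N : ℝ → Matrix (Fin q) (Fin q) ℂ}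
    (h : HasCircleFibers q T M) (hMN : ∀ θ ∈ Set.Ico (0 : ℝ) 1, M θ = N θ) :
    HasFloquetFibers q T N := by
  intro φ
  have h1 := ae_coe_of_ae_circle (ae_all_iff.2 (h φ))
  rw [← Measure.restrict_congr_set Ico_ae_eq_Ioc] at h1
  filter_upwards [h1, ae_restrict_mem measurableSet_Ico] with θ h2 h3 j
  rw [← hMN θ h3]
  exact h2 j

theorem countable_sin_eq_zero : {θ : ℝ | Real.sin (2 * Real.pi * θ) = 0}.Countable := by
  refine (Set.countable_range fun n : ℤ => (n : ℝ) / 2).mono fun θ hθ => ?_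
  obtain ⟨n, hn⟩ := Real.sin_eq_zero_iff.1 hθ
  refine ⟨n, ?_⟩
  have := Real.pi_pos
  simp only
  field_simp
  nlinarith

theorem ae_sin_ne_zero : ∀ᵐ θ : ℝ, Real.sin (2 * Real.pi * θ) ≠ 0 :=
  measure_eq_zero_iff_ae_notMem.1 (countable_sin_eq_zero.measure_zero volume)

theorem multiplier_sq_eq_one_of_sin {θ : ℝ} (h : Real.sin (2 * Real.pi * θ) = 0) :
    multiplier θ ^ 2 = 1 := by
  have h1 : multiplier θ = Complex.cos (2 * Real.pi * θ : ℝ)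
      + Complex.sin (2 * Real.pi * θ : ℝ) * Complex.I := by
    rw [multiplier, ← Complex.exp_mul_I]
    push_cast
    rfl
  rw [← Complex.ofReal_sin, ← Complex.ofReal_cos, h] at h1
  have h2 := Real.sin_sq_add_cos_sq (2 * Real.pi * θ)
  rw [h] at h2
  rw [h1]
  simp only [Complex.ofReal_zero, zero_mul, add_zero]
  have h3 : Real.cos (2 * Real.pi * θ) ^ 2 = 1 := by linarith
  exact_mod_cast h3

/-- The exceptional points are described on the circle as `fourier 1 x ^ 2 = 1`, a closed set, so
that the null set transfers through the measure-preserving quotient map. -/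
theorem ae_circle_of_sin_ne_zero {P : AddCircle (1 : ℝ) → Prop}
    (h : ∀ θ ∈ Set.Ico (0 : ℝ) 1, Real.sin (2 * Real.pi * θ) ≠ 0 → P θ) :
    ∀ᵐ x ∂haarAddCircle, P x := by
  have hm : MeasurableSet {x : AddCircle (1 : ℝ) | (fourier 1 x : ℂ) ^ 2 ≠ 1} :=
    (isOpen_ne_fun ((fourier 1).continuous.pow 2) continuous_const).measurableSet
  have h1 : ∀ᵐ x ∂(haarAddCircle (T := (1 : ℝ))), (fourier 1 x : ℂ) ^ 2 ≠ 1 := by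
    rw [← measurePreserving_circle.map_eq,
      ae_map_iff measurePreserving_circle.measurable.aemeasurable hm]
    filter_upwards [ae_restrict_of_ae ae_sin_ne_zero] with θ hθ h2
    rw [fourier_coe_eq_multiplier] at h2
    exact hθ (sin_eq_zero_of_multiplier_sq h2)
  filter_upwards [h1] with x hx
  obtain ⟨θ, hθ, rfl⟩ : ∃ θ ∈ Set.Ico (0 : ℝ) 1, (θ : AddCircle (1 : ℝ)) = x := by
    refine ⟨(equivIco 1 0 x : ℝ), ?_, ?_⟩
    · have := (equivIco 1 0 x).2
      simpa only [zero_add] using this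
    · exact (equivIco 1 0).symm_apply_apply x
  refine h θ hθ fun h0 => hx ?_
  rw [fourier_coe_eq_multiplier]
  exact multiplier_sq_eq_one_of_sin h0

namespace JacobiMatrix

variable {J : JacobiMatrix} {q : ℕ} [NeZero q]

section TimeAverage

attribute [local instance] Matrix.linftyOpNormedRing Matrix.linftyOpNormedAlgebra

/-- The time average in Floquet space, as a continuous function on the circle. -/
def averageFun (J : JacobiMatrix) (q : ℕ) (t : ℝ) :
    C(AddCircle (1 : ℝ), MatrixAlg q) :=
  heisenbergAverage (bandFun q 1 1 J.a J.b) (bandFun q Complex.I (-Complex.I) J.a fun _ => 0) t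

theorem averageFun_coe (J : JacobiMatrix) (q : ℕ) (t θ : ℝ) :
    J.averageFun q t θ = J.timeAverageFiber q t θ := by
  have h1 := map_heisenbergAverage (evalHom q (θ : AddCircle (1 : ℝ)))
    (continuous_evalHom q _) (bandFun q 1 1 J.a J.b)
    (bandFun q Complex.I (-Complex.I) J.a fun _ => 0) t
  have e1 : evalHom q (θ : AddCircle (1 : ℝ)) (bandFun q 1 1 J.a J.b) = J.floquet q θ := by
    rw [floquet_eq_bandMatrix, ← fourier_coe_eq_multiplier]
    rfl
  have e2 : evalHom q (θ : AddCircle (1 : ℝ)) (bandFun q Complex.I (-Complex.I) J.a fun _ => 0)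
      = J.floquetMomentum q θ := by
    rw [floquetMomentum_eq_bandMatrix, ← fourier_coe_eq_multiplier]
    rfl
  rw [e1, e2] at h1
  have h2 : J.averageFun q t θ =
      heisenbergAverage (𝔸 := MatrixAlg q) (J.floquet q θ) (J.floquetMomentum q θ) t := h1
  rw [h2]
  refine Matrix.ext fun j k => ?_
  let L : MatrixAlg q →L[ℂ] ℂ :=
    LinearMap.toContinuousLinearMap (E := MatrixAlg q) (Matrix.entryLinearMap ℂ ℂ j k)
  have hc : Continuous fun s : ℝ =>
      NormedSpace.exp ((Complex.I * s) • (show MatrixAlg q from J.floquet q θ))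
      * (show MatrixAlg q from J.floquetMomentum q θ)
      * NormedSpace.exp ((-(Complex.I * s)) • (show MatrixAlg q from J.floquet q θ)) :=
    ((continuous_exp_smul_algebra (𝔸 := MatrixAlg q) (J.floquet q θ) (by fun_prop)).mul
      continuous_const).mul
      (continuous_exp_smul_algebra (𝔸 := MatrixAlg q) (J.floquet q θ) (by fun_prop))
  change L ((t : ℂ)⁻¹ • _) = _
  rw [map_smul, ← L.intervalIntegral_comp_comm (hc.intervalIntegrable (μ := volume) 0 t)]
  rfl

/-- Uniqueness identifies `J.op` and `J.momentum` with images under `contFiberHom`, which then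
carries the average formed in the algebra of continuous matrix functions to the operator average. -/
theorem hasCircleFibers_timeAverage (hJ : J.IsPeriodic q) (t : ℝ) :
    HasCircleFibers q (J.timeAverage t) (J.averageFun q t) := by
  have h1 : contFiberOp q (bandFun q 1 1 J.a J.b) = J.op :=
    (hasCircleFibers_contFiberOp q _).unique
      (hasCircleFibers_band q 1 1 J.a J.b (fun n => (hJ n).1) (fun n => (hJ n).2) J.op
        fun φ n => by rw [op_apply]; ring)
  have h2 : contFiberOp q (bandFun q Complex.I (-Complex.I) J.a fun _ => 0) = J.momentum :=
    (hasCircleFibers_contFiberOp q _).unique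
      (hasCircleFibers_band q _ _ J.a _ (fun n => (hJ n).1) (fun n => rfl) J.momentum
        fun φ n => by rw [momentum_apply]; push_cast; ring)
  have h3 := map_heisenbergAverage (contFiberHom q) (continuous_contFiberOp q)
    (bandFun q 1 1 J.a J.b) (bandFun q Complex.I (-Complex.I) J.a fun _ => 0) t
  have h4 : contFiberOp q (J.averageFun q t) = J.timeAverage t := by
    refine Eq.trans h3 ?_
    change heisenbergAverage (contFiberOp q _) (contFiberOp q _) t = _
    rw [h1, h2]
    rfl
  rw [← h4]
  exact hasCircleFibers_contFiberOp q _

theorem continuous_timeAverageFiber (J : JacobiMatrix) (q : ℕ) (t : ℝ) (j k : Fin q) :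
    Continuous fun θ => J.timeAverageFiber q t θ j k := by
  have h : Continuous fun θ : ℝ => J.averageFun q t (θ : AddCircle (1 : ℝ)) :=
    (J.averageFun q t).continuous.comp (AddCircle.continuous_mk' 1)
  simp only [averageFun_coe] at h
  exact h.matrix_elem j k

end TimeAverage

/-- The Hilbert-Schmidt distance of the time average to the velocity tends to zero. -/
theorem tendsto_timeAverageFiber (hJ : J.IsPeriodic q) {θ : ℝ}
    (hθ : Real.sin (2 * Real.pi * θ) ≠ 0) (j k : Fin q) :
    Tendsto (fun N : ℕ => J.timeAverageFiber q (N + 1 : ℕ) θ j k) atTop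
      (nhds (J.velocityFiber q θ j k)) := by
  have hph : ∀ μ : ℝ, μ ≠ 0 →
      Tendsto (fun N : ℕ => ‖phaseAverage ((N + 1 : ℕ) : ℝ) μ‖ ^ 2) atTop (nhds 0) := by
    intro μ hμ
    have h1 : Tendsto (fun N : ℕ => ‖phaseAverage ((N + 1 : ℕ) : ℝ) μ‖) atTop (nhds 0) := by
      refine squeeze_zero (fun N => norm_nonneg _) (g := fun N : ℕ => 2 / |μ| / ((N + 1 : ℕ) : ℝ))
        (fun N => ?_) ?_
      · refine (norm_phaseAverage_le (by positivity) hμ).trans (le_of_eq ?_)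
        rw [abs_of_pos (by positivity)]
        field_simp
      · exact (tendsto_const_div_atTop_nhds_zero_nat (2 / |μ|)).comp (tendsto_add_atTop_nat 1)
    simpa using h1.pow 2
  have h1 : Tendsto (fun N : ℕ => hsNormSq
      (J.velocityFiber q θ - J.timeAverageFiber q ((N + 1 : ℕ) : ℝ) θ)) atTop (nhds 0) := by
    have h2 : Tendsto (fun N : ℕ => ∑ k, ∑ j ∈ Finset.univ.erase k,
          ‖phaseAverage ((N + 1 : ℕ) : ℝ) (J.eigenvalue q j θ - J.eigenvalue q k θ)‖ ^ 2
            * ‖⟪J.eigenbasis q θ j, J.momentumCLM q θ (J.eigenbasis q θ k)⟫_ℂ‖ ^ 2)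
        atTop (nhds (∑ k, ∑ j ∈ Finset.univ.erase k, 0
            * ‖⟪J.eigenbasis q θ j, J.momentumCLM q θ (J.eigenbasis q θ k)⟫_ℂ‖ ^ 2)) := by
      refine tendsto_finsetSum _ fun k _ => tendsto_finsetSum _ fun j hj => ?_
      refine (hph _ ?_).mul_const _
      exact sub_ne_zero.2 (eigenvalue_ne hJ hθ (Finset.mem_erase.1 hj).1)
    simp only [zero_mul, Finset.sum_const_zero] at h2
    refine h2.congr fun N => ?_
    rw [hsNormSq_velocityFiber_sub_timeAverageFiber hJ hθ (by positivity)]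
  rw [tendsto_iff_norm_sub_tendsto_zero]
  have h3 := h1.sqrt
  rw [Real.sqrt_zero] at h3
  refine squeeze_zero (fun N => norm_nonneg _) (fun N => ?_) h3
  apply Real.le_sqrt_of_sq_le
  rw [norm_sub_rev, hsNormSq, ← Matrix.sub_apply]
  refine le_trans ?_ (Finset.single_le_sum (f := fun j => ∑ k, ‖(J.velocityFiber q θ
    - J.timeAverageFiber q ((N + 1 : ℕ) : ℝ) θ) j k‖ ^ 2) (fun j _ => by positivity)
    (Finset.mem_univ j))
  exact Finset.single_le_sum (f := fun k => ‖(J.velocityFiber q θ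
    - J.timeAverageFiber q ((N + 1 : ℕ) : ℝ) θ) j k‖ ^ 2) (fun k _ => by positivity)
    (Finset.mem_univ k)

/-- The crude bound on the distance of the time average to the velocity. -/
theorem hsNormSq_sub_le (hJ : J.IsPeriodic q) {R : ℝ} (hR : 0 < R)
    (hb : J.IsRBounded R) {θ : ℝ} (hθ : Real.sin (2 * Real.pi * θ) ≠ 0) {t : ℝ} (ht : t ≠ 0) :
    hsNormSq (J.velocityFiber q θ - J.timeAverageFiber q t θ) ≤ 4 * R ^ 2 * q := by
  rw [hsNormSq_velocityFiber_sub_timeAverageFiber hJ hθ ht]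
  have h : ∀ k, ∑ j ∈ Finset.univ.erase k,
          ‖phaseAverage t (J.eigenvalue q j θ - J.eigenvalue q k θ)‖ ^ 2
            * ‖⟪J.eigenbasis q θ j, J.momentumCLM q θ (J.eigenbasis q θ k)⟫_ℂ‖ ^ 2
      ≤ 4 * R ^ 2 := by
    intro k
    have h1 : ‖J.momentumCLM q θ (J.eigenbasis q θ k)‖ ≤ 2 * R := by
      have := norm_momentumCLM_le hJ hR hb θ (J.eigenbasis q θ k)
      rwa [(J.eigenbasis q θ).orthonormal.1 k, mul_one] at this
    calc _ ≤ ∑ j ∈ Finset.univ.erase k,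
            ‖⟪J.eigenbasis q θ j, J.momentumCLM q θ (J.eigenbasis q θ k)⟫_ℂ‖ ^ 2 := by
          refine Finset.sum_le_sum fun j _ => mul_le_of_le_one_left (by positivity) ?_
          exact pow_le_one₀ (norm_nonneg _) (norm_phaseAverage_le_one ht _)
      _ ≤ ∑ j, ‖⟪J.eigenbasis q θ j, J.momentumCLM q θ (J.eigenbasis q θ k)⟫_ℂ‖ ^ 2 :=
          Finset.sum_le_univ_sum_of_nonneg fun j => by positivity
      _ = ‖J.momentumCLM q θ (J.eigenbasis q θ k)‖ ^ 2 :=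
          (J.eigenbasis q θ).sum_sq_norm_inner_right _
      _ ≤ (2 * R) ^ 2 := by gcongr
      _ = _ := by ring
  refine (Finset.sum_le_sum fun k _ => h k).trans (le_of_eq ?_)
  rw [Finset.sum_const, Finset.card_univ, Fintype.card_fin, nsmul_eq_mul]
  ring

omit [NeZero q] in
theorem hsNormSq_nonneg (M : Matrix (Fin q) (Fin q) ℂ) : 0 ≤ hsNormSq M :=
  Finset.sum_nonneg fun _ _ => Finset.sum_nonneg fun _ _ => sq_nonneg _

omit [NeZero q] in
theorem norm_entry_sq_le_hsNormSq (M : Matrix (Fin q) (Fin q) ℂ) (j k : Fin q) :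
    ‖M j k‖ ^ 2 ≤ hsNormSq M := by
  refine le_trans ?_ (Finset.single_le_sum (f := fun j => ∑ k, ‖M j k‖ ^ 2)
    (fun j _ => by positivity) (Finset.mem_univ j))
  exact Finset.single_le_sum (f := fun k => ‖M j k‖ ^ 2) (fun k _ => by positivity)
    (Finset.mem_univ k)

/-- Comparison with the average at time 1, which is continuous on the compact circle; no separate
bound on the derivatives of the eigenvalues is needed. -/
theorem exists_norm_velocityFiber_le (hJ : J.IsPeriodic q) {R : ℝ} (hR : 0 < R)
    (hb : J.IsRBounded R) (j k : Fin q) :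
    ∃ C : ℝ, ∀ θ : ℝ, Real.sin (2 * Real.pi * θ) ≠ 0 → ‖J.velocityFiber q θ j k‖ ≤ C := by
  refine ⟨Real.sqrt (4 * R ^ 2 * q) + ‖entryCLM j k (J.averageFun q 1)‖, fun θ hθ => ?_⟩
  have h1 := (norm_entry_sq_le_hsNormSq _ j k).trans (hsNormSq_sub_le hJ hR hb hθ one_ne_zero)
  have h2 := Real.le_sqrt_of_sq_le h1
  have h3 := (entryCLM j k (J.averageFun q 1)).norm_coe_le_norm θ
  rw [entryCLM_apply, averageFun_coe] at h3
  rw [Matrix.sub_apply] at h2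
  calc ‖J.velocityFiber q θ j k‖
      = ‖J.velocityFiber q θ j k - J.timeAverageFiber q 1 θ j k
        + J.timeAverageFiber q 1 θ j k‖ := by rw [sub_add_cancel]
    _ ≤ _ := (norm_add_le _ _).trans (add_le_add h2 h3)

/-- The velocity fibre as a function on the circle. -/
def velocityFun (J : JacobiMatrix) (q : ℕ) :
    AddCircle (1 : ℝ) → Matrix (Fin q) (Fin q) ℂ :=
  AddCircle.liftIco 1 0 (J.velocityFiber q)

omit [NeZero q] in
theorem velocityFun_coe (J : JacobiMatrix) {θ : ℝ} (hθ : θ ∈ Set.Ico (0 : ℝ) 1) :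
    J.velocityFun q θ = J.velocityFiber q θ :=
  AddCircle.liftIco_coe_apply (by simpa using hθ)

/-- Measurability comes from the pointwise limit of continuous averages at the times `N + 1`, not
from a measurable choice of eigenvectors. -/
theorem memLp_velocityFun (hJ : J.IsPeriodic q) {R : ℝ} (hR : 0 < R)
    (hb : J.IsRBounded R) (j k : Fin q) :
    MemLp (fun x => J.velocityFun q x j k) ∞ haarAddCircle := by
  obtain ⟨C, hC⟩ := exists_norm_velocityFiber_le hJ hR hb j k
  refine memLp_top_of_bound ?_ C (ae_circle_of_sin_ne_zero fun θ h1 h2 => ?_)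
  · refine aestronglyMeasurable_of_tendsto_ae atTop
      (f := fun (N : ℕ) x => entryCLM j k (J.averageFun q (N + 1 : ℕ)) x)
      (fun N => (entryCLM j k _).continuous.aestronglyMeasurable)
      (ae_circle_of_sin_ne_zero fun θ h1 h2 => ?_)
    simp only [entryCLM_apply, averageFun_coe, velocityFun_coe J h1]
    exact tendsto_timeAverageFiber hJ h2 j k
  · rw [velocityFun_coe J h1]
    exact hC θ h2

theorem exists_hasCircleFibers_velocityFun (hJ : J.IsPeriodic q) {R : ℝ} (hR : 0 < R)
    (hb : J.IsRBounded R) :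
    ∃ Q : Ell2 →L[ℂ] Ell2, HasCircleFibers q Q (J.velocityFun q) :=
  ⟨_, hasCircleFibers_fiberOp q (fun j k => (memLp_velocityFun hJ hR hb j k).toLp) _
    fun _ _ => MemLp.coeFn_toLp _⟩

theorem aestronglyMeasurable_velocityFiber (hJ : J.IsPeriodic q) (j k : Fin q) :
    AEStronglyMeasurable (fun θ => J.velocityFiber q θ j k) volume := by
  refine aestronglyMeasurable_of_tendsto_ae atTop
    (f := fun (N : ℕ) θ => J.timeAverageFiber q (N + 1 : ℕ) θ j k)
    (fun N => (continuous_timeAverageFiber J q _ j k).aestronglyMeasurable) ?_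
  filter_upwards [ae_sin_ne_zero] with θ hθ
  exact tendsto_timeAverageFiber hJ hθ j k

theorem intervalIntegrable_hsNormSq (hJ : J.IsPeriodic q) {R : ℝ} (hR : 0 < R)
    (hb : J.IsRBounded R) {t : ℝ} (ht : t ≠ 0) :
    IntervalIntegrable (fun θ => hsNormSq (J.velocityFiber q θ - J.timeAverageFiber q t θ))
      volume 0 1 := by
  rw [intervalIntegrable_iff]
  have hm : AEStronglyMeasurable
      (fun θ => hsNormSq (J.velocityFiber q θ - J.timeAverageFiber q t θ)) volume := by
    unfold hsNormSq
    refine Finset.aestronglyMeasurable_fun_sum _ fun j _ =>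
      Finset.aestronglyMeasurable_fun_sum _ fun k _ => ?_
    simp only [Matrix.sub_apply]
    exact ((aestronglyMeasurable_velocityFiber hJ j k).sub
      (continuous_timeAverageFiber J q t j k).aestronglyMeasurable).norm.pow 2
  refine Measure.integrableOn_of_bounded (M := 4 * R ^ 2 * q) (by simp) hm ?_
  filter_upwards [ae_restrict_of_ae ae_sin_ne_zero] with θ hθ
  rw [Real.norm_of_nonneg (hsNormSq_nonneg _)]
  exact hsNormSq_sub_le hJ hR hb hθ ht

end JacobiMatrix

/-! ### The ℓ¹ → ℓ² norm in terms of fibres. -/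

theorem norm_sq_circleL2 (g : CircleL2) :
    ‖g‖ ^ 2 = ∫ θ in (0 : ℝ)..1, ‖g (θ : AddCircle (1 : ℝ))‖ ^ 2 := by
  have h1 : ‖g‖ ^ 2 = ∫ x, ‖g x‖ ^ 2 ∂haarAddCircle := by
    have h2 := congrArg RCLike.re (@L2.inner_def (AddCircle (1 : ℝ)) ℂ ℂ _ _ _ _ _ g g)
    rw [← integral_re] at h2
    · simp only [← norm_sq_eq_re_inner] at h2
      exact h2
    · exact L2.integrable_inner g g
  have h3 := integral_map (f := fun x => ‖g x‖ ^ 2)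
    measurePreserving_circle.measurable.aemeasurable (by
      rw [measurePreserving_circle.map_eq]
      exact (Lp.aestronglyMeasurable g).norm.pow 2)
  rw [measurePreserving_circle.map_eq] at h3
  rw [h1, intervalIntegral.integral_of_le zero_le_one, h3]

theorem integrable_norm_sq_circleL2 (g : CircleL2) :
    IntervalIntegrable (fun θ : ℝ => ‖g (θ : AddCircle (1 : ℝ))‖ ^ 2) volume 0 1 := by
  rw [intervalIntegrable_iff_integrableOn_Ioc_of_le zero_le_one]
  have h1 : Integrable (fun x => ‖g x‖ ^ 2) haarAddCircle :=
    (memLp_two_iff_integrable_sq_norm (Lp.aestronglyMeasurable g)).1 (Lp.memLp g)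
  exact measurePreserving_circle.integrable_comp_of_integrable h1

/-- The transform of a delta sequence is a character times a coordinate vector, so its image has at
almost every `θ` the norm of one column of `M θ`, at most the Hilbert–Schmidt norm. -/
theorem norm_apply_delta_sq_le {q : ℕ} [NeZero q] {T : Ell2 →L[ℂ] Ell2}
    {M : ℝ → Matrix (Fin q) (Fin q) ℂ} (hT : HasFloquetFibers q T M)
    (hM : IntervalIntegrable (fun θ => hsNormSq (M θ)) volume 0 1) (n : ℤ) :
    ‖T (lp.single 2 n 1)‖ ^ 2 ≤ ∫ θ in (0 : ℝ)..1, hsNormSq (M θ) := by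
  obtain ⟨k, p, rfl⟩ := exists_fin_sub_mul q n
  set φ : Ell2 := lp.single 2 ((k : ℕ) - p * q : ℤ) 1 with hφ
  rw [← sum_norm_sq_floquetComponent q]
  simp only [norm_sq_circleL2]
  rw [← intervalIntegral.integral_finsetSum fun j _ => integrable_norm_sq_circleL2 _]
  refine intervalIntegral.integral_mono_ae_restrict zero_le_one
    ?_ hM ?_
  · have := IntervalIntegrable.sum (μ := volume) (a := 0) (b := 1) Finset.univ
      (f := fun (j : Fin q) (θ : ℝ) =>
        ‖floquetComponent q (j : ℕ) (T φ) (θ : AddCircle (1 : ℝ))‖ ^ 2)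
      fun j _ => integrable_norm_sq_circleL2 _
    simpa only [Finset.sum_fn] using this
  have h1 := hT φ
  rw [Measure.restrict_congr_set Ico_ae_eq_Ioc] at h1
  rw [Measure.restrict_congr_set Ioc_ae_eq_Icc.symm]
  have h2 : ∀ᵐ θ : ℝ ∂(volume.restrict (Set.Ioc (0 : ℝ) 1)), ∀ i : Fin q,
      ‖floquetComponent q (i : ℕ) φ (θ : AddCircle (1 : ℝ))‖ = if k = i then 1 else 0 := by
    refine ae_all_iff.2 fun i => ?_
    rw [hφ, floquetComponent_delta]
    split_ifs
    · filter_upwards [ae_coe_of_ae_circle (coeFn_fourierLp (T := 1) 2 p)] with θ h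
      rw [h, fourier_apply, Circle.norm_coe]
    · filter_upwards [ae_coe_of_ae_circle (Lp.coeFn_zero ℂ 2 haarAddCircle)] with θ h
      rw [h, Pi.zero_apply, norm_zero]
  filter_upwards [h1, h2] with θ h3 h4
  refine Finset.sum_le_sum fun j _ => ?_
  have h5 := h3 j
  rw [floquetTransform_eq, Finset.sum_eq_single k] at h5
  · rw [h5, norm_mul, floquetTransform_eq, h4, if_pos rfl, mul_one]
    exact Finset.single_le_sum (f := fun k => ‖M θ j k‖ ^ 2) (fun k _ => by positivity)
      (Finset.mem_univ k)
  · intro i _ hi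
    have := h4 i
    rw [if_neg hi.symm, norm_eq_zero] at this
    rw [floquetTransform_eq, this, mul_zero]
  · simp

/-- The `ℓ¹ → ℓ²` norm is controlled by the Hilbert-Schmidt norm of the fibres. -/
theorem normOneTwo_sq_le {q : ℕ} [NeZero q] {T : Ell2 →L[ℂ] Ell2}
    {M : ℝ → Matrix (Fin q) (Fin q) ℂ} (hT : HasFloquetFibers q T M)
    (hM : IntervalIntegrable (fun θ => hsNormSq (M θ)) volume 0 1) :
    normOneTwo T ^ 2 ≤ ∫ θ in (0 : ℝ)..1, hsNormSq (M θ) := by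
  set C := ∫ θ in (0 : ℝ)..1, hsNormSq (M θ) with hC
  have hC0 : 0 ≤ C := (sq_nonneg _).trans (norm_apply_delta_sq_le hT hM 0)
  have h1 : ∀ n : ℤ, ‖T (lp.single 2 n 1)‖ ≤ Real.sqrt C := fun n =>
    Real.le_sqrt_of_sq_le (norm_apply_delta_sq_le hT hM n)
  have h2 : normOneTwo T ≤ Real.sqrt C := by
    refine ContinuousLinearMap.opNorm_le_bound _ (Real.sqrt_nonneg _) fun φ => ?_
    have h3 := (lp.hasSum_single ENNReal.one_ne_top φ).mapL (T ∘L ell1ToEll2)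
    have h4 : ∀ n, (T ∘L ell1ToEll2) (lp.single 1 n (φ n)) = φ n • T (lp.single 2 n 1) := by
      intro n
      rw [ContinuousLinearMap.comp_apply, ← map_smul]
      congr 1
      ext m
      rw [ell1ToEll2_apply, lp.coeFn_smul, Pi.smul_apply, lp.single_apply, lp.single_apply]
      by_cases h : m = n
      · subst h; simp
      · simp [h]
    simp only [h4] at h3
    have h5 : HasSum (fun n => ‖φ n‖ * Real.sqrt C) (‖φ‖ * Real.sqrt C) := by
      have h := lp.hasSum_norm (p := 1) (by norm_num) φ
      simp only [ENNReal.toReal_one, Real.rpow_one] at h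
      exact h.mul_right _
    rw [mul_comm]
    refine h3.norm_le_of_bounded h5 fun n => ?_
    rw [norm_smul]
    exact mul_le_mul_of_nonneg_left (h1 n) (norm_nonneg _)
  calc normOneTwo T ^ 2 ≤ Real.sqrt C ^ 2 := by
        have : 0 ≤ normOneTwo T := norm_nonneg _
        gcongr
    _ = C := Real.sq_sqrt hC0

end

noncomputable section

open scoped InnerProductSpace

/-! ### The integrable weight `|sin 2πθ|^{-3/4}` -/

/-- The weight `|sin 2πθ|^{-3/4}`. -/
def sineWeight (θ : ℝ) : ℝ := |Real.sin (2 * Real.pi * θ)| ^ (-(3 / 4) : ℝ)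

theorem sineWeight_nonneg (θ : ℝ) : 0 ≤ sineWeight θ := by
  unfold sineWeight
  positivity

theorem sineWeight_half_sub (θ : ℝ) : sineWeight (1 / 2 - θ) = sineWeight θ := by
  rw [sineWeight, sineWeight, show 2 * Real.pi * (1 / 2 - θ) = Real.pi - 2 * Real.pi * θ by ring,
    Real.sin_pi_sub]

theorem sineWeight_periodic : Function.Periodic sineWeight (1 / 2) := by
  intro θ
  rw [sineWeight, sineWeight, show 2 * Real.pi * (θ + 1 / 2) = 2 * Real.pi * θ + Real.pi by ring,
    Real.sin_add_pi, abs_neg]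

/-- On `(0, 1/4]` Jordan's inequality compares the weight with `θ^{-3/4}`; reflection and the period
`1/2` give the rest. -/
theorem intervalIntegrable_sineWeight (a b : ℝ) : IntervalIntegrable sineWeight volume a b := by
  have hm : Measurable sineWeight := by
    unfold sineWeight
    exact (((Real.continuous_sin.comp (continuous_const.mul continuous_id)).abs).measurable).pow_const _
  have h1 : IntervalIntegrable sineWeight volume 0 (1 / 4) := by
    refine (intervalIntegral.intervalIntegrable_rpow' (r := -(3 / 4)) (by norm_num)).mono_fun
      hm.aestronglyMeasurable ?_
    rw [Set.uIoc_of_le (by norm_num)]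
    filter_upwards [ae_restrict_mem measurableSet_Ioc] with θ hθ
    have hπ := Real.pi_pos
    have h2 := Real.mul_le_sin (x := 2 * Real.pi * θ) (by nlinarith [hθ.1]) (by nlinarith [hθ.2])
    have h3 : 2 / Real.pi * (2 * Real.pi * θ) = 4 * θ := by field_simp; ring
    rw [h3] at h2
    have h4 : θ ≤ |Real.sin (2 * Real.pi * θ)| := by
      refine le_trans ?_ (le_abs_self _)
      linarith [hθ.1]
    rw [Real.norm_of_nonneg (sineWeight_nonneg θ),
      Real.norm_of_nonneg (Real.rpow_nonneg hθ.1.le _)]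
    exact Real.rpow_le_rpow_of_nonpos hθ.1 h4 (by norm_num)
  have h2 : IntervalIntegrable sineWeight volume (1 / 4) (1 / 2) := by
    have h := h1.comp_sub_left (1 / 2)
    simp only [sineWeight_half_sub] at h
    norm_num at h
    exact h.symm
  exact sineWeight_periodic.intervalIntegrable (t := 0) (by norm_num)
    (by simpa using h1.trans h2) a b

/-- The integral of the weight `|sin 2πθ|^{-3/4}` over a period. -/
def sineWeightIntegral : ℝ := ∫ θ in (0 : ℝ)..1, sineWeight θ

theorem sineWeightIntegral_nonneg : 0 ≤ sineWeightIntegral :=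
  intervalIntegral.integral_nonneg zero_le_one fun θ _ => sineWeight_nonneg θ

/-- A regularised weight. -/
def regularWeight (h θ : ℝ) : ℝ := (|Real.sin (2 * Real.pi * θ)| + h) ^ (-(3 / 4) : ℝ)

theorem regularWeight_nonneg {h : ℝ} (hh : 0 < h) (θ : ℝ) : 0 ≤ regularWeight h θ := by
  unfold regularWeight
  positivity

theorem continuous_regularWeight {h : ℝ} (hh : 0 < h) : Continuous (regularWeight h) := by
  unfold regularWeight
  refine Continuous.rpow_const (by fun_prop) fun θ => Or.inl ?_
  positivity

theorem regularWeight_periodic (h : ℝ) : Function.Periodic (regularWeight h) 1 := by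
  intro θ
  rw [regularWeight, regularWeight,
    show 2 * Real.pi * (θ + 1) = 2 * Real.pi * θ + 2 * Real.pi by ring, Real.sin_add_two_pi]

theorem integral_regularWeight_le {h : ℝ} (hh : 0 < h) :
    ∫ θ in (0 : ℝ)..1, regularWeight h θ ≤ sineWeightIntegral := by
  refine intervalIntegral.integral_mono_ae zero_le_one
    ((continuous_regularWeight hh).intervalIntegrable _ _) (intervalIntegrable_sineWeight 0 1) ?_
  filter_upwards [ae_sin_ne_zero] with θ hθ
  exact Real.rpow_le_rpow_of_nonpos (abs_pos.2 hθ) (by linarith) (by norm_num)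

/-- Adding `h` makes the weight comparable with itself over distances up to `h`: the sine changes by
at most `2πh ≤ 7h`, hence the factor `7 + 1 = 8`. -/
theorem regularWeight_le {h x y : ℝ} (hh : 0 < h) (hxy : |x - y| ≤ h) :
    regularWeight h x ≤ 8 * regularWeight h y := by
  have h1 : |Real.sin (2 * Real.pi * y)| ≤ |Real.sin (2 * Real.pi * x)| + 7 * h := by
    have h2 : |Real.sin (2 * Real.pi * y) - Real.sin (2 * Real.pi * x)|
        ≤ |2 * Real.pi * y - 2 * Real.pi * x| := by
      have := Real.lipschitzWith_sin.dist_le_mul (2 * Real.pi * y) (2 * Real.pi * x)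
      simpa [Real.dist_eq] using this
    have h3 : |2 * Real.pi * y - 2 * Real.pi * x| ≤ 7 * h := by
      rw [← mul_sub, abs_mul, abs_sub_comm, abs_of_pos Real.two_pi_pos]
      have := Real.pi_lt_d2
      nlinarith [abs_nonneg (x - y)]
    have h4 := abs_sub_abs_le_abs_sub (Real.sin (2 * Real.pi * y)) (Real.sin (2 * Real.pi * x))
    linarith
  have hx : 0 < |Real.sin (2 * Real.pi * x)| + h := by positivity
  have hy : 0 < |Real.sin (2 * Real.pi * y)| + h := by positivity
  have h5 : (|Real.sin (2 * Real.pi * y)| + h) / 8 ≤ |Real.sin (2 * Real.pi * x)| + h := by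
    linarith [abs_nonneg (Real.sin (2 * Real.pi * x))]
  calc regularWeight h x ≤ ((|Real.sin (2 * Real.pi * y)| + h) / 8) ^ (-(3 / 4) : ℝ) :=
        Real.rpow_le_rpow_of_nonpos (by positivity) h5 (by norm_num)
    _ = (8 : ℝ) ^ (3 / 4 : ℝ) * regularWeight h y := by
        rw [Real.div_rpow hy.le (by norm_num), Real.rpow_neg (by norm_num : (0 : ℝ) ≤ 8), div_inv_eq_mul,
          mul_comm, regularWeight]
    _ ≤ 8 * regularWeight h y := by
        refine mul_le_mul_of_nonneg_right ?_ (regularWeight_nonneg hh y)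
        calc (8 : ℝ) ^ (3 / 4 : ℝ) ≤ 8 ^ (1 : ℝ) :=
              Real.rpow_le_rpow_of_exponent_le (by norm_num) (by norm_num)
          _ = 8 := Real.rpow_one 8

/-- A Riemann sum: each value is at most `8m` times the integral over its cell of length `1/m`, and
the cells tile one period. -/
theorem sum_regularWeight_le {m : ℕ} (hm : 0 < m) (θ : ℝ) :
    ∑ l : Fin m, regularWeight (1 / m) ((θ + (l : ℕ)) / m) ≤ 8 * sineWeightIntegral * m := by
  have hm' : (0 : ℝ) < m := by exact_mod_cast hm
  have hh : (0 : ℝ) < 1 / m := by positivity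
  set g := regularWeight (1 / (m : ℝ)) with hg
  have hgc : Continuous g := continuous_regularWeight hh
  have h1 : ∀ l : ℕ, g ((θ + l) / m) ≤ 8 * m * ∫ x in (θ + l) / m..(θ + (l + 1 : ℕ)) / m, g x := by
    intro l
    have hle : (θ + l) / m ≤ (θ + (l + 1 : ℕ)) / m := by
      push_cast
      gcongr
      linarith
    have hlen : (θ + (l + 1 : ℕ)) / m - (θ + l) / m = 1 / m := by
      push_cast
      ring
    have h2 : ∫ _ in (θ + l) / m..(θ + (l + 1 : ℕ)) / m, g ((θ + l) / m) / 8
        ≤ ∫ x in (θ + l) / m..(θ + (l + 1 : ℕ)) / m, g x := by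
      refine intervalIntegral.integral_mono_on hle (by simp) (hgc.intervalIntegrable _ _)
        fun x hx => ?_
      have := regularWeight_le (x := (θ + l) / m) (y := x) hh (by
        rw [abs_sub_comm, abs_of_nonneg (by linarith [hx.1])]
        linarith [hx.2])
      rw [← hg] at this
      linarith
    rw [intervalIntegral.integral_const, hlen, smul_eq_mul] at h2
    calc g ((θ + l) / m) = 8 * m * (1 / m * (g ((θ + l) / m) / 8)) := by field_simp
      _ ≤ _ := by gcongr
  rw [Fin.sum_univ_eq_sum_range (fun l => g ((θ + l) / m)) m]
  refine (Finset.sum_le_sum fun l _ => h1 l).trans ?_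
  rw [← Finset.mul_sum, intervalIntegral.sum_integral_adjacent_intervals
    (a := fun l : ℕ => (θ + l) / m) fun k _ => hgc.intervalIntegrable _ _]
  have h3 := (regularWeight_periodic (1 / (m : ℝ))).intervalIntegral_add_eq (θ / m) 0
  rw [zero_add, ← hg] at h3
  have h4 : (θ + (m : ℕ)) / m = θ / m + 1 := by field_simp
  simp only [Nat.cast_zero, add_zero]
  rw [h4, h3]
  have := integral_regularWeight_le hh
  rw [← hg] at this
  calc 8 * (m : ℝ) * ∫ x in (0 : ℝ)..1, g x ≤ 8 * m * sineWeightIntegral := by gcongr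
    _ = _ := by ring

/-! ### The refined bound -/

/-- Interpolation that trades a strong singularity in the gaps for an integrable power. -/
theorem min_one_sq_le_rpow {x p : ℝ} (hx : 0 ≤ x) (hp : 0 ≤ p) (hp2 : p ≤ 2) :
    min 1 x ^ 2 ≤ x ^ p := by
  rcases le_total x 1 with h | h
  · rw [min_eq_right h, ← Real.rpow_natCast]
    exact Real.rpow_le_rpow_of_exponent_ge_of_imp hx h (by exact_mod_cast hp2) (fun h0 h2 => by
      norm_num at h2)
  · rw [min_eq_left h, one_pow]
    exact Real.one_le_rpow h hp

/-- With `u = ds` and `W = u^{-3/4}`, the first minimum is interpolated with power `3/4` and the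
second with `1/2`, whose surplus `u^{1/4} ≤ 2` brings it to the same weight. The constant is `6 +
48·4 + 12·16 = 390`. -/
theorem rpow_add_sq_bound {δ ε R B d s m : ℝ} (hδ : 0 ≤ δ) (hδε : δ ≤ ε) (hR : 1 ≤ R) (hB : 1 ≤ B)
    (hd : 0 < d) (hd1 : d ≤ 1) (hs : 0 < s) (hs2 : s ≤ 2) (hm : 1 ≤ m) (hδm : δ * m ^ 3 ≤ 1) :
    (δ + 2 * (2 * R) * min 1 (4 * δ * m * B / (d * s))
        + 2 * R * min 1 (8 * ε * B / (d * s))) ^ 2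
      ≤ 390 * R ^ 2 * B * Real.sqrt ε * (d ^ (-(3 / 4) : ℝ) * s ^ (-(3 / 4) : ℝ)) := by
  have hε : 0 ≤ ε := hδ.trans hδε
  set u := d * s with hu
  have hu0 : 0 < u := mul_pos hd hs
  have hu2 : u ≤ 2 := by nlinarith
  have hW : d ^ (-(3 / 4) : ℝ) * s ^ (-(3 / 4) : ℝ) = u ^ (-(3 / 4) : ℝ) :=
    (Real.mul_rpow hd.le hs.le).symm
  rw [hW]
  set W := u ^ (-(3 / 4) : ℝ) with hWd
  have hW0 : 0 < W := Real.rpow_pos_of_pos hu0 _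
  have h2W : 1 ≤ 2 * W := by
    have h1 : (2 : ℝ) ^ (-(3 / 4) : ℝ) ≤ W := Real.rpow_le_rpow_of_nonpos hu0 hu2 (by norm_num)
    have h2 : (2 : ℝ) ^ (-1 : ℝ) ≤ (2 : ℝ) ^ (-(3 / 4) : ℝ) :=
      Real.rpow_le_rpow_of_exponent_le (by norm_num) (by norm_num)
    rw [Real.rpow_neg_one] at h2
    linarith
  have hδ1 : δ ≤ 1 := by
    have : 1 ≤ m ^ 3 := one_le_pow₀ hm
    nlinarith
  have hsq : Real.sqrt δ ≤ Real.sqrt ε := Real.sqrt_le_sqrt hδε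
  have hsδ : δ ^ 2 ≤ Real.sqrt ε := by
    refine le_trans ?_ hsq
    apply Real.le_sqrt_of_sq_le
    calc (δ ^ 2) ^ 2 = δ * δ ^ 3 := by ring
      _ ≤ δ * 1 := by
        gcongr
        exact pow_le_one₀ hδ hδ1
      _ = δ := mul_one δ
  have hx1 : min 1 (4 * δ * m * B / u) ^ 2 ≤ 4 * B * Real.sqrt ε * W := by
    -- The cubic factor in the approximation rate is matched to the power `3/4`: `δ m³ ≤ 1` is what
    -- makes `(δm)^{3/4} ≤ δ^{1/2}`.
    have e1 : (δ * m) ^ (3 / 4 : ℝ) ≤ Real.sqrt ε := by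
      refine le_trans ?_ hsq
      apply Real.le_sqrt_of_sq_le
      have e2 : ((δ * m) ^ (3 / 4 : ℝ)) ^ 2 = (δ * m) ^ (3 / 2 : ℝ) := by
        rw [← Real.rpow_natCast, ← Real.rpow_mul (by positivity)]
        norm_num
      have e3 : ((δ * m) ^ (3 / 2 : ℝ)) ^ 2 ≤ δ ^ 2 := by
        rw [← Real.rpow_natCast, ← Real.rpow_mul (by positivity)]
        norm_num
        calc (δ * m) ^ 3 = δ ^ 2 * (δ * m ^ 3) := by ring
          _ ≤ δ ^ 2 * 1 := by gcongr
          _ = δ ^ 2 := mul_one _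
      rw [e2]
      exact le_of_sq_le_sq e3 hδ
    have e4 : (4 * B) ^ (3 / 4 : ℝ) ≤ 4 * B := by
      calc (4 * B) ^ (3 / 4 : ℝ) ≤ (4 * B) ^ (1 : ℝ) :=
            Real.rpow_le_rpow_of_exponent_le (by linarith) (by norm_num)
        _ = _ := Real.rpow_one _
    have e5 : (4 * δ * m * B / u) ^ (3 / 4 : ℝ)
        = (4 * B) ^ (3 / 4 : ℝ) * (δ * m) ^ (3 / 4 : ℝ) * W := by
      rw [Real.div_rpow (by positivity) hu0.le, hWd, Real.rpow_neg hu0.le,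
        ← Real.mul_rpow (by positivity) (by positivity), div_eq_mul_inv]
      congr 2
      ring
    refine (min_one_sq_le_rpow (p := 3 / 4) (by positivity) (by norm_num) (by norm_num)).trans ?_
    rw [e5]
    gcongr
  have hx2 : min 1 (8 * ε * B / u) ^ 2 ≤ 16 * B * Real.sqrt ε * W := by
    have e1 : (8 * ε * B / u) ^ (1 / 2 : ℝ)
        = (8 * B) ^ (1 / 2 : ℝ) * Real.sqrt ε * (u ^ (1 / 4 : ℝ) * W) := by
      rw [hWd, ← Real.rpow_add hu0, Real.sqrt_eq_rpow, ← Real.mul_rpow (by positivity) hε,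
        Real.div_rpow (by positivity) hu0.le, div_eq_mul_inv, ← Real.rpow_neg hu0.le]
      congr 2
      · ring
      · norm_num
    have e2 : (8 * B) ^ (1 / 2 : ℝ) ≤ 8 * B := by
      calc (8 * B) ^ (1 / 2 : ℝ) ≤ (8 * B) ^ (1 : ℝ) :=
            Real.rpow_le_rpow_of_exponent_le (by linarith) (by norm_num)
        _ = _ := Real.rpow_one _
    have e3 : u ^ (1 / 4 : ℝ) ≤ 2 := by
      calc u ^ (1 / 4 : ℝ) ≤ 2 ^ (1 / 4 : ℝ) := Real.rpow_le_rpow hu0.le hu2 (by norm_num)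
        _ ≤ 2 ^ (1 : ℝ) := Real.rpow_le_rpow_of_exponent_le (by norm_num) (by norm_num)
        _ = 2 := Real.rpow_one 2
    refine (min_one_sq_le_rpow (p := 1 / 2) (by positivity) (by norm_num) (by norm_num)).trans ?_
    rw [e1]
    calc _ ≤ 8 * B * Real.sqrt ε * (2 * W) := by gcongr
      _ = _ := by ring
  set x := min 1 (4 * δ * m * B / u)
  set y := min 1 (8 * ε * B / u)
  have hS := Real.sqrt_nonneg ε
  have hsq3 : (δ + 2 * (2 * R) * x + 2 * R * y) ^ 2
      ≤ 3 * δ ^ 2 + 48 * R ^ 2 * x ^ 2 + 12 * R ^ 2 * y ^ 2 := by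
    nlinarith [sq_nonneg (δ - 4 * R * x), sq_nonneg (δ - 2 * R * y), sq_nonneg (4 * R * x - 2 * R * y)]
  have hR2 : 1 ≤ R ^ 2 := one_le_pow₀ hR
  have hRB : 1 ≤ R ^ 2 * B := one_le_mul_of_one_le_of_one_le hR2 hB
  have hfirst : 3 * δ ^ 2 ≤ 6 * (R ^ 2 * B) * (Real.sqrt ε * W) := by
    have g1 : Real.sqrt ε ≤ 2 * (Real.sqrt ε * W) := by nlinarith
    have g2 : Real.sqrt ε * W ≤ (R ^ 2 * B) * (Real.sqrt ε * W) :=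
      le_mul_of_one_le_left (by positivity) hRB
    linarith
  have g3 : 48 * R ^ 2 * x ^ 2 ≤ 48 * R ^ 2 * (4 * B * Real.sqrt ε * W) := by gcongr
  have g4 : 12 * R ^ 2 * y ^ 2 ≤ 12 * R ^ 2 * (16 * B * Real.sqrt ε * W) := by gcongr
  have g5 : 0 ≤ R ^ 2 * B * (Real.sqrt ε * W) := by positivity
  nlinarith

end

/-! ### Resonant pairs under approximation by a smaller period. -/

noncomputable section

open scoped InnerProductSpace

namespace JacobiMatrix

theorem norm_delta (n : ℤ) : ‖(lp.single 2 n (1 : ℂ) : Ell2)‖ = 1 := by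
  rw [lp.norm_single (by norm_num)]
  simp

theorem norm_apply_le_norm_op_sub (J J' : JacobiMatrix) (n m : ℤ) :
    ‖J.op (lp.single 2 m 1) n - J'.op (lp.single 2 m 1) n‖ ≤ ‖J.op - J'.op‖ := by
  have h1 := lp.norm_apply_le_norm (p := 2) (by norm_num) ((J.op - J'.op) (lp.single 2 m 1)) n
  have h2 := (J.op - J'.op).le_opNorm (lp.single 2 m 1)
  rw [norm_delta, mul_one] at h2
  exact h1.trans h2

theorem abs_a_sub_le (J J' : JacobiMatrix) (n : ℤ) : |J.a n - J'.a n| ≤ ‖J.op - J'.op‖ := by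
  have h := norm_apply_le_norm_op_sub J J' n (n + 1)
  rw [op_apply, op_apply] at h
  simp only [lp.single_apply, Pi.single_apply] at h
  simp only [show ¬ (n - 1 = n + 1) by omega, show ¬ (n = n + 1) by omega, if_true, if_false,
    mul_zero, mul_one, zero_add, ← Complex.ofReal_sub, Complex.norm_real, Real.norm_eq_abs] at h
  exact h

theorem abs_b_sub_le (J J' : JacobiMatrix) (n : ℤ) : |J.b n - J'.b n| ≤ ‖J.op - J'.op‖ := by
  have h := norm_apply_le_norm_op_sub J J' n n
  rw [op_apply, op_apply] at h
  simp only [lp.single_apply, Pi.single_apply] at h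
  simp only [show ¬ (n - 1 = n) by omega, show ¬ (n + 1 = n) by omega, if_true, if_false,
    mul_zero, mul_one, zero_add, add_zero, ← Complex.ofReal_sub, Complex.norm_real,
    Real.norm_eq_abs] at h
  exact h

variable {J J' : JacobiMatrix} {q q' m : ℕ} [NeZero q] [NeZero q']

/-- The perturbation lemma with `κ = ds/(2mB)` from `lifted_gap` and `g = y/B` from
`lifted_momentum_gap`. Only `κ`, which measures how far the eigenvector moves, contains `m`, and
there it is paired with the tiny `δ`. -/
theorem norm_sq_resonant_component_le (hJ : J.IsPeriodic q) (hJ' : J'.IsPeriodic q')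
    (hq : q = q' * m) {R : ℝ} (hR : 1 ≤ R) (hb' : J'.IsRBounded R)
    {θ : ℝ} (hθ : Real.sin (2 * Real.pi * θ) ≠ 0) {δ ε : ℝ} (hε : 0 < ε) (hδε : δ ≤ ε)
    (hδ : 3 * ‖J.op - J'.op‖ ≤ δ) (hδm : δ * m ^ 3 ≤ 1) (k : Fin q) :
    ‖SpectralBasis.component (J.eigenbasis q θ)
        (Finset.univ.filter fun j => j ≠ k ∧ |J.eigenvalue q j θ - J.eigenvalue q k θ| ≤ ε)
        (J.momentumCLM q θ (J.eigenbasis q θ k))‖ ^ 2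
      ≤ 390 * R ^ 2 * discBound R q' * Real.sqrt ε * (sineWeight θ
        * regularWeight (1 / m) ((θ + (J'.phaseIndex q q' m hJ' hq θ hθ k : ℕ)) / m)) := by
  have hR0 : 0 < R := by linarith
  have hJq' : J'.IsPeriodic q := hq ▸ hJ'.mul m
  have hB := one_le_discBound hR q'
  have hmN : 0 < m := Nat.pos_of_ne_zero fun h => NeZero.ne q (by simpa [h] using hq)
  have hm : (0 : ℝ) < m := by exact_mod_cast hmN
  have hm1 : (1 : ℝ) ≤ m := by exact_mod_cast hmN
  set l := J'.phaseIndex q q' m hJ' hq θ hθ k with hl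
  set d := |Real.sin (2 * Real.pi * θ)| with hd
  set y := |Real.sin (2 * Real.pi * ((θ + (l : ℕ)) / m))| with hy
  set B := discBound R q' with hBdef
  have hd0 : 0 < d := abs_pos.2 hθ
  have hd1 : d ≤ 1 := Real.abs_sin_le_one _
  have hdy : d ≤ m * y := by
    have h := abs_sin_nat_mul_le m (2 * Real.pi * ((θ + (l : ℕ)) / m))
    rw [show (m : ℝ) * (2 * Real.pi * ((θ + (l : ℕ)) / m))
      = 2 * Real.pi * θ + (l : ℕ) * (2 * Real.pi) by field_simp, Real.sin_add_nat_mul_two_pi] at h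
    exact h
  have hy0 : 0 < y := by
    by_contra h
    have : y = 0 := le_antisymm (not_lt.1 h) (abs_nonneg _)
    rw [this, mul_zero] at hdy
    linarith
  have hy1 : y ≤ 1 := Real.abs_sin_le_one _
  set s := y + 1 / m with hs
  have hs0 : 0 < s := by positivity
  have hs2 : s ≤ 2 := by
    have : 1 / (m : ℝ) ≤ 1 := by rw [div_le_one hm]; exact hm1
    linarith
  -- Rewrites the gap `y / B` through `d * s`, so that both minima have the same denominator.
  have hys : d * s ≤ 2 * y := by
    have e1 : d * (1 / m) ≤ y := by
      rw [mul_one_div, div_le_iff₀ hm]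
      linarith
    have e2 : d * y ≤ y := mul_le_of_le_one_left hy0.le hd1
    rw [hs, mul_add]
    linarith
  have hδ0 : 0 ≤ δ := le_trans (by positivity) hδ
  have hTT' : ∀ x, ‖J.floquetCLM q θ x - J'.floquetCLM q θ x‖ ≤ δ * ‖x‖ := fun x =>
    (norm_floquetCLM_sub_le hJ hJq' (abs_a_sub_le J J') (abs_b_sub_le J J') θ x).trans (by gcongr)
  have hAA' : ∀ x, ‖J.momentumCLM q θ x - J'.momentumCLM q θ x‖ ≤ δ * ‖x‖ := fun x =>
    (norm_momentumCLM_sub_le hJ hJq' (abs_a_sub_le J J') θ x).trans (by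
      have : 2 * ‖J.op - J'.op‖ ≤ δ := by linarith [norm_nonneg (J.op - J'.op)]
      gcongr)
  have hκ : 0 < d / m * s / (2 * B) := by positivity
  have hg : 0 < y / B := by positivity
  have key := SpectralBasis.norm_component_apply_eigenvector_le (J.floquetCLM q θ)
    (J'.floquetCLM q θ) (J.momentumCLM q θ) (J'.momentumCLM q θ) (J.eigenbasis q θ)
    (J'.eigenbasis q θ) (fun i => J.eigenvalue q i θ) (fun i => J'.eigenvalue q i θ)
    (J.floquetCLM_eigenbasis q θ) (J'.floquetCLM_eigenbasis q θ) hδ0 hδε hκ hg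
    (by positivity : 0 ≤ 2 * R) hTT' hAA' (norm_momentumCLM_le hJq' hR0 hb' θ) k
    (SpectralBasis.abs_eigenvalue_sub_le _ _ (J.eigenbasis q θ) (J'.eigenbasis q θ) _ _
      (J.floquetCLM_eigenbasis q θ) (J'.floquetCLM_eigenbasis q θ) (J.eigenvalue_mono q θ)
      (J'.eigenvalue_mono q θ) hTT' k)
    (fun a ha => by
      have h := lifted_gap hJ' hq hR hb' hθ ha
      rw [← hl, ← hd, ← hy, ← hs] at h
      rw [div_le_iff₀ (by positivity)]
      linarith)
    (fun a ha h0 => by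
      have h := lifted_momentum_gap hJ' hq hR hb' hθ ha h0
      rw [← hl, ← hy] at h
      rw [div_le_iff₀ (by positivity)]
      linarith)
    (Finset.univ.filter fun j => j ≠ k ∧ |J.eigenvalue q j θ - J.eigenvalue q k θ| ≤ ε)
    (fun j hj => (Finset.mem_filter.1 hj).2)
  have e1 : 2 * δ / (d / m * s / (2 * B)) = 4 * δ * m * B / (d * s) := by
    field_simp
    ring
  have e2 : 4 * ε / (y / B) ≤ 8 * ε * B / (d * s) := by
    rw [div_div_eq_mul_div, div_le_div_iff₀ hy0 (by positivity)]
    calc 4 * ε * B * (d * s) ≤ 4 * ε * B * (2 * y) := by gcongr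
      _ = _ := by ring
  have e3 : min 1 (4 * ε / (y / B)) ≤ min 1 (8 * ε * B / (d * s)) := min_le_min_left _ e2
  have key2 : ‖SpectralBasis.component (J.eigenbasis q θ)
        (Finset.univ.filter fun j => j ≠ k ∧ |J.eigenvalue q j θ - J.eigenvalue q k θ| ≤ ε)
        (J.momentumCLM q θ (J.eigenbasis q θ k))‖
      ≤ δ + 2 * (2 * R) * min 1 (4 * δ * m * B / (d * s))
        + 2 * R * min 1 (8 * ε * B / (d * s)) := by
    rw [e1] at key
    refine key.trans ?_
    gcongr
  refine (pow_le_pow_left₀ (norm_nonneg _) key2 2).trans ?_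
  exact rpow_add_sq_bound hδ0 hδε hR hB hd0 hd1 hs0 hs2 hm1 hδm

/-- Each phase occurs at most `q'` times and the weights of the phases sum to at most `8m` times the
weight integral, so `3120 = 390 · 8` and `q' m = q`. -/
theorem hsNormSq_le_of_approx (hJ : J.IsPeriodic q) (hJ' : J'.IsPeriodic q')
    (hq : q = q' * m) {R : ℝ} (hR : 1 ≤ R) (hb : J.IsRBounded R) (hb' : J'.IsRBounded R)
    {θ : ℝ} (hθ : Real.sin (2 * Real.pi * θ) ≠ 0) {t : ℝ} (ht : t ≠ 0)
    {δ ε : ℝ} (hε : 0 < ε) (hδε : δ ≤ ε)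
    (hδ : 3 * ‖J.op - J'.op‖ ≤ δ) (hδm : δ * m ^ 3 ≤ 1) :
    hsNormSq (J.velocityFiber q θ - J.timeAverageFiber q t θ)
      ≤ 16 * R ^ 2 * q / (t ^ 2 * ε ^ 2)
        + 3120 * sineWeightIntegral * R ^ 2 * q * discBound R q' * Real.sqrt ε
          * sineWeight θ := by
  have hB := one_le_discBound hR q'
  have hmN : 0 < m := Nat.pos_of_ne_zero fun h => NeZero.ne q (by simpa [h] using hq)
  have hm : (0 : ℝ) < m := by exact_mod_cast hmN
  have hW := sineWeight_nonneg θ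
  refine (hsNormSq_le_sum_component hJ (by linarith) hb hθ ht hε).trans (add_le_add_right ?_ _)
  refine (Finset.sum_le_sum fun k _ => norm_sq_resonant_component_le hJ hJ' hq hR hb' hθ hε hδε
    hδ hδm k).trans ?_
  rw [← Finset.mul_sum, ← Finset.mul_sum]
  have h1 := sum_phaseIndex_le hJ' hq hθ
    (fun l : Fin m => regularWeight (1 / m) ((θ + (l : ℕ)) / m))
    (fun l => regularWeight_nonneg (by positivity) _)
  have h2 := sum_regularWeight_le hmN θ
  have h3 : ∑ k, regularWeight (1 / m) ((θ + (J'.phaseIndex q q' m hJ' hq θ hθ k : ℕ)) / m)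
      ≤ 8 * sineWeightIntegral * q := by
    refine h1.trans ?_
    calc (q' : ℝ) * ∑ l : Fin m, regularWeight (1 / m) ((θ + (l : ℕ)) / m)
        ≤ q' * (8 * sineWeightIntegral * m) := by gcongr
      _ = 8 * sineWeightIntegral * q := by
          rw [hq]
          push_cast
          ring
  calc _ ≤ 390 * R ^ 2 * discBound R q' * Real.sqrt ε
        * (sineWeight θ * (8 * sineWeightIntegral * q)) := by gcongr
    _ = _ := by ring

/-- Integration of a bound by a multiple of the weight. -/
theorem integral_hsNormSq_le (hJ : J.IsPeriodic q) {R : ℝ} (hR : 0 < R) (hb : J.IsRBounded R)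
    {t : ℝ} (ht : t ≠ 0) {A D : ℝ}
    (h : ∀ θ, Real.sin (2 * Real.pi * θ) ≠ 0 →
      hsNormSq (J.velocityFiber q θ - J.timeAverageFiber q t θ) ≤ A + D * sineWeight θ) :
    ∫ θ in (0 : ℝ)..1, hsNormSq (J.velocityFiber q θ - J.timeAverageFiber q t θ)
      ≤ A + D * sineWeightIntegral := by
  have hi := (intervalIntegrable_sineWeight 0 1).const_mul D
  calc _ ≤ ∫ θ in (0 : ℝ)..1, (A + D * sineWeight θ) := by
        refine intervalIntegral.integral_mono_ae zero_le_one
          (intervalIntegrable_hsNormSq hJ hR hb ht) (intervalIntegrable_const.add hi) ?_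
        filter_upwards [ae_sin_ne_zero] with θ hθ
        exact h θ hθ
    _ = _ := by
        rw [intervalIntegral.integral_add intervalIntegrable_const hi,
          intervalIntegral.integral_const, intervalIntegral.integral_const_mul]
        simp [sineWeightIntegral]

/-- The velocity operator, and its `ℓ¹ → ℓ²` distance to the time averages. -/
theorem exists_velocity (hJ : J.IsPeriodic q) {R : ℝ} (hR : 0 < R) (hb : J.IsRBounded R) :
    ∃ Q : Ell2 →L[ℂ] Ell2, HasFloquetFibers q Q (J.velocityFiber q) ∧ ∀ t : ℝ, t ≠ 0 →
      normOneTwo (Q - J.timeAverage t) ^ 2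
        ≤ ∫ θ in (0 : ℝ)..1, hsNormSq (J.velocityFiber q θ - J.timeAverageFiber q t θ) := by
  obtain ⟨Q, hQ⟩ := exists_hasCircleFibers_velocityFun hJ hR hb
  refine ⟨Q, hQ.hasFloquetFibers fun θ hθ => velocityFun_coe J hθ, fun t ht => ?_⟩
  refine normOneTwo_sq_le ((hQ.sub (hasCircleFibers_timeAverage hJ t)).hasFloquetFibers
    (N := fun θ => J.velocityFiber q θ - J.timeAverageFiber q t θ) fun θ hθ => ?_)
    (intervalIntegrable_hsNormSq hJ hR hb ht)
  rw [velocityFun_coe J hθ]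
  exact congrArg (fun M => J.velocityFiber q θ - M) (averageFun_coe J q t θ)

end JacobiMatrix

/-! ### The constant -/

open JacobiMatrix

/-- The constant in the lower bound for the slopes of the eigenvalues. -/
def slopeConstant (R : ℝ) : ℝ :=
  2 * (Real.log (14 * max 1 R ^ 2)
    + Real.log (3120 * (sineWeightIntegral ^ 2 + sineWeightIntegral + 1)) + 1)

theorem slopeConstant_pos (R : ℝ) : 0 < slopeConstant R := by
  have hC := sineWeightIntegral_nonneg
  have h1 : 0 ≤ Real.log (14 * max 1 R ^ 2) := by
    apply Real.log_nonneg
    nlinarith [le_max_left 1 R]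
  have h2 : 0 ≤ Real.log (3120 * (sineWeightIntegral ^ 2 + sineWeightIntegral + 1)) := by
    apply Real.log_nonneg
    nlinarith
  unfold slopeConstant
  linarith

/-- The exponential equals `B_q K^q e^q` by the choice of the constant, with `K ≤ K^q` and `q ≤
e^q`. It thus absorbs every numerical prefactor of both estimates. -/
theorem le_exp_slopeConstant {R : ℝ} (hR : 1 ≤ R) {q : ℕ} (hq : 1 ≤ q) :
    discBound R q * (3120 * (sineWeightIntegral ^ 2 + sineWeightIntegral + 1)) * q
      ≤ Real.exp (slopeConstant R * q / 2) := by
  have hC := sineWeightIntegral_nonneg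
  set K := 3120 * (sineWeightIntegral ^ 2 + sineWeightIntegral + 1) with hK
  have hK1 : 1 ≤ K := by nlinarith
  have hpos : 0 < 14 * R ^ 2 := by positivity
  have h1 : Real.exp (slopeConstant R * q / 2) = discBound R q * K ^ q * Real.exp q := by
    rw [slopeConstant, max_eq_right hR, ← hK,
      show 2 * (Real.log (14 * R ^ 2) + Real.log K + 1) * q / 2
        = q * Real.log (14 * R ^ 2) + q * Real.log K + q by ring,
      Real.exp_add, Real.exp_add, Real.exp_nat_mul, Real.exp_nat_mul, Real.exp_log hpos,
      Real.exp_log (by linarith), discBound]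
  have h2 : (q : ℝ) ≤ Real.exp q := by
    have := Real.add_one_le_exp (q : ℝ)
    linarith
  have h3 : K ≤ K ^ q := le_self_pow₀ hK1 (by omega)
  have hB := one_le_discBound hR q
  rw [h1]
  gcongr

theorem isSlopeConstant_slopeConstant {R : ℝ} (hR : 0 < R) :
    IsSlopeConstant R (slopeConstant R) := by
  intro q J hb hJ j θ
  have hR1 := JacobiMatrix.one_le_of_isRBounded hR hb
  have hq : 1 ≤ (q : ℕ) := q.pos
  have h1 := JacobiMatrix.sin_le_discBound_mul_deriv hJ hR1 hb j θ
  have h2 := le_exp_slopeConstant hR1 hq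
  have hC := sineWeightIntegral_nonneg
  have hB := one_le_discBound hR1 q
  have hq' : (1 : ℝ) ≤ (q : ℕ) := by exact_mod_cast hq
  have hcp := slopeConstant_pos R
  have h3 : discBound R q ≤ Real.exp (slopeConstant R * (q : ℕ)) := by
    calc discBound R q
        ≤ discBound R q * (3120 * (sineWeightIntegral ^ 2 + sineWeightIntegral + 1)) * (q : ℕ) := by
          rw [mul_assoc]
          refine le_mul_of_one_le_right (by positivity) ?_
          nlinarith
      _ ≤ _ := h2
      _ ≤ _ := by
          gcongr
          have : 0 ≤ slopeConstant R * (q : ℕ) := by positivity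
          linarith
  rw [neg_mul, Real.exp_neg, inv_mul_le_iff₀ (Real.exp_pos _)]
  refine h1.trans ?_
  gcongr

/-! ### The two estimates -/

namespace JacobiMatrix

variable {J J' : JacobiMatrix} {q q' m : ℕ} [NeZero q] [NeZero q']

-- The periods tend to infinity, and `q ≥ 4` gives `16q ≤ 4q²`, the form required in both estimates.
omit [NeZero q] in
theorem nonresonant_le {R t ε : ℝ} (hq : 4 ≤ q) :
    16 * R ^ 2 * q / (t ^ 2 * ε ^ 2) ≤ 4 * R ^ 2 * (q : ℝ) ^ 2 / (t ^ 2 * ε ^ 2) := by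
  have : (4 : ℝ) ≤ q := by exact_mod_cast hq
  have h2 : 16 * R ^ 2 * q ≤ 4 * R ^ 2 * (q : ℝ) ^ 2 := by
    calc 16 * R ^ 2 * q = 4 * R ^ 2 * (4 * q) := by ring
      _ ≤ 4 * R ^ 2 * (q * q) := by gcongr
      _ = _ := by ring
  gcongr

theorem integral_hsNormSq_le_of_gap (hJ : J.IsPeriodic q) {R : ℝ} (hR : 1 ≤ R)
    (hb : J.IsRBounded R) (hq4 : 4 ≤ q) {t : ℝ} (ht : t ≠ 0) {ε : ℝ} (hε : 0 < ε) :
    ∫ θ in (0 : ℝ)..1, hsNormSq (J.velocityFiber q θ - J.timeAverageFiber q t θ)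
      ≤ 4 * R ^ 2 * (q : ℝ) ^ 2 / (t ^ 2 * ε ^ 2)
        + 64 * R ^ 2 * Real.exp (slopeConstant R * q / 2) * Real.sqrt ε := by
  have hC := sineWeightIntegral_nonneg
  have hB := one_le_discBound hR q
  refine (integral_hsNormSq_le hJ (by linarith) hb ht
    fun θ hθ => hsNormSq_le_of_gap hJ hR hb hθ ht hε).trans
    (add_le_add (nonresonant_le hq4) ?_)
  rw [Real.sqrt_mul (by positivity)]
  have h1 : Real.sqrt (discBound R q) ≤ discBound R q := by
    rw [Real.sqrt_le_left (by positivity)]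
    nlinarith
  have h2 := le_exp_slopeConstant hR (q := q) (by omega)
  have h3 : q * (Real.sqrt (discBound R q) * sineWeightIntegral)
      ≤ Real.exp (slopeConstant R * q / 2) := by
    refine le_trans ?_ h2
    calc q * (Real.sqrt (discBound R q) * sineWeightIntegral)
        ≤ q * (discBound R q * (3120 * (sineWeightIntegral ^ 2 + sineWeightIntegral + 1))) := by
          gcongr
          nlinarith
      _ = _ := by ring
  calc 4 * R ^ 2 * q * (Real.sqrt (discBound R q) * Real.sqrt ε) * sineWeightIntegral
      = 4 * R ^ 2 * (q * (Real.sqrt (discBound R q) * sineWeightIntegral)) * Real.sqrt ε := by ring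
    _ ≤ 64 * R ^ 2 * Real.exp (slopeConstant R * q / 2) * Real.sqrt ε := by
        gcongr
        norm_num

/-- The weight integral enters squared: once from the sum over Bloch phases and once from
integrating over `θ`. Only the exponential in `q'` has to absorb it, as the factor `q` is kept. -/
theorem integral_hsNormSq_le_of_approx (hJ : J.IsPeriodic q) (hJ' : J'.IsPeriodic q')
    (hq : q' ∣ q) {R : ℝ} (hR : 1 ≤ R) (hb : J.IsRBounded R) (hb' : J'.IsRBounded R)
    (hq4 : 4 ≤ q) {t : ℝ} (ht : t ≠ 0) {δ ε : ℝ} (hε : 0 < ε) (hδε : δ ≤ ε)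
    (hδ : 3 * ‖J.op - J'.op‖ ≤ δ) (hδq : δ * (q : ℝ) ^ 3 ≤ 1) :
    ∫ θ in (0 : ℝ)..1, hsNormSq (J.velocityFiber q θ - J.timeAverageFiber q t θ)
      ≤ 4 * R ^ 2 * (q : ℝ) ^ 2 / (t ^ 2 * ε ^ 2)
        + 16 * R ^ 2 * (q : ℝ) * Real.exp (slopeConstant R * q' / 2) * Real.sqrt ε := by
  have hC := sineWeightIntegral_nonneg
  have hB := one_le_discBound hR q'
  obtain ⟨m, hqm⟩ := hq
  have hδ0 : 0 ≤ δ := le_trans (by positivity) hδ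
  have hq' : 1 ≤ q' := NeZero.one_le
  have hq'R : (1 : ℝ) ≤ q' := by exact_mod_cast hq'
  have hδm : δ * (m : ℝ) ^ 3 ≤ 1 := by
    refine le_trans ?_ hδq
    have : (m : ℝ) ≤ q := by
      rw [hqm]
      push_cast
      exact le_mul_of_one_le_left (by positivity) hq'R
    gcongr
  refine (integral_hsNormSq_le hJ (by linarith) hb ht
    fun θ hθ => hsNormSq_le_of_approx hJ hJ' hqm hR hb hb' hθ ht hε hδε hδ hδm).trans
    (add_le_add (nonresonant_le hq4) ?_)
  have h2 := le_exp_slopeConstant hR hq'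
  have h3 : 3120 * sineWeightIntegral ^ 2 * discBound R q'
      ≤ 16 * Real.exp (slopeConstant R * q' / 2) := by
    have h4 : 3120 * sineWeightIntegral ^ 2 * discBound R q'
        ≤ discBound R q' * (3120 * (sineWeightIntegral ^ 2 + sineWeightIntegral + 1)) * q' := by
      calc 3120 * sineWeightIntegral ^ 2 * discBound R q'
          = discBound R q' * (3120 * sineWeightIntegral ^ 2) * 1 := by ring
        _ ≤ _ := by
          gcongr
          linarith
    linarith [Real.exp_pos (slopeConstant R * q' / 2)]
  calc 3120 * sineWeightIntegral * R ^ 2 * q * discBound R q' * Real.sqrt ε * sineWeightIntegral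
      = R ^ 2 * q * (3120 * sineWeightIntegral ^ 2 * discBound R q') * Real.sqrt ε := by ring
    _ ≤ R ^ 2 * q * (16 * Real.exp (slopeConstant R * q' / 2)) * Real.sqrt ε := by gcongr
    _ = _ := by ring

end JacobiMatrix

/-! ### Exponential approximation -/

theorem IsExpApprox.lt {η : ℝ} {J : JacobiMatrix} {q : ℕ → ℕ+} {Jq : ℕ → JacobiMatrix}
    (h : IsExpApprox η J q Jq) (n : ℕ) : (q n : ℕ) < q (n + 1) :=
  lt_of_le_of_ne (Nat.le_of_dvd (q (n + 1)).pos (h.dvd n)) fun e => h.ne n (PNat.coe_injective e)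

theorem IsExpApprox.le_period {η : ℝ} {J : JacobiMatrix} {q : ℕ → ℕ+} {Jq : ℕ → JacobiMatrix}
    (h : IsExpApprox η J q Jq) (n : ℕ) : n ≤ (q n : ℕ) :=
  (strictMono_nat_of_lt_succ h.lt).le_apply

/-- Each of the two approximants is eventually within one sixth of the rate of `J`, the later one
because its own rate is smaller. The triangle inequality and the factor 3 give exactly one. -/
theorem IsExpApprox.eventually_norm_sub_le {η : ℝ} (hη : 0 < η) {J : JacobiMatrix} {q : ℕ → ℕ+}
    {Jq : ℕ → JacobiMatrix} (h : IsExpApprox η J q Jq) :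
    ∀ᶠ n in atTop, 3 * ‖(Jq (n + 1)).op - (Jq n).op‖ ≤ gammaRate η q (n + 1) := by
  have h1 := h.tendsto.eventually_le_const (u := 1 / 6) (by norm_num)
  filter_upwards [h1, (tendsto_add_atTop_nat 1).eventually h1] with n h2 h3
  set E := Real.exp (η * (q n : ℕ)) with hE
  set N : ℝ := ((q (n + 1) : ℕ) : ℝ) with hN
  have hE0 : 0 < E := Real.exp_pos _
  have hN0 : 0 < N := by
    have := (q (n + 1)).pos
    rw [hN]
    exact_mod_cast this
  have h4 : N ^ 3 * E * ‖J.op - (Jq (n + 1)).op‖ ≤ 1 / 6 := by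
    refine le_trans ?_ h3
    have e1 : N ≤ ((q (n + 1 + 1) : ℕ) : ℝ) :=
      Nat.cast_le.2 (h.lt (n + 1)).le
    have e2 : E ≤ Real.exp (η * (q (n + 1) : ℕ)) := by
      have : ((q n : ℕ) : ℝ) ≤ (q (n + 1) : ℕ) := by exact_mod_cast (h.lt n).le
      rw [hE]
      gcongr
    gcongr
  have h5 : gammaRate η q (n + 1) = 1 / (N ^ 3 * E) := by
    rw [gammaRate, Nat.add_sub_cancel, neg_mul, Real.exp_neg, ← hE, ← hN]
    field_simp
  rw [h5, le_div_iff₀ (by positivity)]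
  have h6 : ‖(Jq (n + 1)).op - (Jq n).op‖ ≤ ‖J.op - (Jq n).op‖ + ‖J.op - (Jq (n + 1)).op‖ := by
    calc ‖(Jq (n + 1)).op - (Jq n).op‖
        = ‖(J.op - (Jq n).op) - (J.op - (Jq (n + 1)).op)‖ := by congr 1; abel
      _ ≤ _ := norm_sub_le _ _
  have hP : 0 < N ^ 3 * E := by positivity
  calc 3 * ‖(Jq (n + 1)).op - (Jq n).op‖ * (N ^ 3 * E)
      ≤ 3 * (‖J.op - (Jq n).op‖ + ‖J.op - (Jq (n + 1)).op‖) * (N ^ 3 * E) := by gcongr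
    _ = 3 * (N ^ 3 * E * ‖J.op - (Jq n).op‖ + N ^ 3 * E * ‖J.op - (Jq (n + 1)).op‖) := by ring
    _ ≤ 1 := by linarith

theorem gammaRate_mul_le_one {η : ℝ} (hη : 0 < η) (q : ℕ → ℕ+) (n : ℕ) :
    gammaRate η q n * ((q n : ℕ) : ℝ) ^ 3 ≤ 1 := by
  have : (0 : ℝ) < (q n : ℕ) := by exact_mod_cast (q n).pos
  rw [gammaRate, div_mul_cancel₀ _ (by positivity), Real.exp_le_one_iff, neg_mul]
  exact neg_nonpos.2 (by positivity)

theorem gammaRate_pos (η : ℝ) (q : ℕ → ℕ+) (n : ℕ) : 0 < gammaRate η q n := by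
  have : (0 : ℝ) < (q n : ℕ) := by exact_mod_cast (q n).pos
  unfold gammaRate
  positivity

end

theorem theorem4p1 (R : ℝ) (hR : 0 < R) :
    ∃ c₁ : ℝ, 0 < c₁ ∧ IsSlopeConstant R c₁ ∧
      ∀ (η : ℝ) (J : JacobiMatrix) (q : ℕ → ℕ+) (Jq : ℕ → JacobiMatrix),
        7 * c₁ < η → J.IsRBounded R → IsExpApprox η J q Jq →
        (∀ᶠ n in atTop, (Jq n).IsRBounded R) →
        ∀ᶠ n in atTop, ∃ Q : Ell2 →L[ℂ] Ell2,
          HasFloquetFibers (q n) Q ((Jq n).velocityFiber (q n)) ∧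
          ∀ t : ℝ, t ≠ 0 →
            IntervalIntegrable
              (fun θ => hsNormSq ((Jq n).velocityFiber (q n) θ - (Jq n).timeAverageFiber (q n) t θ))
              volume 0 1 ∧
            normOneTwo (Q - (Jq n).timeAverage t) ^ 2 ≤
              (∫ θ in (0 : ℝ)..1,
                hsNormSq
                  ((Jq n).velocityFiber (q n) θ - (Jq n).timeAverageFiber (q n) t θ)) ∧
            (∀ ε : ℝ, 0 < ε →
              (∫ θ in (0 : ℝ)..1,
                  hsNormSq
                    ((Jq n).velocityFiber (q n) θ - (Jq n).timeAverageFiber (q n) t θ)) ≤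
                4 * R ^ 2 * (q n : ℝ) ^ 2 / (t ^ 2 * ε ^ 2)
                  + 64 * R ^ 2 * Real.exp (c₁ * (q n : ℝ) / 2) * Real.sqrt ε) ∧
            (∀ ε : ℝ, gammaRate η q n < ε →
              (∫ θ in (0 : ℝ)..1,
                  hsNormSq
                    ((Jq n).velocityFiber (q n) θ - (Jq n).timeAverageFiber (q n) t θ)) ≤
                4 * R ^ 2 * (q n : ℝ) ^ 2 / (t ^ 2 * ε ^ 2)
                  + 16 * R ^ 2 * (q n : ℝ) * Real.exp (c₁ * (q (n - 1) : ℝ) / 2)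
                    * Real.sqrt ε) := by
  refine ⟨slopeConstant R, slopeConstant_pos R, isSlopeConstant_slopeConstant hR, ?_⟩
  intro η J q Jq hη hJb hE hb
  have hR1 := JacobiMatrix.one_le_of_isRBounded hR hJb
  have hη0 : 0 < η := by linarith [slopeConstant_pos R]
  -- The index is shifted so that `q (n - 1)` is the true preceding period, not the truncated
  -- subtraction at zero.
  rw [← map_add_atTop_eq_nat 1, eventually_map]
  filter_upwards [hb, (tendsto_add_atTop_nat 1).eventually hb, hE.eventually_norm_sub_le hη0,
    eventually_ge_atTop 3] with n hb' hb hδ hn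
  have hper := hE.periodic (n + 1)
  have hq4 : 4 ≤ (q (n + 1) : ℕ) := le_trans (by omega) (hE.le_period (n + 1))
  obtain ⟨Q, hQ, hQt⟩ := JacobiMatrix.exists_velocity hper hR hb
  refine ⟨Q, hQ, fun t ht => ⟨JacobiMatrix.intervalIntegrable_hsNormSq hper hR hb ht, hQt t ht,
    fun ε hε => JacobiMatrix.integral_hsNormSq_le_of_gap hper hR1 hb hq4 ht hε, fun ε hε => ?_⟩⟩
  -- Here `δ` is the rate `gammaRate` itself: it dominates three times the distance of consecutive
  -- approximants, lies below `ε`, and satisfies `δ q³ ≤ 1`.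
  exact JacobiMatrix.integral_hsNormSq_le_of_approx hper (hE.periodic n) (hE.dvd n) hR1 hb hb' hq4
    ht ((gammaRate_pos η q _).trans hε) hε.le hδ (gammaRate_mul_le_one hη0 q _)
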